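/- \textbf{Setting.} There are $m$ unit-demand agents and $n$ items, with $k_j\ge 0$ copies of item $j$. The value $v_{ij}\ge 0$ of agent $i$ for item $j$ is drawn from a probability distribution $F_{ij}$ on $[0,\infty)$, and all $mn$ values are independent. A set $S$ of pairs $(i,j)$ is feasible if it contains at most one pair for each agent $i$ and at most $k_j$ pairs for each item $j$. Let $\mathrm{OPT}$ be the supremum of the expected revenues of all deterministic, dominant-strategy truthful, individually rational (measurable) mechanisms that allocate feasible sets (served agents pay at most their value, unserved agents pay nothing). Prices $p_{ij}\ge 0$ define an order-oblivious posted pricing (OPM): agents arrive in an arbitrary order, and each arriving agent is offered the items of which a copy is left at her prices $p_{ij}$; she takes an item maximizing $v_{ij}-p_{ij}$ (ties broken arbitrarily), and takes nothing only if $v_{ij}<p_{ij}$ for all items offered. Let $$\mathcal R(p)=\mathbb E_{v}\Big[\min_{S}\sum_{(i,j)\in S}p_{ij}\Big],$$ where $S$ ranges over the maximal feasible sets of pairs satisfying $v_{ij}\ge p_{ij}$. Call $p$ a \emph{truthful $6.75$-approximate OPM} if $\mathrm{OPT}\le 6.75\,\mathcal R(p)$ and, for every arrival order and every tie-breaking,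 the posted pricing is a feasible, dominant-strategy truthful, individually rational mechanism whose revenue on every value profile $v$ is at least $\min_{S}\sum_{(i,j)\in S}p_{ij}$. \textbf{Theorem.} (1) If for all $i,j$ the monopoly revenue $\sup_{p\ge0}p\,\Pr[v_{ij}\ge p]$ is finite, then there exists a truthful $6.75$-approximate OPM. (2) Such prices can be computed in polynomial time: there are a single real-RAM program and a polynomial $P$ such that, on every instance, the program performs at most $P(m+n)$ steps and outputs prices of a truthful $6.75$-approximate OPM. The program receives $m$, $n$, the $k_j$, and access to the distributions through oracles that return, for given $i,j$: the acceptance probability $\Pr[v_{ij}\ge p]$ of a price $p$ (that is, $1-F_{ij}(p)$ for a continuous distribution function $F_{ij}$); the quantile $F_{ij}^{-1}(a)=\min\{x\ge 0:F_{ij}(x)\ge a\}$ for $0<a<1$; and, for $x\ge0$, an optimal price, i.e. a maximizer of $p\,\Pr[v_{ij}\ge p]$ over $p\ge x$ (assumed to exist in this part). Each field operation on reals, addition or subtraction of natural numbers, comparison, memory access and oracle call costs one step. -/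

import Mathlib

open MeasureTheory
open scoped NNReal ENNReal

/-! ## Markets with several copies of several items and unit-demand agents -/

/-- An agent-item pair `(i, j)`: the service "agent `i` gets a copy of item `j`". -/
abbrev Service (m n : ℕ) : Type := Fin m × Fin n

/-- A value (or bid) profile: the value of every agent for every item. -/
abbrev Profile (m n : ℕ) : Type := Service m n → ℝ≥0

/-- `m` unit-demand agents, `n` items, `copies j` copies of item `j`; the value of agent `i` for
item `j` has law `dist (i, j)`, an arbitrary probability distribution on `[0, ∞)`. -/
structure Market (m n : ℕ) where
  copies : Fin n → ℕ
  dist : Service m n → Measure ℝ≥0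
  isProb : ∀ s, IsProbabilityMeasure (dist s)

attribute [instance] Market.isProb

namespace Market

variable {m n : ℕ}

/-- The law of the value profile: all values are independent. -/
noncomputable def law (I : Market m n) : Measure (Profile m n) := Measure.pi I.dist

/-- The probability that the value of a service is at least `p`. -/
noncomputable def acceptProb (I : Market m n) (s : Service m n) (p : ℝ) : ℝ :=
  (I.dist s).real {v | p ≤ (v : ℝ)}

/-- Selling a single service at a posted price has bounded expected revenue. -/
def FiniteMonopolyRevenue (I : Market m n) : Prop :=
  ∀ s, ∃ B : ℝ, ∀ p : ℝ, 0 ≤ p → p * I.acceptProb s p ≤ B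

/-- The set system: at most one item per agent, at most `copies j` copies of item `j`. -/
def Feasible (I : Market m n) (S : Finset (Service m n)) : Prop :=
  (∀ i, (S.filter fun s => s.1 = i).card ≤ 1) ∧
    ∀ j, (S.filter fun s => s.2 = j).card ≤ I.copies j

end Market

/-! ## Deterministic direct mechanisms -/

/-- A deterministic direct mechanism: every bid profile is mapped to an assignment of at most one
item to each agent and to a payment (possibly negative) of each agent. -/
structure Mechanism (m n : ℕ) where
  alloc : Profile m n → Fin m → Option (Fin n)
  pay : Profile m n → Fin m → ℝ

namespace Mechanism

variable {m n : ℕ}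

/-- The set of services allocated on the bids `b`. -/
def served (M : Mechanism m n) (b : Profile m n) : Finset (Service m n) :=
  Finset.univ.filter fun s => M.alloc b s.1 = some s.2

/-- The mechanism only selects feasible allocations. -/
def IsFeasible (M : Mechanism m n) (I : Market m n) : Prop :=
  ∀ b, I.Feasible (M.served b)

/-- The utility of agent `i` whose values are those in `v`, when the bids are `b`. -/
def utility (M : Mechanism m n) (v b : Profile m n) (i : Fin m) : ℝ :=
  (match M.alloc b i with
    | some j => (v (i, j) : ℝ)
    | none => 0) - M.pay b i

/-- Bidding the true values is a dominant strategy. -/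
def IsTruthful (M : Mechanism m n) : Prop :=
  ∀ (i : Fin m) (v b : Profile m n), (∀ s, s.1 ≠ i → b s = v s) →
    M.utility v b i ≤ M.utility v v i

/-- A served agent pays at most her bid for the item she gets, an unserved agent pays nothing. -/
def IsIndividuallyRational (M : Mechanism m n) : Prop :=
  ∀ (b : Profile m n) (i : Fin m),
    (∀ j, M.alloc b i = some j → M.pay b i ≤ b (i, j)) ∧ (M.alloc b i = none → M.pay b i = 0)

/-- The allocation and the payments are measurable functions of the bids. -/
def IsMeasurable (M : Mechanism m n) : Prop :=
  (∀ i o, MeasurableSet {b | M.alloc b i = o}) ∧ ∀ i, Measurable fun b => M.pay b i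

/-- The total payment. -/
def revenue (M : Mechanism m n) (b : Profile m n) : ℝ := ∑ i, M.pay b i

/-- The expected revenue (under truthful bidding), `E[R⁺] - E[R⁻]`. -/
noncomputable def expectedRevenue (M : Mechanism m n) (I : Market m n) : EReal :=
  ((∫⁻ v, ENNReal.ofReal (M.revenue v) ∂I.law : ℝ≥0∞) : EReal) -
    ((∫⁻ v, ENNReal.ofReal (-M.revenue v) ∂I.law : ℝ≥0∞) : EReal)

end Mechanism

/-- The optimal revenue: the supremum of the expected revenues of the deterministic, truthful,
individually rational mechanisms. -/
noncomputable def Market.optRevenue {m n : ℕ} (I : Market m n) : EReal :=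
  ⨆ M ∈ {M : Mechanism m n | M.IsFeasible I ∧ M.IsMeasurable ∧ M.IsTruthful ∧
    M.IsIndividuallyRational}, M.expectedRevenue I

/-! ## Order-oblivious posted pricings -/

section OPM

variable {m n : ℕ}

/-- A pure purchasing behaviour of the agents: from her identity, her values and the menu of items
on offer, each agent picks an item or nothing. -/
abbrev Behaviour (m n : ℕ) : Type :=
  Fin m → (Fin n → ℝ≥0) → Finset (Fin n) → Option (Fin n)

/-- Each agent buys an item of the menu that maximizes value minus price, ties broken in any way,
and buys nothing only if all items on the menu cost more than she values them. -/
def Behaviour.IsRational (c : Behaviour m n) (p : Service m n → ℝ≥0) : Prop :=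
  ∀ (i : Fin m) (w : Fin n → ℝ≥0) (T : Finset (Fin n)),
    match c i w T with
    | some j => j ∈ T ∧ p (i, j) ≤ w j ∧
        ∀ j' ∈ T, (w j' : ℝ) - p (i, j') ≤ (w j : ℝ) - p (i, j)
    | none => ∀ j ∈ T, w j < p (i, j)

/-- The items of which a copy is left after the allocation `A`. -/
def Market.available (I : Market m n) (A : Fin m → Option (Fin n)) : Finset (Fin n) :=
  Finset.univ.filter fun j => (Finset.univ.filter fun i => A i = some j).card < I.copies j

/-- Approach the listed agents in turn and let each choose from the menu of available items. -/
def Market.offer (I : Market m n) (c : Behaviour m n) (v : Profile m n) :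
    List (Fin m) → (Fin m → Option (Fin n)) → (Fin m → Option (Fin n))
  | [], A => A
  | i :: l, A =>
      I.offer c v l (Function.update A i (c i (fun j => v (i, j)) (I.available A)))

/-- The posted pricing with prices `p`, when the agents arrive in the order `σ 0, σ 1, …` and
choose according to `c`. -/
def Market.postedPricing (I : Market m n) (p : Service m n → ℝ≥0) (σ : Equiv.Perm (Fin m))
    (c : Behaviour m n) : Mechanism m n where
  alloc b := I.offer c b (List.ofFn σ) (fun _ => none)
  pay b i :=
    match I.offer c b (List.ofFn σ) (fun _ => none) i with
    | some j => (p (i, j) : ℝ)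
    | none => 0

/-- `S` is a maximal feasible set of services that are desired at the prices `p`. -/
def Market.IsMaximalDesired (I : Market m n) (p : Service m n → ℝ≥0) (v : Profile m n)
    (S : Finset (Service m n)) : Prop :=
  Maximal (fun T : Finset (Service m n) => I.Feasible T ∧ ∀ s ∈ T, p s ≤ v s) S

/-- The smallest total price of a maximal feasible set of desired services. -/
noncomputable def Market.obliviousRevenueAt (I : Market m n) (p : Service m n → ℝ≥0)
    (v : Profile m n) : ℝ≥0∞ :=
  ⨅ S ∈ {S : Finset (Service m n) | I.IsMaximalDesired p v S}, ∑ s ∈ S, (p s : ℝ≥0∞)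

/-- The order-oblivious expected revenue of the prices `p`. -/
noncomputable def Market.obliviousRevenue (I : Market m n) (p : Service m n → ℝ≥0) : ℝ≥0∞ :=
  ∫⁻ v, I.obliviousRevenueAt p v ∂I.law

/-- The prices `p` define a truthful `α`-approximate OPM: for every arrival order and every
rational behaviour the posted pricing is feasible, truthful and individually rational, and on every
profile it earns at least the order-oblivious revenue, whose expectation is at least the optimal
revenue divided by `α`. -/
def Market.IsTruthfulApproxOPM (I : Market m n) (α : ℝ≥0) (p : Service m n → ℝ≥0) : Prop :=
  (∀ (σ : Equiv.Perm (Fin m)) (c : Behaviour m n), c.IsRational p →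
    (I.postedPricing p σ c).IsFeasible I ∧
    (I.postedPricing p σ c).IsTruthful ∧
    (I.postedPricing p σ c).IsIndividuallyRational ∧
    ∀ v, I.obliviousRevenueAt p v ≤ ENNReal.ofReal ((I.postedPricing p σ c).revenue v)) ∧
  I.optRevenue ≤ (((α : ℝ≥0∞) * I.obliviousRevenue p : ℝ≥0∞) : EReal)

end OPM

/-! ## Real random access machine programs with oracle access to the value distributions -/

namespace RealRAM

/-- Three oracles about each service `(i, j)`, each taking one real argument. -/
structure Oracles where
  accept : ℕ → ℕ → ℝ → ℝ
  quantile : ℕ → ℕ → ℝ → ℝ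
  bestPrice : ℕ → ℕ → ℝ → ℝ

/-- The oracles answer correctly: `accept` is the probability that the value is at least `p` (this
is `1 - F(p)` if the distribution function `F` is continuous), `quantile` is `F⁻¹(a)`, the least
`x ≥ 0` with `F(x) ≥ a`, and `bestPrice` is an optimal price for the single service among the
prices in `[x, ∞)`. -/
def Oracles.Describe {m n : ℕ} (O : Oracles) (I : Market m n) : Prop :=
  ∀ (i : Fin m) (j : Fin n),
    (∀ p : ℝ, O.accept i j p = I.acceptProb (i, j) p) ∧
    (∀ a : ℝ, 0 < a → a < 1 →
      IsLeast {x : ℝ | 0 ≤ x ∧ a ≤ (I.dist (i, j)).real {v | (v : ℝ) ≤ x}} (O.quantile i j a)) ∧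
    (∀ x : ℝ, 0 ≤ x → x ≤ O.bestPrice i j x ∧ ∀ p : ℝ, x ≤ p →
      p * I.acceptProb (i, j) p ≤ O.bestPrice i j x * I.acceptProb (i, j) (O.bestPrice i j x))

/-- The memory: natural number registers, used for counting and addressing, and real arrays, each
with three indices. -/
structure State where
  nat : ℕ → ℕ
  real : ℕ → ℕ → ℕ → ℕ → ℝ

/-- Natural number expressions (truncated subtraction, no multiplication). -/
inductive NExp where
  | const (c : ℕ)
  | reg (x : ℕ)
  | plus (e f : NExp)
  | minus (e f : NExp)

/-- Real expressions: rational constants, conversion of naturals, array cells, field operations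
(`x / 0 = 0`), oracle calls. -/
inductive RExp where
  | const (c : ℚ)
  | ofNat (e : NExp)
  | cell (a : ℕ) (i j l : NExp)
  | plus (e f : RExp)
  | minus (e f : RExp)
  | times (e f : RExp)
  | div (e f : RExp)
  | accept (i j : NExp) (e : RExp)
  | quantile (i j : NExp) (e : RExp)
  | bestPrice (i j : NExp) (e : RExp)

/-- Comparisons. -/
inductive Test where
  | natLt (e f : NExp)
  | realLt (e f : RExp)

/-- Programs: assignments, composition, branching, and loops `for x < e do c`, whose bound `e` is
evaluated once, on entry. -/
inductive Program where
  | skip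
  | setNat (x : ℕ) (e : NExp)
  | setReal (a : ℕ) (i j l : NExp) (e : RExp)
  | seq (c d : Program)
  | ite (t : Test) (c d : Program)
  | loop (x : ℕ) (e : NExp) (c : Program)

def NExp.eval (s : State) : NExp → ℕ
  | .const c => c
  | .reg x => s.nat x
  | .plus e f => e.eval s + f.eval s
  | .minus e f => e.eval s - f.eval s

noncomputable def RExp.eval (O : Oracles) (s : State) : RExp → ℝ
  | .const c => (c : ℝ)
  | .ofNat e => (e.eval s : ℝ)
  | .cell a i j l => s.real a (i.eval s) (j.eval s) (l.eval s)
  | .plus e f => e.eval O s + f.eval O s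
  | .minus e f => e.eval O s - f.eval O s
  | .times e f => e.eval O s * f.eval O s
  | .div e f => e.eval O s / f.eval O s
  | .accept i j e => O.accept (i.eval s) (j.eval s) (e.eval O s)
  | .quantile i j e => O.quantile (i.eval s) (j.eval s) (e.eval O s)
  | .bestPrice i j e => O.bestPrice (i.eval s) (j.eval s) (e.eval O s)

def Test.holds (O : Oracles) (s : State) : Test → Prop
  | .natLt e f => e.eval s < f.eval s
  | .realLt e f => e.eval O s < f.eval O s

/-- The number of operations needed to evaluate an expression. -/
def NExp.cost : NExp → ℕ
  | .const _ => 1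
  | .reg _ => 1
  | .plus e f => e.cost + f.cost + 1
  | .minus e f => e.cost + f.cost + 1

def RExp.cost : RExp → ℕ
  | .const _ => 1
  | .ofNat e => e.cost + 1
  | .cell _ i j l => i.cost + j.cost + l.cost + 1
  | .plus e f => e.cost + f.cost + 1
  | .minus e f => e.cost + f.cost + 1
  | .times e f => e.cost + f.cost + 1
  | .div e f => e.cost + f.cost + 1
  | .accept i j e => i.cost + j.cost + e.cost + 1
  | .quantile i j e => i.cost + j.cost + e.cost + 1
  | .bestPrice i j e => i.cost + j.cost + e.cost + 1

def Test.cost : Test → ℕ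
  | .natLt e f => e.cost + f.cost + 1
  | .realLt e f => e.cost + f.cost + 1

def State.setNat (s : State) (x k : ℕ) : State :=
  { s with nat := fun y => if y = x then k else s.nat y }

def State.setReal (s : State) (a i j l : ℕ) (r : ℝ) : State :=
  { s with real := fun a' i' j' l' =>
      if a' = a ∧ i' = i ∧ j' = j ∧ l' = l then r else s.real a' i' j' l' }

open Classical in
/-- Run a program: the final state and the number of steps, where every arithmetic operation,
memory access, comparison, oracle call and loop iteration costs one step. -/
noncomputable def Program.run (O : Oracles) : Program → State → State × ℕ
  | .skip, s => (s, 1)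
  | .setNat x e, s => (s.setNat x (e.eval s), e.cost + 1)
  | .setReal a i j l e, s =>
      (s.setReal a (i.eval s) (j.eval s) (l.eval s) (e.eval O s),
        i.cost + j.cost + l.cost + e.cost + 1)
  | .seq c d, s => ((d.run O (c.run O s).1).1, (c.run O s).2 + (d.run O (c.run O s).1).2)
  | .ite t c d, s =>
      if t.holds O s then ((c.run O s).1, t.cost + (c.run O s).2)
      else ((d.run O s).1, t.cost + (d.run O s).2)
  | .loop x e c, s =>
      Nat.rec (s, e.cost + 1)
        (fun k r => ((c.run O (r.1.setNat x k)).1, r.2 + (c.run O (r.1.setNat x k)).2 + 1))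
        (e.eval s)

/-- The initial memory: the numbers of agents and items are in the registers `0` and `1`, the
numbers of copies are in array `0`, and all other memory is zero. -/
noncomputable def input {m n : ℕ} (I : Market m n) : State where
  nat x := if x = 0 then m else if x = 1 then n else 0
  real a i j l := if h : i < n then (if a = 0 ∧ j = 0 ∧ l = 0 then (I.copies ⟨i, h⟩ : ℝ) else 0)
    else 0

/-- The prices are read off array `1`. -/
def Outputs {m n : ℕ} (s : State) (p : Service m n → ℝ≥0) : Prop :=
  ∀ (i : Fin m) (j : Fin n), s.real 1 i j 0 = (p (i, j) : ℝ)

end RealRAM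

/-! ## An upper bound on the optimal revenue -/

namespace Mechanism

variable {m n : ℕ} {M : Mechanism m n} {I : Market m n}

/-! The optimum is compared with a Lagrangian dual. Charge `u i` for serving agent `i` and `w j` for
using a copy of item `j`, and let `κ j` be the number of copies capped at `m`. When all other values
are fixed, a truthful mechanism sells a single service at one posted price, so its expected payment
net of charges is at most the best profit `φ s` from a price. Feasibility bounds the charges
collected by `X = ∑ u + ∑ κ w`. Hence the optimum is at most `X + ∑ φ` (`Market.optRevenue_le`).

For the lower bound, two services conflict with weight `1` if they share the agent and `1 / κ j` if
they share item `j`. A desired service outside a maximal set `S` is blocked by its agent or by at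
least `κ j` members of `S`, so its price is at most a conflict-weighted sum over `S` of maxima of
two prices. Summation shows that every maximal set earns at least the total desired price minus half
the sum of `conflict * max` over all pairs of desired services. By independence the expectation is
an explicit quadratic expression in the acceptance probabilities
(`Market.ofReal_le_obliviousRevenue`).

Suppose now that each service independently draws an option of maximal profit `ψ` at the charges,
with loads of at most a third of every capacity and equal to a third where the charge is positive.
The linear part of the bound is then `∑ ψ + X / 3`. Each service meets a conflict weight of at most
a third through its agent and a third through its item, and `pairLoss_le` with `conflict_sum_le`
bounds the loss by `2 / 3 * ∑ ψ + X / 6`. What remains is at least a sixth of the dual value. The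
gap between `6` and `27 / 4` pays for all approximations. The bound is affine in the lottery of each
single service, so replacing the lotteries one by one by their best options yields deterministic
prices (`quadBound_le_update`).

The charges and lotteries come from a projected subgradient method (`IsDynamics`): average charges
form the dual solution, and frequencies of choices form the lotteries. Charges stay of order `N *
V`, with `V` the largest monopoly revenue, so the loads hardly exceed a third; an energy argument
shows that charges are hardly paid for unused capacity (`IsDynamics.exists_dual`). The options are
the best prices above the points of a grid of width `V / (100 * N ^ 2)`, which lose little against
arbitrary prices (`Market.IsNearlyBest.profit_le`).

A program whose loops are polynomially bounded carries this out. Its correctness needs only nearly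
best prices, so the existence statement follows from the same program, run with oracles picked from
the finite suprema. -/

theorem IsTruthful.pay_update_le (hM : M.IsTruthful) (b : Profile m n) (s : Service m n)
    {x y : ℝ≥0} (hx : M.alloc (Function.update b s x) s.1 = some s.2)
    (hy : M.alloc (Function.update b s y) s.1 = some s.2) :
    M.pay (Function.update b s x) s.1 ≤ M.pay (Function.update b s y) s.1 := by
  -- An agent whose value is `x` may bid `y`: she gets the same item, so only the payment changes,
  -- and she must not gain. Applied both ways, the price of a service does not depend on the value
  -- for it.
  have h := hM s.1 (Function.update b s x) (Function.update b s y) (fun s' hs' => by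
    have : s' ≠ s := fun h => hs' (by rw [h])
    simp [Function.update_of_ne this])
  simp only [utility, hx, hy] at h
  linarith

theorem measurable_service_surplus (hM : M.IsMeasurable) (s : Service m n) (t : ℝ) :
    Measurable fun b => if M.alloc b s.1 = some s.2 then ENNReal.ofReal (M.pay b s.1 - t) else 0 :=
  Measurable.ite (hM.1 s.1 (some s.2)) (((hM.2 s.1).sub_const t).ennreal_ofReal) measurable_const

/-- The expected payment for a service, net of a charge `t` for using it, is at most the best
profit from a posted price. -/
theorem lintegral_service_surplus_le (hm : M.IsMeasurable) (ht : M.IsTruthful)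
    (hr : M.IsIndividuallyRational) (s : Service m n) {t φ : ℝ} (t0 : 0 ≤ t)
    (hφ : ∀ p : ℝ, 0 ≤ p → (p - t) * I.acceptProb s p ≤ φ) :
    ∫⁻ b, (if M.alloc b s.1 = some s.2 then ENNReal.ofReal (M.pay b s.1 - t) else 0) ∂I.law
      ≤ ENNReal.ofReal φ := by
  have hconst : ∫⁻ _, ENNReal.ofReal φ ∂I.law = ENNReal.ofReal φ := by
    simp [Market.law]
  rw [← hconst]
  -- It suffices to integrate out coordinate `s` for each choice of the other values, where the
  -- mechanism offers `s` at a fixed price `π` or never.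
  refine lintegral_le_of_lmarginal_le {s} (measurable_service_surplus hm s t) measurable_const ?_
  rw [lmarginal_singleton, lmarginal_singleton]
  intro x
  simp only [lintegral_const, measure_univ, mul_one]
  by_cases h : ∃ y, M.alloc (Function.update x s y) s.1 = some s.2
  · obtain ⟨y, hy⟩ := h
    set π := M.pay (Function.update x s y) s.1 with hπ
    have hle : ∀ z, (if M.alloc (Function.update x s z) s.1 = some s.2 then
        ENNReal.ofReal (M.pay (Function.update x s z) s.1 - t) else 0) ≤
        Set.indicator {v : ℝ≥0 | π ≤ (v : ℝ)} (fun _ => ENNReal.ofReal (π - t)) z := by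
      intro z
      split_ifs with hz
      · have h1 : M.pay (Function.update x s z) s.1 = π :=
          le_antisymm (ht.pay_update_le x s hz hy) (ht.pay_update_le x s hy hz)
        have h2 := (hr (Function.update x s z) s.1).1 s.2 hz
        rw [h1] at h2 ⊢
        rw [Set.indicator_of_mem]
        simpa using h2
      · exact zero_le
    refine (lintegral_mono hle).trans ?_
    have hms : MeasurableSet {v : ℝ≥0 | π ≤ (v : ℝ)} :=
      measurableSet_le measurable_const measurable_coe_nnreal_real
    rw [lintegral_indicator_const hms]
    -- `π` may be negative, but `hφ` concerns nonnegative prices only. Up to `t` there is no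
    -- surplus, and above it `t0` gives `0 ≤ π`.
    rcases le_total π t with h | h
    · simp [ENNReal.ofReal_of_nonpos (sub_nonpos.2 h)]
    · rw [← ofReal_measureReal, ← ENNReal.ofReal_mul (by linarith)]
      exact ENNReal.ofReal_le_ofReal (hφ π (t0.trans h))
  · push Not at h
    simp [h]

theorem card_served_agent_le (b : Profile m n) (i : Fin m) :
    ((M.served b).filter fun s => s.1 = i).card ≤ 1 := by
  rw [Finset.card_le_one]
  rintro ⟨i₁, j₁⟩ h₁ ⟨i₂, j₂⟩ h₂
  simp only [served, Finset.mem_filter, Finset.mem_univ, true_and] at h₁ h₂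
  obtain ⟨h₁, rfl⟩ := h₁
  obtain ⟨h₂, rfl⟩ := h₂
  rw [h₁] at h₂
  simpa using h₂

theorem card_served_item_le (b : Profile m n) (j : Fin n) :
    ((M.served b).filter fun s => s.2 = j).card ≤ m := by
  have : ((M.served b).filter fun s => s.2 = j).card ≤ (Finset.univ : Finset (Fin m)).card := by
    refine Finset.card_le_card_of_injOn Prod.fst (fun _ _ => Finset.mem_univ _) ?_
    rintro ⟨i₁, j₁⟩ h₁ ⟨i₂, j₂⟩ h₂ h
    simp at h₁ h₂ h
    simp [h, h₁.2, h₂.2]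
  simpa using this

theorem revenue_eq_sum_served (hr : M.IsIndividuallyRational) (b : Profile m n) :
    M.revenue b = ∑ s ∈ M.served b, M.pay b s.1 := by
  rw [revenue, served, Finset.sum_filter, Fintype.sum_prod_type]
  refine Finset.sum_congr rfl fun i _ => ?_
  rcases h : M.alloc b i with _ | j
  · simp [(hr b i).2 h]
  · simp [h]

end Mechanism

namespace Market

variable {m n : ℕ}

/-- The number of copies of an item that can be of use. -/
def usableCopies (I : Market m n) (j : Fin n) : ℕ := min (I.copies j) m

/-- Weak duality: charges `u i` for serving an agent and `w j` for using a copy of an item bound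
the optimal revenue. -/
theorem optRevenue_le (I : Market m n) (u : Fin m → ℝ) (w : Fin n → ℝ) (φ : Service m n → ℝ)
    (hu : ∀ i, 0 ≤ u i) (hw : ∀ j, 0 ≤ w j) (hφ0 : ∀ s, 0 ≤ φ s)
    (hφ : ∀ s : Service m n, 0 < I.usableCopies s.2 → ∀ p : ℝ, 0 ≤ p →
      (p - (u s.1 + w s.2)) * I.acceptProb s p ≤ φ s) :
    I.optRevenue ≤
      ((ENNReal.ofReal (∑ i, u i + ∑ j, I.usableCopies j * w j + ∑ s, φ s) : ℝ≥0∞) : EReal) := by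
  refine iSup₂_le fun M ⟨hf, hm, ht, hr⟩ => ?_
  refine (EReal.sub_le_of_le_add (le_add_of_nonneg_right (EReal.coe_ennreal_nonneg _))).trans ?_
  rw [EReal.coe_ennreal_le_coe_ennreal_iff]
  set X := ∑ i, u i + ∑ j, I.usableCopies j * w j with hX
  have hX0 : 0 ≤ X := by
    have := Finset.sum_nonneg fun i (_ : i ∈ Finset.univ) => hu i
    have := Finset.sum_nonneg fun j (_ : j ∈ Finset.univ) =>
      mul_nonneg (Nat.cast_nonneg (α := ℝ) (I.usableCopies j)) (hw j)
    linarith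
  -- Revenue is charges plus net payments. Feasibility bounds the charges by `X`, and net payments
  -- are replaced by their positive parts, so that each service can be estimated alone.
  have hpt : ∀ b, ENNReal.ofReal (M.revenue b) ≤ ENNReal.ofReal X + ∑ s : Service m n,
      if M.alloc b s.1 = some s.2 then ENNReal.ofReal (M.pay b s.1 - (u s.1 + w s.2)) else 0 := by
    intro b
    rw [Mechanism.revenue_eq_sum_served hr b, ← Finset.sum_filter]
    change _ ≤ _ + ∑ s ∈ M.served b, _
    have hch : ∑ s ∈ M.served b, (u s.1 + w s.2) ≤ X := by
      rw [Finset.sum_add_distrib]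
      refine add_le_add ?_ ?_
      · rw [← Finset.sum_fiberwise (M.served b) Prod.fst]
        refine Finset.sum_le_sum fun i _ => ?_
        rw [Finset.sum_congr rfl (g := fun _ => u i) (by simp +contextual), Finset.sum_const,
          nsmul_eq_mul]
        have : ((Finset.card ((M.served b).filter fun s => s.1 = i) : ℕ) : ℝ) ≤ 1 := by
          exact_mod_cast Mechanism.card_served_agent_le b i
        nlinarith [hu i]
      · rw [← Finset.sum_fiberwise (M.served b) Prod.snd]
        refine Finset.sum_le_sum fun j _ => ?_
        rw [Finset.sum_congr rfl (g := fun _ => w j) (by simp +contextual), Finset.sum_const,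
          nsmul_eq_mul]
        refine mul_le_mul_of_nonneg_right ?_ (hw j)
        exact_mod_cast le_min ((hf b).2 j) (Mechanism.card_served_item_le b j)
    have hrev : ∑ s ∈ M.served b, M.pay b s.1 ≤
        X + ∑ s ∈ M.served b, (M.pay b s.1 - (u s.1 + w s.2)) := by
      rw [Finset.sum_sub_distrib]; linarith
    refine (ENNReal.ofReal_le_ofReal hrev).trans (ENNReal.ofReal_add_le.trans ?_)
    gcongr
    exact Finset.le_sum_of_subadditive _ ENNReal.ofReal_zero.le
      (fun _ _ => ENNReal.ofReal_add_le) _ _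
  refine (lintegral_mono hpt).trans ?_
  rw [lintegral_add_left measurable_const, lintegral_finsetSum _ fun s _ =>
    Mechanism.measurable_service_surplus hm s _, lintegral_const]
  have hone : I.law Set.univ = 1 := by simp [law]
  rw [hone, mul_one, ENNReal.ofReal_add hX0 (Finset.sum_nonneg fun s _ => hφ0 s),
    ENNReal.ofReal_sum_of_nonneg fun s _ => hφ0 s]
  gcongr with s
  by_cases hs : 0 < I.usableCopies s.2
  · exact Mechanism.lintegral_service_surplus_le hm ht hr s (add_nonneg (hu _) (hw _)) (hφ s hs)
  · have hno : ∀ b, M.alloc b s.1 ≠ some s.2 := by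
      intro b hb
      refine hs (lt_min ?_ (Fin.pos s.1))
      refine lt_of_lt_of_le ?_ ((hf b).2 s.2)
      exact Finset.card_pos.2 ⟨s, by simp [Mechanism.served, hb]⟩
    simp [hno]

end Market

/-! ## A quadratic lower bound on the order-oblivious revenue -/

section Conflict

variable {α β : Type*} [DecidableEq α] [DecidableEq β]

/-- The pairs of different services of the same agent. -/
def sameAgent (s s' : α × β) : ℝ := if s.1 = s'.1 ∧ s.2 ≠ s'.2 then 1 else 0

/-- The pairs of services of different agents for the same item, weighted by the inverse number of
copies. -/
noncomputable def sameItem (κ : β → ℝ) (s s' : α × β) : ℝ :=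
  if s.2 = s'.2 ∧ s.1 ≠ s'.1 then (κ s.2)⁻¹ else 0

/-- The amount to which two services exclude each other. -/
noncomputable def conflict (κ : β → ℝ) (s s' : α × β) : ℝ := sameAgent s s' + sameItem κ s s'

theorem sameAgent_comm (s s' : α × β) : sameAgent s s' = sameAgent s' s := by
  simp only [sameAgent, eq_comm, ne_comm]

theorem sameItem_comm (κ : β → ℝ) (s s' : α × β) : sameItem κ s s' = sameItem κ s' s := by
  unfold sameItem
  by_cases h : s.2 = s'.2 ∧ s.1 ≠ s'.1
  · rw [if_pos h, if_pos ⟨h.1.symm, h.2.symm⟩, h.1]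
  · rw [if_neg h, if_neg fun h' => h ⟨h'.1.symm, h'.2.symm⟩]

theorem conflict_comm (κ : β → ℝ) (s s' : α × β) : conflict κ s s' = conflict κ s' s := by
  rw [conflict, conflict, sameAgent_comm, sameItem_comm]

theorem conflict_self (κ : β → ℝ) (s : α × β) : conflict κ s s = 0 := by
  simp [conflict, sameAgent, sameItem]

theorem sameAgent_nonneg (s s' : α × β) : 0 ≤ sameAgent s s' := by
  unfold sameAgent; split_ifs <;> norm_num

theorem sameItem_nonneg {κ : β → ℝ} (hκ : ∀ j, 0 ≤ κ j) (s s' : α × β) :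
    0 ≤ sameItem κ s s' := by
  unfold sameItem; split_ifs
  · exact inv_nonneg.2 (hκ _)
  · exact le_rfl

theorem conflict_nonneg {κ : β → ℝ} (hκ : ∀ j, 0 ≤ κ j) (s s' : α × β) :
    0 ≤ conflict κ s s' :=
  add_nonneg (sameAgent_nonneg _ _) (sameItem_nonneg hκ _ _)

end Conflict

namespace Market

variable {m n : ℕ}

theorem usableCopies_pos {I : Market m n} {s : Service m n} :
    0 < I.usableCopies s.2 ↔ 0 < I.copies s.2 := by
  simp [usableCopies, Fin.pos s.1]

/-- The services of use that are desired at the prices `p`. -/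
noncomputable def desired (I : Market m n) (p : Service m n → ℝ≥0) (v : Profile m n) :
    Finset (Service m n) :=
  Finset.univ.filter fun s => 0 < I.usableCopies s.2 ∧ p s ≤ v s

theorem Feasible.insert {I : Market m n} {S : Finset (Service m n)} (hS : I.Feasible S)
    {s : Service m n} (h1 : ∀ s' ∈ S, s'.1 ≠ s.1)
    (h2 : (S.filter fun s' => s'.2 = s.2).card < I.copies s.2) :
    I.Feasible (insert s S) := by
  refine ⟨fun i => ?_, fun j => ?_⟩
  · rw [Finset.filter_insert]
    split_ifs with h
    · have : S.filter (fun s' => s'.1 = i) = ∅ := by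
        rw [Finset.filter_eq_empty_iff]
        intro s' hs' h'
        exact h1 s' hs' (h'.trans h.symm)
      simp [this]
    · exact hS.1 i
  · rw [Finset.filter_insert]
    split_ifs with h
    · subst h
      exact (Finset.card_insert_le _ _).trans h2
    · exact hS.2 j

/-- Maximality leaves two obstacles: the agent is served in `S`, which is one conflict of weight at
least `1`, or the item is exhausted, which gives at least `κ` conflicts of weight `κ⁻¹`. The maximum
of both prices makes the bound symmetric in the two services, so that double sums can be halved. -/
theorem price_le_sum_conflict {I : Market m n} {p : Service m n → ℝ≥0} {v : Profile m n}
    {S : Finset (Service m n)} (hS : I.IsMaximalDesired p v S) {s : Service m n}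
    (hs : s ∈ I.desired p v) (hsS : s ∉ S) :
    (p s : ℝ) ≤ ∑ s' ∈ S, conflict (fun j => (I.usableCopies j : ℝ)) s s' * max (p s : ℝ) (p s') := by
  set κ : Fin n → ℝ := fun j => (I.usableCopies j : ℝ) with hκ
  have hκ0 : ∀ j, 0 ≤ κ j := fun j => Nat.cast_nonneg _
  have hnn : ∀ s' ∈ S, 0 ≤ conflict κ s s' * max (p s : ℝ) (p s') := fun s' _ =>
    mul_nonneg (conflict_nonneg hκ0 _ _) (le_max_of_le_left (p s).coe_nonneg)
  simp only [desired, Finset.mem_filter, Finset.mem_univ, true_and] at hs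
  by_cases h1 : ∃ s' ∈ S, s'.1 = s.1
  · obtain ⟨s', hs', h⟩ := h1
    refine le_trans ?_ (Finset.single_le_sum hnn hs')
    have hne : s.2 ≠ s'.2 := fun h' => hsS (by rwa [Prod.ext h.symm h'])
    have : (1 : ℝ) ≤ conflict κ s s' := by
      have := sameItem_nonneg hκ0 s s'
      simp only [conflict, sameAgent, h.symm, hne, ne_eq, not_false_eq_true, and_self, if_true]
      linarith
    calc (p s : ℝ) ≤ max (p s : ℝ) (p s') := le_max_left _ _
      _ ≤ _ := le_mul_of_one_le_left (le_max_of_le_left (p s).coe_nonneg) this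
  · push Not at h1
    have h2 : I.copies s.2 ≤ (S.filter fun s' => s'.2 = s.2).card := by
      by_contra! h2
      have hf := hS.1.1.insert h1 h2
      have := hS.2 (y := insert s S) ⟨hf, fun s' hs' => by
        rcases Finset.mem_insert.1 hs' with rfl | h
        · exact hs.2
        · exact hS.1.2 s' h⟩ (Finset.subset_insert _ _)
      exact hsS (this (Finset.mem_insert_self _ _))
    have hpos : (0 : ℝ) < κ s.2 := by simpa [hκ] using hs.1
    refine le_trans ?_ (Finset.sum_le_sum_of_subset_of_nonneg
      (Finset.filter_subset (fun s' => s'.2 = s.2) S) fun s' h _ => hnn s' h)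
    have hterm : ∀ s' ∈ S.filter (fun s' => s'.2 = s.2),
        (κ s.2)⁻¹ * (p s : ℝ) ≤ conflict κ s s' * max (p s : ℝ) (p s') := by
      intro s' hs'
      obtain ⟨hs', h⟩ := Finset.mem_filter.1 hs'
      have : conflict κ s s' = (κ s.2)⁻¹ := by
        simp [conflict, sameAgent, sameItem, h, (h1 s' hs').symm]
      rw [this]
      exact mul_le_mul_of_nonneg_left (le_max_left _ _) (inv_nonneg.2 hpos.le)
    have := Finset.card_nsmul_le_sum _ _ _ hterm
    refine le_trans ?_ this
    rw [nsmul_eq_mul, ← mul_assoc]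
    refine le_mul_of_one_le_left (p s).coe_nonneg ?_
    rw [← div_eq_mul_inv, one_le_div hpos]
    exact Nat.cast_le.2 ((min_le_left _ _).trans h2)

/-- Every service that is desired but not in a maximal set is charged to its conflicts. -/
theorem sum_desired_sub_conflicts_le {I : Market m n} {p : Service m n → ℝ≥0} {v : Profile m n}
    {S : Finset (Service m n)} (hS : I.IsMaximalDesired p v S) :
    ∑ s ∈ I.desired p v, (p s : ℝ) - 1 / 2 * ∑ s ∈ I.desired p v, ∑ s' ∈ I.desired p v,
      conflict (fun j => (I.usableCopies j : ℝ)) s s' * max (p s : ℝ) (p s') ≤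
      ∑ s ∈ S, (p s : ℝ) := by
  set κ : Fin n → ℝ := fun j => (I.usableCopies j : ℝ) with hκ
  have hκ0 : ∀ j, 0 ≤ κ j := fun j => Nat.cast_nonneg _
  set f : Service m n → Service m n → ℝ := fun s s' => conflict κ s s' * max (p s : ℝ) (p s')
  have hf0 : ∀ s s', 0 ≤ f s s' := fun s s' =>
    mul_nonneg (conflict_nonneg hκ0 _ _) (le_max_of_le_left (p s).coe_nonneg)
  have hfc : ∀ s s', f s s' = f s' s := fun s s' => by
    simp only [f]; rw [conflict_comm, max_comm]
  set D := I.desired p v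
  have hSD : S ⊆ D := by
    intro s hs
    refine Finset.mem_filter.2 ⟨Finset.mem_univ _, ?_, hS.1.2 s hs⟩
    rw [usableCopies_pos]
    exact lt_of_lt_of_le (Finset.card_pos.2 ⟨s, by simp [hs]⟩) (hS.1.1.2 s.2)
  have hout : ∑ s ∈ D \ S, (p s : ℝ) ≤ ∑ s ∈ D \ S, ∑ s' ∈ S, f s s' :=
    Finset.sum_le_sum fun s hs =>
      price_le_sum_conflict hS (Finset.mem_sdiff.1 hs).1 (Finset.mem_sdiff.1 hs).2
  have hnn : ∀ A B : Finset (Service m n), 0 ≤ ∑ s ∈ A, ∑ s' ∈ B, f s s' := fun A B =>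
    Finset.sum_nonneg fun s _ => Finset.sum_nonneg fun s' _ => hf0 s s'
  -- The double sum over `D` contains each pair between `D \ S` and `S` in both orders, so half of
  -- it pays for all prices outside `S`. The pairs inside `D \ S` and inside `S` only help.
  have hsplit : ∑ s ∈ D, ∑ s' ∈ D, f s s' =
      ∑ s ∈ D \ S, ∑ s' ∈ D \ S, f s s' + ∑ s ∈ D \ S, ∑ s' ∈ S, f s s' +
      (∑ s ∈ S, ∑ s' ∈ D \ S, f s s' + ∑ s ∈ S, ∑ s' ∈ S, f s s') := by
    rw [← Finset.sum_sdiff hSD, ← Finset.sum_add_distrib, ← Finset.sum_add_distrib]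
    congr 1 <;> refine Finset.sum_congr rfl fun s _ => ?_ <;> rw [← Finset.sum_sdiff hSD]
  have hsym : ∑ s ∈ S, ∑ s' ∈ D \ S, f s s' = ∑ s ∈ D \ S, ∑ s' ∈ S, f s s' := by
    rw [Finset.sum_comm]
    exact Finset.sum_congr rfl fun s _ => Finset.sum_congr rfl fun s' _ => hfc _ _
  rw [← Finset.sum_sdiff hSD (f := fun s => (p s : ℝ))]
  have := hnn (D \ S) (D \ S)
  have := hnn S S
  linarith

theorem measurableSet_desire (p : Service m n → ℝ≥0) (s : Service m n) :
    MeasurableSet {v : Profile m n | p s ≤ v s} :=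
  measurableSet_le measurable_const (measurable_pi_apply s)

instance (I : Market m n) : IsProbabilityMeasure I.law := by unfold law; infer_instance

theorem acceptProb_coe (I : Market m n) (s : Service m n) (x : ℝ≥0) :
    I.acceptProb s x = (I.dist s).real (Set.Ici x) := by
  simp [acceptProb, Set.Ici]

theorem law_real_desire (I : Market m n) (p : Service m n → ℝ≥0) (s : Service m n) :
    I.law.real {v | p s ≤ v s} = I.acceptProb s (p s) := by
  classical
  have : {v : Profile m n | p s ≤ v s} =
      Set.univ.pi fun r => if r = s then Set.Ici (p s) else Set.univ := by
    ext v
    simp only [Set.mem_ofPred_eq, Set.mem_pi, Set.mem_univ, true_imp_iff]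
    refine ⟨fun h r => ?_, fun h => by simpa using h s⟩
    split_ifs with hr
    · subst hr; exact h
    · trivial
  rw [acceptProb_coe, measureReal_def, measureReal_def, this, law, Measure.pi_pi,
    Finset.prod_eq_single s]
  · simp
  · intro r _ hr; simp [hr]
  · simp

theorem law_real_desire_inter (I : Market m n) (p : Service m n → ℝ≥0) {s s' : Service m n}
    (h : s ≠ s') : I.law.real ({v | p s ≤ v s} ∩ {v | p s' ≤ v s'}) =
      I.acceptProb s (p s) * I.acceptProb s' (p s') := by
  classical
  have : {v : Profile m n | p s ≤ v s} ∩ {v | p s' ≤ v s'} =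
      Set.univ.pi fun r => if r = s then Set.Ici (p s) else if r = s' then Set.Ici (p s')
        else Set.univ := by
    ext v
    simp only [Set.mem_inter_iff, Set.mem_ofPred_eq, Set.mem_pi, Set.mem_univ, true_imp_iff]
    refine ⟨fun h r => ?_, fun h' => ⟨by simpa using h' s, by simpa [h.symm] using h' s'⟩⟩
    split_ifs with hr hr'
    · subst hr; exact h.1
    · subst hr'; exact h.2
    · trivial
  rw [acceptProb_coe, acceptProb_coe, measureReal_def, measureReal_def, measureReal_def, this, law,
    Measure.pi_pi, Finset.prod_eq_mul s s' h, ENNReal.toReal_mul]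
  · simp [h.symm]
  · rintro r _ ⟨h1, h2⟩; simp [h1, h2]
  · simp
  · simp

/-- The acceptance probability of a service of use, `0` for a service that can never be given. -/
noncomputable def usableProb (I : Market m n) (s : Service m n) (p : ℝ) : ℝ :=
  if 0 < I.usableCopies s.2 then I.acceptProb s p else 0

/-- The expectation of the pointwise bound. As `conflict` vanishes on the diagonal, only pairs of
distinct services matter, and these are desired independently. -/
theorem ofReal_le_obliviousRevenue (I : Market m n) (p : Service m n → ℝ≥0) :
    ENNReal.ofReal (∑ s, p s * I.usableProb s (p s) - 1 / 2 * ∑ s, ∑ s',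
      conflict (fun j => (I.usableCopies j : ℝ)) s s' *
        (I.usableProb s (p s) * I.usableProb s' (p s') * max (p s : ℝ) (p s'))) ≤
      I.obliviousRevenue p := by
  set κ : Fin n → ℝ := fun j => (I.usableCopies j : ℝ) with hκ
  set A : Service m n → Set (Profile m n) := fun s => {v | p s ≤ v s} with hA
  have hAm : ∀ s, MeasurableSet (A s) := measurableSet_desire p
  set q : Service m n → ℝ := fun s => if 0 < I.usableCopies s.2 then 1 else 0 with hq
  set g : Profile m n → ℝ := fun v => ∑ s, (A s).indicator (fun _ => q s * p s) v -
    1 / 2 * ∑ s, ∑ s', (A s ∩ A s').indicator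
      (fun _ => q s * q s' * (conflict κ s s' * max (p s : ℝ) (p s'))) v with hg
  have hi1 : ∀ s (x : ℝ), Integrable ((A s).indicator fun _ => x) I.law := fun s x =>
    (integrable_const x).indicator (hAm s)
  have hi2 : ∀ s s' (x : ℝ), Integrable ((A s ∩ A s').indicator fun _ => x) I.law :=
    fun s s' x => (integrable_const x).indicator ((hAm s).inter (hAm s'))
  have hint : ∫ v, g v ∂I.law = ∑ s, p s * I.usableProb s (p s) - 1 / 2 * ∑ s, ∑ s',
      conflict κ s s' *
        (I.usableProb s (p s) * I.usableProb s' (p s') * max (p s : ℝ) (p s')) := by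
    have hu : ∀ s, I.usableProb s (p s) = q s * I.acceptProb s (p s) := fun s => by
      simp [usableProb, hq]
    rw [hg, integral_sub (integrable_finsetSum _ fun s _ => hi1 s _)
      ((integrable_finsetSum _ fun s _ => integrable_finsetSum _ fun s' _ => hi2 s s' _).const_mul
        _), integral_const_mul, integral_finsetSum _ fun s _ => hi1 s _,
      integral_finsetSum _ fun s _ => integrable_finsetSum _ fun s' _ => hi2 s s' _]
    congr 1
    · refine Finset.sum_congr rfl fun s _ => ?_
      rw [integral_indicator_const _ (hAm s), law_real_desire, hu, smul_eq_mul]; ring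
    · congr 1
      refine Finset.sum_congr rfl fun s _ => ?_
      rw [integral_finsetSum _ fun s' _ => hi2 s s' _]
      refine Finset.sum_congr rfl fun s' _ => ?_
      rw [integral_indicator_const _ ((hAm s).inter (hAm s')), smul_eq_mul]
      by_cases h : s = s'
      · subst h; simp [conflict_self]
      · rw [law_real_desire_inter I p h, hu, hu]; ring
  have hgi : Integrable g I.law := (integrable_finsetSum _ fun s _ => hi1 s _).sub
    ((integrable_finsetSum _ fun s _ => integrable_finsetSum _ fun s' _ => hi2 s s' _).const_mul _)
  rw [← hint]
  -- `g` may be negative, whereas the revenue is not, so `g` is truncated at zero before the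
  -- pointwise comparison.
  have hle : ENNReal.ofReal (∫ v, g v ∂I.law) ≤ ∫⁻ v, ENNReal.ofReal (g v) ∂I.law := by
    rw [integral_eq_lintegral_pos_part_sub_lintegral_neg_part hgi]
    exact (ENNReal.ofReal_le_ofReal (sub_le_self _ ENNReal.toReal_nonneg)).trans
      ENNReal.ofReal_toReal_le
  refine hle.trans (lintegral_mono fun v => le_iInf₂ fun S hS => ?_)
  have h := sum_desired_sub_conflicts_le hS
  have hgv : g v = ∑ s ∈ I.desired p v, (p s : ℝ) - 1 / 2 * ∑ s ∈ I.desired p v,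
      ∑ s' ∈ I.desired p v, conflict κ s s' * max (p s : ℝ) (p s') := by
    have hmem : ∀ s, s ∈ I.desired p v ↔ 0 < I.usableCopies s.2 ∧ p s ≤ v s := fun s => by
      simp [desired]
    have h1 : ∀ s, (A s).indicator (fun _ => q s * p s) v =
        if s ∈ I.desired p v then (p s : ℝ) else 0 := by
      intro s
      by_cases ha : 0 < I.usableCopies s.2 <;> by_cases hb : p s ≤ v s <;>
        simp only [hmem, ha, hb, hq, hA, Set.indicator, Set.mem_ofPred_eq, if_true, if_false,
          one_mul, zero_mul, and_self, and_false, false_and]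
    have h2 : ∀ s s' (x : ℝ), (A s ∩ A s').indicator (fun _ => q s * q s' * x) v =
        if s ∈ I.desired p v then (if s' ∈ I.desired p v then x else 0) else 0 := by
      intro s s' x
      by_cases ha : 0 < I.usableCopies s.2 <;> by_cases hb : p s ≤ v s <;>
      by_cases ha' : 0 < I.usableCopies s'.2 <;> by_cases hb' : p s' ≤ v s' <;>
        simp only [hmem, ha, hb, ha', hb', hq, hA, Set.indicator, Set.mem_inter_iff,
          Set.mem_ofPred_eq, if_true, if_false, one_mul, zero_mul, mul_zero, and_self, and_false,
          false_and, ite_self]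
    simp only [hg, h1, h2]
    rw [Finset.sum_ite_mem, Finset.univ_inter]
    congr 2
    calc _ = ∑ s, if s ∈ I.desired p v then ∑ s', (if s' ∈ I.desired p v then
          conflict κ s s' * max (p s : ℝ) (p s') else 0) else 0 :=
          Finset.sum_congr rfl fun s _ => by split_ifs <;> simp
      _ = _ := by
        rw [Finset.sum_ite_mem, Finset.univ_inter]
        exact Finset.sum_congr rfl fun s _ => by rw [Finset.sum_ite_mem, Finset.univ_inter]
  rw [hgv]
  refine (ENNReal.ofReal_le_ofReal h).trans ?_
  rw [ENNReal.ofReal_sum_of_nonneg fun s _ => (p s).coe_nonneg]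
  simp

end Market

/-! ## Posted pricings -/

namespace Market

variable {m n : ℕ} {I : Market m n} {c : Behaviour m n} {p : Service m n → ℝ≥0}

/-- The number of agents that have item `j`. -/
def holders (A : Fin m → Option (Fin n)) (j : Fin n) : ℕ :=
  (Finset.univ.filter fun i => A i = some j).card

theorem mem_available {A : Fin m → Option (Fin n)} {j : Fin n} :
    j ∈ I.available A ↔ holders A j < I.copies j := by
  simp [available, holders]

theorem offer_append (v : Profile m n) (l₁ l₂ : List (Fin m)) (A : Fin m → Option (Fin n)) :
    I.offer c v (l₁ ++ l₂) A = I.offer c v l₂ (I.offer c v l₁ A) := by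
  induction l₁ generalizing A with
  | nil => rfl
  | cons i l ih => exact ih _

theorem offer_of_notMem (v : Profile m n) {l : List (Fin m)} (A : Fin m → Option (Fin n))
    {i : Fin m} (hi : i ∉ l) : I.offer c v l A i = A i := by
  induction l generalizing A with
  | nil => rfl
  | cons i' l ih =>
    rw [List.mem_cons, not_or] at hi
    rw [offer, ih _ hi.2, Function.update_of_ne hi.1]

theorem offer_congr {v v' : Profile m n} {l : List (Fin m)} (A : Fin m → Option (Fin n))
    (h : ∀ i ∈ l, ∀ j, v (i, j) = v' (i, j)) : I.offer c v l A = I.offer c v' l A := by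
  induction l generalizing A with
  | nil => rfl
  | cons i l ih =>
    rw [offer, offer, ih _ fun i' hi' => h i' (List.mem_cons_of_mem _ hi')]
    simp only [h i List.mem_cons_self]

theorem holders_le_update {A : Fin m → Option (Fin n)} {i : Fin m} (hi : A i = none)
    (o : Option (Fin n)) (j : Fin n) : holders A j ≤ holders (Function.update A i o) j := by
  refine Finset.card_le_card fun i' hi' => ?_
  simp only [Finset.mem_filter, Finset.mem_univ, true_and] at hi' ⊢
  rw [Function.update_of_ne, hi']
  rintro rfl
  simp [hi] at hi'

theorem holders_le_offer (v : Profile m n) {l : List (Fin m)} (hl : l.Nodup)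
    {A : Fin m → Option (Fin n)} (hA : ∀ i ∈ l, A i = none) (j : Fin n) :
    holders A j ≤ holders (I.offer c v l A) j := by
  induction l generalizing A with
  | nil => exact le_rfl
  | cons i l ih =>
    rw [List.nodup_cons] at hl
    refine (holders_le_update (hA i List.mem_cons_self) _ j).trans (ih hl.2 fun i' hi' => ?_)
    rw [Function.update_of_ne (by rintro rfl; exact hl.1 hi'), hA i' (List.mem_cons_of_mem _ hi')]

theorem holders_update_le (hc : c.IsRational p) {A : Fin m → Option (Fin n)} {i : Fin m}
    (hA : ∀ j, holders A j ≤ I.copies j) (w : Fin n → ℝ≥0) (j : Fin n) :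
    holders (Function.update A i (c i w (I.available A))) j ≤ I.copies j := by
  have hins : (Finset.univ.filter fun i' =>
      Function.update A i (c i w (I.available A)) i' = some j) ⊆
      insert i (Finset.univ.filter fun i' => A i' = some j) := by
    intro i' hi'
    by_cases h : i' = i
    · simp [h]
    · simpa [Function.update_of_ne h, h] using hi'
  by_cases h : c i w (I.available A) = some j
  · have hr := hc i w (I.available A)
    rw [h] at hr
    have := mem_available.1 hr.1
    exact ((Finset.card_le_card hins).trans (Finset.card_insert_le _ _)).trans this
  · refine le_trans (Finset.card_le_card fun i' hi' => ?_) (hA j)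
    simp only [Finset.mem_filter, Finset.mem_univ, true_and] at hi' ⊢
    by_cases h' : i' = i
    · subst h'; rw [Function.update_self] at hi'; exact absurd hi' h
    · rwa [Function.update_of_ne h'] at hi'

theorem holders_offer_le (hc : c.IsRational p) (v : Profile m n) (l : List (Fin m))
    {A : Fin m → Option (Fin n)} (hA : ∀ j, holders A j ≤ I.copies j) (j : Fin n) :
    holders (I.offer c v l A) j ≤ I.copies j := by
  induction l generalizing A with
  | nil => exact hA j
  | cons i l ih => exact ih fun j => holders_update_le hc hA _ j

theorem card_served_item (M : Mechanism m n) (b : Profile m n) (j : Fin n) :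
    ((M.served b).filter fun s => s.2 = j).card = holders (M.alloc b) j := by
  refine (Finset.card_bij (fun i _ => (i, j)) ?_ ?_ ?_).symm
  · intro i hi
    simpa [Mechanism.served] using hi
  · intro i _ i' _ h
    simpa using h
  · rintro ⟨i, j'⟩ h
    simp only [Mechanism.served, Finset.mem_filter, Finset.mem_univ, true_and] at h
    obtain ⟨h, rfl⟩ := h
    exact ⟨i, by simpa using h, rfl⟩

/-- What an agent gets is her choice from a menu that does not depend on her own values, and the
items missing from the menu are sold out in the end. -/
theorem exists_menu (σ : Equiv.Perm (Fin m)) (c : Behaviour m n) (i : Fin m) (v : Profile m n) :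
    ∃ T : Finset (Fin n),
      (∀ b : Profile m n, (∀ s, s.1 ≠ i → b s = v s) →
        (I.postedPricing p σ c).alloc b i = c i (fun j => b (i, j)) T) ∧
      ∀ j, j ∉ T → I.copies j ≤ holders ((I.postedPricing p σ c).alloc v) j := by
  have hmem : i ∈ List.ofFn σ := by
    rw [List.mem_ofFn]
    exact ⟨σ.symm i, σ.apply_symm_apply i⟩
  have hnd : (List.ofFn σ).Nodup := List.nodup_ofFn.2 σ.injective
  obtain ⟨l₁, l₂, hl⟩ := List.append_of_mem hmem
  rw [hl] at hnd
  have h₁ : i ∉ l₁ := by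
    intro h
    exact (List.nodup_append.1 hnd).2.2 i h i List.mem_cons_self rfl
  have h₂ : i ∉ l₂ := (List.nodup_cons.1 (List.nodup_append.1 hnd).2.1).1
  -- The menu is what the agents before `i` leave over. Copies are never returned, so an item
  -- missing from it stays sold out.
  refine ⟨I.available (I.offer c v l₁ fun _ => none), fun b hb => ?_, fun j hj => ?_⟩
  · have : I.offer c b l₁ (fun _ => none) = I.offer c v l₁ fun _ => none :=
      offer_congr _ fun i' hi' j => hb (i', j) fun h => h₁ (by rwa [← show i' = i from h])
    simp only [postedPricing]
    rw [hl, offer_append, offer, offer_of_notMem _ _ h₂, Function.update_self, this]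
  · rw [mem_available, not_lt] at hj
    refine hj.trans ?_
    simp only [postedPricing]
    rw [hl, offer_append]
    refine holders_le_offer v (List.nodup_append.1 hnd).2.1 (fun i' hi' => ?_) j
    rw [offer_of_notMem]
    intro h
    exact (List.nodup_append.1 hnd).2.2 i' h i' hi' rfl

theorem postedPricing_pay (σ : Equiv.Perm (Fin m)) (b : Profile m n) (i : Fin m) :
    (I.postedPricing p σ c).pay b i =
      match (I.postedPricing p σ c).alloc b i with
      | some j => (p (i, j) : ℝ)
      | none => 0 := rfl

theorem postedPricing_isFeasible (hc : c.IsRational p) (σ : Equiv.Perm (Fin m)) :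
    (I.postedPricing p σ c).IsFeasible I := by
  intro b
  refine ⟨Mechanism.card_served_agent_le b, fun j => ?_⟩
  rw [card_served_item]
  exact holders_offer_le hc b _ (by simp [holders]) j

theorem postedPricing_isTruthful (hc : c.IsRational p) (σ : Equiv.Perm (Fin m)) :
    (I.postedPricing p σ c).IsTruthful := by
  intro i v b hb
  obtain ⟨T, hT, -⟩ := exists_menu (I := I) (p := p) σ c i v
  simp only [Mechanism.utility, postedPricing_pay, hT b hb, hT v fun _ _ => rfl]
  have h1 := hc i (fun j => v (i, j)) T
  have h2 := hc i (fun j => b (i, j)) T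
  rcases hv : c i (fun j => v (i, j)) T with _ | j <;>
    rcases hb : c i (fun j => b (i, j)) T with _ | j' <;> rw [hv] at h1 <;> rw [hb] at h2
  · have : (v (i, j') : ℝ) < p (i, j') := h1 j' h2.1
    simp only
    linarith
  · have : (p (i, j) : ℝ) ≤ v (i, j) := h1.2.1
    simp only
    linarith
  · exact h1.2.2 j' h2.1

theorem postedPricing_isIndividuallyRational (hc : c.IsRational p) (σ : Equiv.Perm (Fin m)) :
    (I.postedPricing p σ c).IsIndividuallyRational := by
  intro b i
  obtain ⟨T, hT, -⟩ := exists_menu (I := I) (p := p) σ c i b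
  have h := hc i (fun j => b (i, j)) T
  rw [← hT b fun _ _ => rfl] at h
  refine ⟨fun j hj => ?_, fun hn => ?_⟩
  · rw [hj] at h
    rw [postedPricing_pay, hj]
    exact_mod_cast h.2.1
  · rw [postedPricing_pay, hn]

/-- This turns the minimum over maximal sets into a guarantee for every order and behaviour. A
further desired service cannot be added: either its agent is already served, or, by rationality, the
item was not on her menu and is sold out. -/
theorem postedPricing_isMaximalDesired (hc : c.IsRational p) (σ : Equiv.Perm (Fin m))
    (v : Profile m n) : I.IsMaximalDesired p v ((I.postedPricing p σ c).served v) := by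
  set M := I.postedPricing p σ c
  refine ⟨⟨postedPricing_isFeasible hc σ v, ?_⟩, ?_⟩
  · rintro ⟨i, j⟩ hs
    have hs : M.alloc v i = some j := by simpa [Mechanism.served] using hs
    obtain ⟨T, hT, -⟩ := exists_menu (I := I) (p := p) σ c i v
    have h := hc i (fun j => v (i, j)) T
    rw [← hT v fun _ _ => rfl] at h
    change match M.alloc v i with | some j => _ | none => _ at h
    rw [hs] at h
    exact h.2.1
  · rintro S ⟨hS, hd⟩ hsub ⟨i, j⟩ hs
    by_contra hno
    rcases ha : M.alloc v i with _ | j'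
    · obtain ⟨T, hT, hT'⟩ := exists_menu (I := I) (p := p) σ c i v
      have h := hc i (fun j => v (i, j)) T
      rw [← hT v fun _ _ => rfl] at h
      change match M.alloc v i with | some j => _ | none => _ at h
      rw [ha] at h
      have hj : j ∉ T := fun hj => absurd (hd (i, j) hs) (not_le.2 (h j hj))
      have h1 := hT' j hj
      rw [← card_served_item] at h1
      refine absurd (hS.2 j) (not_le.2 (h1.trans_lt (Finset.card_lt_card ?_)))
      refine Finset.ssubset_iff_of_subset (Finset.filter_subset_filter _ hsub) |>.2
        ⟨(i, j), by simp [hs], fun h' => hno (Finset.mem_filter.1 h').1⟩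
    · have h1 : (i, j') ∈ S := hsub (by simp [Mechanism.served, ha])
      have := Finset.card_le_one.1 (hS.1 i) (i, j) (by simp [hs]) (i, j') (by simp [h1])
      rw [this] at hno
      exact hno (by simp [Mechanism.served, ha])

theorem obliviousRevenueAt_le_postedPricing (hc : c.IsRational p) (σ : Equiv.Perm (Fin m))
    (v : Profile m n) :
    I.obliviousRevenueAt p v ≤ ENNReal.ofReal ((I.postedPricing p σ c).revenue v) := by
  refine (iInf₂_le _ (postedPricing_isMaximalDesired hc σ v)).trans ?_
  rw [Mechanism.revenue_eq_sum_served (postedPricing_isIndividuallyRational hc σ)]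
  have : ∀ s ∈ (I.postedPricing p σ c).served v, (I.postedPricing p σ c).pay v s.1 = p s := by
    intro s hs
    have hs : (I.postedPricing p σ c).alloc v s.1 = some s.2 := by
      simpa [Mechanism.served] using hs
    rw [postedPricing_pay, hs]
  rw [Finset.sum_congr rfl this, ENNReal.ofReal_sum_of_nonneg fun s _ => (p s).coe_nonneg]
  simp

/-- Prices define a truthful approximate OPM as soon as the expected quadratic lower bound on
their revenue is large compared with a dual solution. -/
theorem isTruthfulApproxOPM_of_le (I : Market m n) (α : ℝ≥0) (p : Service m n → ℝ≥0)
    (u : Fin m → ℝ) (w : Fin n → ℝ) (φ : Service m n → ℝ)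
    (hu : ∀ i, 0 ≤ u i) (hw : ∀ j, 0 ≤ w j) (hφ0 : ∀ s, 0 ≤ φ s)
    (hφ : ∀ s : Service m n, 0 < I.usableCopies s.2 → ∀ q : ℝ, 0 ≤ q →
      (q - (u s.1 + w s.2)) * I.acceptProb s q ≤ φ s)
    (h : ∑ i, u i + ∑ j, I.usableCopies j * w j + ∑ s, φ s ≤
      α * (∑ s, p s * I.usableProb s (p s) - 1 / 2 * ∑ s, ∑ s',
        conflict (fun j => (I.usableCopies j : ℝ)) s s' *
          (I.usableProb s (p s) * I.usableProb s' (p s') * max (p s : ℝ) (p s')))) :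
    I.IsTruthfulApproxOPM α p := by
  refine ⟨fun σ c hc => ⟨postedPricing_isFeasible hc σ, postedPricing_isTruthful hc σ,
    postedPricing_isIndividuallyRational hc σ, obliviousRevenueAt_le_postedPricing hc σ⟩, ?_⟩
  refine (I.optRevenue_le u w φ hu hw hφ0 hφ).trans ?_
  rw [EReal.coe_ennreal_le_coe_ennreal_iff]
  refine (ENNReal.ofReal_le_ofReal h).trans ?_
  rw [ENNReal.ofReal_mul α.coe_nonneg, ENNReal.ofReal_coe_nnreal]
  gcongr
  exact I.ofReal_le_obliviousRevenue p

end Market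

/-! ## Lotteries over prices -/

section Lottery

variable {α β : Type*} [Fintype α] [Fintype β] [DecidableEq α] [DecidableEq β]

/-- The loss from two services that are desired with probabilities `a`, `a'` at prices `p`, `p'`. -/
noncomputable def pairLoss (a p a' p' : ℝ) : ℝ := a * a' * max p p'

theorem pairLoss_comm (a p a' p' : ℝ) : pairLoss a p a' p' = pairLoss a' p' a p := by
  rw [pairLoss, pairLoss, max_comm, mul_comm a]

/-- If option `l < L` of service `e` has price `p e l` and acceptance probability `a e l`, then this
is the quadratic lower bound on the revenue when options are drawn independently with
probabilities `ν e l`. -/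
noncomputable def quadBound (κ : β → ℝ) (L : ℕ) (p a ν : α × β → ℕ → ℝ) : ℝ :=
  ∑ e, ∑ l ∈ Finset.range L, ν e l * (p e l * a e l) -
    1 / 2 * ∑ e, ∑ e', conflict κ e e' *
      ∑ l ∈ Finset.range L, ∑ l' ∈ Finset.range L,
        ν e l * ν e' l' * pairLoss (a e l) (p e l) (a e' l') (p e' l')

/-- The profit bound of the service with the larger price suffices. The charge term of the other
service is spare, so the common part `z` of the charges may be subtracted; this saving produces `3 /
2` instead of `2` in `conflict_sum_le`. -/
theorem pairLoss_le {a p a' p' ψ ψ' t t' z : ℝ} (ha : 0 ≤ a) (ha' : 0 ≤ a')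
    (hψ : 0 ≤ ψ) (hψ' : 0 ≤ ψ') (h : (p - t) * a ≤ ψ) (h' : (p' - t') * a' ≤ ψ')
    (hz : z ≤ t) (hz' : z ≤ t') :
    pairLoss a p a' p' ≤ (ψ + t * a) * a' + a * (ψ' + t' * a') - z * (a * a') := by
  unfold pairLoss
  have haa : 0 ≤ a * a' := mul_nonneg ha ha'
  rcases le_total p p' with hp | hp
  · rw [max_eq_right hp]
    nlinarith [mul_le_mul_of_nonneg_left h' ha, mul_nonneg hψ ha',
      mul_nonneg haa (sub_nonneg.2 hz)]
  · rw [max_eq_left hp]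
    nlinarith [mul_le_mul_of_nonneg_right h ha', mul_nonneg hψ' ha,
      mul_nonneg haa (sub_nonneg.2 hz')]

theorem sum_sameAgent_mul_le {f : α × β → ℝ} (hf : ∀ e, 0 ≤ f e) (e : α × β) :
    ∑ e', sameAgent e e' * f e' ≤ ∑ j, f (e.1, j) := by
  rw [Fintype.sum_prod_type, Finset.sum_eq_single e.1]
  · refine Finset.sum_le_sum fun j _ => mul_le_of_le_one_left (hf _) ?_
    unfold sameAgent; split_ifs <;> norm_num
  · intro i _ hi
    exact Finset.sum_eq_zero fun j _ => by simp [sameAgent, hi.symm]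
  · simp

theorem sum_sameItem_mul_le {κ : β → ℝ} (hκ : ∀ j, 0 ≤ κ j) {f : α × β → ℝ} (hf : ∀ e, 0 ≤ f e)
    (e : α × β) : ∑ e', sameItem κ e e' * f e' ≤ (κ e.2)⁻¹ * ∑ i, f (i, e.2) := by
  rw [Fintype.sum_prod_type_right, Finset.sum_eq_single e.2, Finset.mul_sum]
  · refine Finset.sum_le_sum fun i _ => mul_le_mul_of_nonneg_right ?_ (hf _)
    unfold sameItem; split_ifs
    · exact le_rfl
    · exact inv_nonneg.2 (hκ _)
  · intro j _ hj
    exact Finset.sum_eq_zero fun i _ => by simp [sameItem, hj.symm]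
  · simp

theorem sum_symm_mul {E : Type*} [Fintype E] {c : E → E → ℝ} (hc : ∀ e e', c e e' = c e' e)
    (f g : E → ℝ) : ∑ e, ∑ e', c e e' * (g e * f e') = ∑ e, ∑ e', c e e' * (f e * g e') := by
  rw [Finset.sum_comm]
  exact Finset.sum_congr rfl fun e _ => Finset.sum_congr rfl fun e' _ => by rw [hc]; ring

/-- One half of the conflicts. -/
theorem half_sum_le {E : Type*} [Fintype E] {c : E → E → ℝ} (hc0 : ∀ e e', 0 ≤ c e e')
    (hc : ∀ e e', c e e' = c e' e) {K : E → E → ℝ} {ρ a z : E → ℝ}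
    (hK : ∀ e e', c e e' ≠ 0 → K e e' ≤ ρ e * a e' + a e * ρ e' - z e * (a e * a e')) :
    1 / 2 * ∑ e, ∑ e', c e e' * K e e' ≤ ∑ e, (ρ e - 1 / 2 * z e * a e) * ∑ e', c e e' * a e' := by
  have h1 : ∑ e, ∑ e', c e e' * K e e' ≤
      ∑ e, ∑ e', (c e e' * (ρ e * a e') + c e e' * (a e * ρ e') -
        c e e' * (z e * (a e * a e'))) := by
    refine Finset.sum_le_sum fun e _ => Finset.sum_le_sum fun e' _ => ?_
    by_cases h : c e e' = 0
    · simp [h]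
    · have := mul_le_mul_of_nonneg_left (hK e e' h) (hc0 e e')
      linarith
  -- By symmetry of `c` the two mixed terms have the same sum, so the factor one half leaves a
  -- single copy.
  have h2 := sum_symm_mul hc ρ a
  have h3 : ∑ e, (ρ e - 1 / 2 * z e * a e) * ∑ e', c e e' * a e' =
      ∑ e, ∑ e', c e e' * (ρ e * a e') - 1 / 2 * ∑ e, ∑ e', c e e' * (z e * (a e * a e')) := by
    rw [Finset.mul_sum, ← Finset.sum_sub_distrib]
    refine Finset.sum_congr rfl fun e _ => ?_
    rw [Finset.mul_sum, Finset.mul_sum, ← Finset.sum_sub_distrib]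
    exact Finset.sum_congr rfl fun e' _ => by ring
  simp only [Finset.sum_sub_distrib, Finset.sum_add_distrib] at h1
  linarith

/-- The total loss from conflicts when the loads are at most `C`. -/
theorem conflict_sum_le {κ : β → ℝ} (hκ : ∀ j, 0 ≤ κ j) {K : α × β → α × β → ℝ}
    {ψ a : α × β → ℝ} {u : α → ℝ} {w : β → ℝ} {C : ℝ} (hψ : ∀ e, 0 ≤ ψ e) (ha : ∀ e, 0 ≤ a e)
    (hu : ∀ i, 0 ≤ u i) (hw : ∀ j, 0 ≤ w j)
    (hC : 0 ≤ C) (hA : ∀ i, ∑ j, a (i, j) ≤ C) (hB : ∀ j, ∑ i, a (i, j) ≤ C * κ j)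
    (hK : ∀ e e' z, z ≤ u e.1 + w e.2 → z ≤ u e'.1 + w e'.2 →
      K e e' ≤ (ψ e + (u e.1 + w e.2) * a e) * a e' + a e * (ψ e' + (u e'.1 + w e'.2) * a e') -
        z * (a e * a e')) :
    1 / 2 * ∑ e, ∑ e', conflict κ e e' * K e e' ≤
      2 * C * ∑ e, ψ e + 3 / 2 * C * ∑ e : α × β, (u e.1 + w e.2) * a e := by
  -- Services of one agent share the charge `u`, and services for one item share `w`; this common
  -- part is the `z` of the respective half of the conflicts.
  have h1 := half_sum_le (c := sameAgent) (z := fun e : α × β => u e.1) sameAgent_nonneg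
    sameAgent_comm (K := K) (ρ := fun e => ψ e + (u e.1 + w e.2) * a e) (a := a)
    fun e e' h => hK e e' _ (by linarith [hw e.2]) (by
      have : e.1 = e'.1 := by by_contra h'; exact h (by simp [sameAgent, h'])
      rw [this]; linarith [hw e'.2])
  have h2 := half_sum_le (c := sameItem κ) (z := fun e : α × β => w e.2) (sameItem_nonneg hκ)
    (sameItem_comm κ) (K := K) (ρ := fun e => ψ e + (u e.1 + w e.2) * a e) (a := a)
    fun e e' h => hK e e' _ (by linarith [hu e.1]) (by
      have : e.2 = e'.2 := by by_contra h'; exact h (by simp [sameItem, h'])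
      rw [this]; linarith [hu e'.1])
  have hC1 : ∀ e, ∑ e', sameAgent e e' * a e' ≤ C := fun e =>
    (sum_sameAgent_mul_le ha e).trans (hA _)
  have hC2 : ∀ e, ∑ e', sameItem κ e e' * a e' ≤ C := fun e => by
    refine (sum_sameItem_mul_le hκ ha e).trans ?_
    rcases (hκ e.2).eq_or_lt with h | h
    · simpa [← h] using hC
    · rw [inv_mul_le_iff₀ h, mul_comm]; exact hB _
  have hs : ∑ e, ∑ e', conflict κ e e' * K e e' =
      ∑ e, ∑ e', sameAgent e e' * K e e' + ∑ e, ∑ e', sameItem κ e e' * K e e' := by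
    simp only [conflict, add_mul, Finset.sum_add_distrib]
  rw [hs, mul_add]
  refine (add_le_add h1 h2).trans ?_
  rw [← Finset.sum_add_distrib, Finset.mul_sum, Finset.mul_sum, ← Finset.sum_add_distrib]
  refine Finset.sum_le_sum fun e _ => ?_
  have e1 : 0 ≤ u e.1 * a e := mul_nonneg (hu _) (ha e)
  have e2 : 0 ≤ w e.2 * a e := mul_nonneg (hw _) (ha e)
  -- In total `ψ` occurs `2 * C` times, while `u * a` occurs `C / 2` times through the agent and `C`
  -- times through the item, and `w * a` vice versa.
  have k1 := mul_le_mul_of_nonneg_left (hC1 e)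
    (show 0 ≤ ψ e + (u e.1 + w e.2) * a e - 1 / 2 * u e.1 * a e by linarith [hψ e])
  have k2 := mul_le_mul_of_nonneg_left (hC2 e)
    (show 0 ≤ ψ e + (u e.1 + w e.2) * a e - 1 / 2 * w e.2 * a e by linarith [hψ e])
  linarith

/-! ### Derandomization -/

/-- The gain from option `l` of service `e`, given the lotteries of the other services. -/
noncomputable def optionScore (κ : β → ℝ) (L : ℕ) (p a ν : α × β → ℕ → ℝ) (e : α × β) (l : ℕ) :
    ℝ :=
  p e l * a e l - ∑ e', conflict κ e e' * ∑ l' ∈ Finset.range L,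
    ν e' l' * pairLoss (a e l) (p e l) (a e' l') (p e' l')

/-- A service has no conflict with itself, so the quadratic bound is affine in the lottery of a
single service. The symmetry of the conflicts cancels the factor one half in the coefficients. -/
theorem quadBound_update (κ : β → ℝ) (L : ℕ) (p a ν : α × β → ℕ → ℝ) (e : α × β) (μ : ℕ → ℝ)
    (he : ν e = 0) :
    quadBound κ L p a (Function.update ν e μ) =
      quadBound κ L p a ν + ∑ l ∈ Finset.range L, μ l * optionScore κ L p a ν e l := by
  set δ : α × β → ℕ → ℝ := fun e' l => if e' = e then μ l else 0 with hδ
  have hν : ∀ e' l, Function.update ν e μ e' l = ν e' l + δ e' l := by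
    intro e' l
    by_cases h : e' = e
    · subst h; simp [hδ, he]
    · simp [hδ, h]
  set Q : (α × β → ℕ → ℝ) → (α × β → ℕ → ℝ) → ℝ := fun ν ν' => ∑ e, ∑ e', conflict κ e e' *
      ∑ l ∈ Finset.range L, ∑ l' ∈ Finset.range L,
        ν e l * ν' e' l' * pairLoss (a e l) (p e l) (a e' l') (p e' l') with hQ
  have hsymm : ∀ ν ν', Q ν ν' = Q ν' ν := by
    intro ν ν'
    simp only [hQ]
    rw [Finset.sum_comm]
    refine Finset.sum_congr rfl fun e₁ _ => Finset.sum_congr rfl fun e₂ _ => ?_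
    rw [conflict_comm, Finset.sum_comm]
    congr 1
    refine Finset.sum_congr rfl fun l _ => Finset.sum_congr rfl fun l' _ => ?_
    rw [pairLoss_comm, mul_comm (ν _ _)]
  have hadd : ∀ ν₁ ν₂ ν', Q (fun e l => ν₁ e l + ν₂ e l) ν' = Q ν₁ ν' + Q ν₂ ν' := by
    intro ν₁ ν₂ ν'
    simp only [hQ, add_mul, Finset.sum_add_distrib, mul_add]
  have hδδ : Q δ δ = 0 := by
    refine Finset.sum_eq_zero fun e₁ _ => Finset.sum_eq_zero fun e₂ _ => ?_
    by_cases h1 : e₁ = e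
    · by_cases h2 : e₂ = e
      · rw [h1, h2, conflict_self, zero_mul]
      · simp [hδ, h2]
    · simp [hδ, h1]
  have hδν : Q δ ν = ∑ l ∈ Finset.range L, μ l * ∑ e', conflict κ e e' *
      ∑ l' ∈ Finset.range L, ν e' l' * pairLoss (a e l) (p e l) (a e' l') (p e' l') := by
    simp only [hQ]
    rw [Finset.sum_eq_single e (fun e₁ _ h => by simp [hδ, h]) (by simp)]
    simp only [hδ, if_true, Finset.mul_sum]
    rw [Finset.sum_comm]
    refine Finset.sum_congr rfl fun l _ => ?_
    refine Finset.sum_congr rfl fun e' _ => Finset.sum_congr rfl fun l' _ => by ring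
  have hfun : (fun e' l => Function.update ν e μ e' l) = fun e' l => ν e' l + δ e' l := by
    funext e' l; exact hν e' l
  have hquad : quadBound κ L p a (Function.update ν e μ) =
      ∑ e, ∑ l ∈ Finset.range L, (ν e l + δ e l) * (p e l * a e l) -
        1 / 2 * Q (fun e l => ν e l + δ e l) (fun e l => ν e l + δ e l) := by
    simp only [quadBound, hQ, hν]
  have hlin : ∑ e', ∑ l ∈ Finset.range L, δ e' l * (p e' l * a e' l) =
      ∑ l ∈ Finset.range L, μ l * (p e l * a e l) := by
    rw [Finset.sum_eq_single e (fun e₁ _ h => by simp [hδ, h]) (by simp)]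
    simp [hδ]
  have hexp : Q (fun e l => ν e l + δ e l) (fun e l => ν e l + δ e l) = Q ν ν + 2 * Q δ ν := by
    rw [hadd, hsymm ν, hsymm δ, hadd, hadd, hδδ, hsymm ν δ]; ring
  rw [hquad, hexp, hδν]
  simp only [add_mul, Finset.sum_add_distrib, hlin, optionScore, mul_sub, Finset.sum_sub_distrib]
  simp only [quadBound, hQ]
  ring

/-- Replacing the lottery of a service by its best option does not decrease the bound. -/
theorem quadBound_le_update (κ : β → ℝ) (L : ℕ) (p a ν : α × β → ℕ → ℝ) (e : α × β) {b : ℕ}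
    (hb : b < L) (h0 : ∀ l, 0 ≤ ν e l) (h1 : ∑ l ∈ Finset.range L, ν e l = 1)
    (hbest : ∀ l < L, optionScore κ L p a (Function.update ν e 0) e l ≤
      optionScore κ L p a (Function.update ν e 0) e b) :
    quadBound κ L p a ν ≤
      quadBound κ L p a (Function.update ν e fun l => if l = b then 1 else 0) := by
  have hz : Function.update ν e 0 e = 0 := Function.update_self ..
  have e1 := quadBound_update κ L p a (Function.update ν e 0) e (ν e) hz
  have e2 := quadBound_update κ L p a (Function.update ν e 0) e
    (fun l => if l = b then 1 else 0) hz
  rw [Function.update_idem] at e1 e2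
  rw [Function.update_eq_self] at e1
  rw [e1, e2]
  refine add_le_add le_rfl ?_
  have : ∑ l ∈ Finset.range L, (if l = b then (1 : ℝ) else 0) *
      optionScore κ L p a (Function.update ν e 0) e l =
      optionScore κ L p a (Function.update ν e 0) e b := by
    simp [hb]
  rw [this]
  calc _ ≤ ∑ l ∈ Finset.range L, ν e l * optionScore κ L p a (Function.update ν e 0) e b :=
        Finset.sum_le_sum fun l hl =>
          mul_le_mul_of_nonneg_left (hbest l (Finset.mem_range.1 hl)) (h0 l)
    _ = _ := by rw [← Finset.sum_mul, h1, one_mul]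

/-- The bound for pure choices of options. -/
theorem quadBound_pure (κ : β → ℝ) {L : ℕ} (p a : α × β → ℕ → ℝ) {b : α × β → ℕ}
    (hb : ∀ e, b e < L) :
    quadBound κ L p a (fun e l => if l = b e then 1 else 0) =
      ∑ e, p e (b e) * a e (b e) - 1 / 2 * ∑ e, ∑ e', conflict κ e e' *
        (a e (b e) * a e' (b e') * max (p e (b e)) (p e' (b e'))) := by
  simp [quadBound, pairLoss, hb]

end Lottery

/-! ## Dual charges by a subgradient method -/

section Dynamics

variable {α β : Type*} [Fintype α] [Fintype β]

/-- The options `l < L` of the services have acceptance probabilities `a e l`, prices `p e l` and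
revenues of at most `2 * V`, and there are prices above every relevant charge. -/
structure IsOptionTable (N V : ℝ) (κ : β → ℝ) (L : ℕ) (p a : α × β → ℕ → ℝ) : Prop where
  card_le : (Fintype.card α : ℝ) + Fintype.card β ≤ N
  one_le : 1 ≤ N
  V_nonneg : 0 ≤ V
  copies : ∀ j, κ j = 0 ∨ 1 ≤ κ j
  copies_le : ∀ j, κ j ≤ N
  unusable : ∀ e : α × β, κ e.2 = 0 → ∀ l < L, a e l = 0
  a_nonneg : ∀ e, ∀ l < L, 0 ≤ a e l
  a_le_one : ∀ e, ∀ l < L, a e l ≤ 1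
  p_nonneg : ∀ e, ∀ l < L, 0 ≤ p e l
  revenue_le : ∀ e, ∀ l < L, p e l * a e l ≤ 2 * V
  top : ∀ e, ∀ t, 0 ≤ t → t ≤ 14 * N * V → ∃ l < L, 0 ≤ (p e l - t) * a e l

/-- In every round, each service picks a most profitable option at the current charges, and the
charges move in the direction of the excess demand over a third of the supply. -/
structure IsDynamics (κ : β → ℝ) (L T : ℕ) (p a : α × β → ℕ → ℝ) (step : ℝ)
    (u : ℕ → α → ℝ) (w : ℕ → β → ℝ) (ch : ℕ → α × β → ℕ) : Prop where
  u_zero : ∀ i, u 0 i = 0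
  w_zero : ∀ j, w 0 j = 0
  u_succ : ∀ τ < T, ∀ i,
    u (τ + 1) i = max 0 (u τ i + step * (∑ j, a (i, j) (ch τ (i, j)) - 1 / 3))
  w_succ : ∀ τ < T, ∀ j,
    w (τ + 1) j = max 0 (w τ j + step * (∑ i, a (i, j) (ch τ (i, j)) - κ j / 3))
  ch_lt : ∀ τ < T, ∀ e, ch τ e < L
  best : ∀ τ < T, ∀ e : α × β, ∀ l < L, (p e l - (u τ e.1 + w τ e.2)) * a e l ≤
    (p e (ch τ e) - (u τ e.1 + w τ e.2)) * a e (ch τ e)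

theorem exists_large_of_sum {γ : Type*} [Fintype γ] {f : γ → ℝ} {N : ℝ} (hN : 0 < N)
    (hc : (Fintype.card γ : ℝ) ≤ N) (h : 1 / 3 < ∑ x, f x) : ∃ x, 1 / (3 * N) < f x := by
  by_contra! hno
  have h1 : ∑ x, f x ≤ ∑ _x : γ, 1 / (3 * N) := Finset.sum_le_sum fun x _ => hno x
  rw [Finset.sum_const, Finset.card_univ, nsmul_eq_mul] at h1
  have h2 : (Fintype.card γ : ℝ) * (1 / (3 * N)) ≤ N * (1 / (3 * N)) :=
    mul_le_mul_of_nonneg_right hc (by positivity)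
  have h3 : N * (1 / (3 * N)) = 1 / 3 := by field_simp
  linarith

variable {N V step : ℝ} {κ : β → ℝ} {L T : ℕ} {p a : α × β → ℕ → ℝ}
  {u : ℕ → α → ℝ} {w : ℕ → β → ℝ} {ch : ℕ → α × β → ℕ}

namespace IsDynamics

theorem u_nonneg (hd : IsDynamics κ L T p a step u w ch) {τ : ℕ} (hτ : τ ≤ T) (i : α) :
    0 ≤ u τ i := by
  cases τ with
  | zero => rw [hd.u_zero]
  | succ τ => rw [hd.u_succ τ hτ]; exact le_max_left _ _

theorem w_nonneg (hd : IsDynamics κ L T p a step u w ch) {τ : ℕ} (hτ : τ ≤ T) (j : β) :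
    0 ≤ w τ j := by
  cases τ with
  | zero => rw [hd.w_zero]
  | succ τ => rw [hd.w_succ τ hτ]; exact le_max_left _ _

/-- A charge on which there is excess demand is small. -/
theorem charge_le (ho : IsOptionTable N V κ L p a) (hs0 : 0 ≤ step)
    (hs : step * N ≤ V) {γ : Type*} [Fintype γ] {f r : γ → ℝ} {x y c : ℝ}
    (hcard : (Fintype.card γ : ℝ) ≤ N) (hf1 : ∀ k, f k ≤ 1)
    (hc : c = 0 ∧ (∀ k, f k = 0) ∨ 1 ≤ c)
    (hr : ∀ k, x * f k ≤ r k) (hr' : ∀ k, r k ≤ 2 * V) (hx : x ≤ 7 * N * V)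
    (hy : y = max 0 (x + step * (∑ k, f k - c / 3))) : y ≤ 7 * N * V := by
  have hV := ho.V_nonneg
  have hN : 0 < N := by linarith [ho.one_le]
  rw [hy]
  refine max_le (by positivity) ?_
  rcases le_or_gt (∑ k, f k) (c / 3) with h | h
  · nlinarith [mul_nonneg hs0 (sub_nonneg.2 h)]
  -- Without capacity there is no demand, so excess demand forces `1 ≤ c` and some acceptance
  -- probability above `1 / (3 * N)`. The revenue of that service, at most `2 * V`, covers `x * f
  -- k`; hence `x ≤ 6 * N * V`, and one more step adds at most `V`.
  · have hc1 : 1 ≤ c := by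
      rcases hc with ⟨hc, hf⟩ | hc
      · simp [hf, hc] at h
      · exact hc
    obtain ⟨k, hk⟩ := exists_large_of_sum hN hcard (lt_of_le_of_lt (by linarith) h)
    have h1 : x ≤ 6 * N * V := by
      by_contra! h1
      have h2 : 6 * N * V * (1 / (3 * N)) < x * f k := by
        have hx0 : 0 < x := lt_of_le_of_lt (by positivity) h1
        calc 6 * N * V * (1 / (3 * N)) ≤ x * (1 / (3 * N)) :=
              mul_le_mul_of_nonneg_right h1.le (by positivity)
          _ < x * f k := mul_lt_mul_of_pos_left hk hx0
      have h3 : 6 * N * V * (1 / (3 * N)) = 2 * V := by field_simp; ring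
      linarith [hr k, hr' k]
    have h2 : ∑ k, f k ≤ N := by
      refine le_trans ?_ hcard
      calc ∑ k, f k ≤ ∑ _k : γ, (1 : ℝ) := Finset.sum_le_sum fun k _ => hf1 k
        _ = _ := by simp
    have h3 : step * (∑ k, f k - c / 3) ≤ step * N :=
      mul_le_mul_of_nonneg_left (by linarith) hs0
    nlinarith [mul_nonneg (sub_nonneg.2 ho.one_le) hV]

theorem charges_le (hd : IsDynamics κ L T p a step u w ch) (ho : IsOptionTable N V κ L p a)
    (hs0 : 0 ≤ step) (hs : step * N ≤ V) {τ : ℕ} (hτ : τ ≤ T) :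
    (∀ i, u τ i ≤ 7 * N * V) ∧ ∀ j, w τ j ≤ 7 * N * V := by
  have hV := ho.V_nonneg
  have hN : 0 < N := by linarith [ho.one_le]
  have hcα : (Fintype.card α : ℝ) ≤ N := by
    linarith [ho.card_le, (Nat.cast_nonneg (Fintype.card β) : (0 : ℝ) ≤ _)]
  have hcβ : (Fintype.card β : ℝ) ≤ N := by
    linarith [ho.card_le, (Nat.cast_nonneg (Fintype.card α) : (0 : ℝ) ≤ _)]
  induction τ with
  | zero =>
    simp only [hd.u_zero, hd.w_zero]
    exact ⟨fun _ => by positivity, fun _ => by positivity⟩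
  | succ τ ih =>
    obtain ⟨ihu, ihw⟩ := ih (Nat.le_of_succ_le hτ)
    have hlt : τ < T := hτ
    -- The option from `top` never loses money at the current charges, so neither does the most
    -- profitable one.
    have hprofit : ∀ e : α × β, (u τ e.1 + w τ e.2) * a e (ch τ e) ≤
        p e (ch τ e) * a e (ch τ e) := by
      intro e
      obtain ⟨l, hl, h⟩ := ho.top e (u τ e.1 + w τ e.2)
        (add_nonneg (hd.u_nonneg hlt.le _) (hd.w_nonneg hlt.le _)) (by linarith [ihu e.1, ihw e.2])
      linarith [hd.best τ hlt e l hl]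
    have ha0 : ∀ e, 0 ≤ a e (ch τ e) := fun e => ho.a_nonneg e _ (hd.ch_lt τ hlt e)
    refine ⟨fun i => ?_, fun j => ?_⟩
    · refine charge_le ho hs0 hs (f := fun j => a (i, j) (ch τ (i, j)))
        (r := fun j => p (i, j) (ch τ (i, j)) * a (i, j) (ch τ (i, j))) hcβ
        (fun j => ho.a_le_one _ _ (hd.ch_lt τ hlt _)) (c := 1) (Or.inr le_rfl) (fun j => ?_)
        (fun j => ho.revenue_le _ _ (hd.ch_lt τ hlt _)) (ihu i) (hd.u_succ τ hlt i)
      have := hprofit (i, j)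
      have := mul_nonneg (hd.w_nonneg hlt.le j) (ha0 (i, j))
      simp only at *
      linarith
    · refine charge_le ho hs0 hs (f := fun i => a (i, j) (ch τ (i, j)))
        (r := fun i => p (i, j) (ch τ (i, j)) * a (i, j) (ch τ (i, j))) hcα
        (fun i => ho.a_le_one _ _ (hd.ch_lt τ hlt _)) (c := κ j) ?_ (fun i => ?_)
        (fun i => ho.revenue_le _ _ (hd.ch_lt τ hlt _)) (ihw j) (hd.w_succ τ hlt j)
      · exact (ho.copies j).imp (fun h => ⟨h, fun i => ho.unusable (i, j) h _ (hd.ch_lt τ hlt _)⟩) id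
      · have := hprofit (i, j)
        have := mul_nonneg (hd.u_nonneg hlt.le i) (ha0 (i, j))
        simp only at *
        linarith

/-- The total excess demand is bounded by the final charge. -/
theorem sum_excess_le {x f : ℕ → ℝ} (h0 : x 0 = 0)
    (h : ∀ τ < T, x (τ + 1) = max 0 (x τ + step * f τ)) :
    step * ∑ τ ∈ Finset.range T, f τ ≤ x T := by
  induction T with
  | zero => simp [h0]
  | succ T ih =>
    rw [Finset.sum_range_succ, mul_add, h T (Nat.lt_succ_self T)]
    exact (add_le_add (ih fun τ hτ => h τ (hτ.trans (Nat.lt_succ_self T))) le_rfl).trans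
      (le_max_right _ _)

/-- Charges are hardly ever paid for unused capacity. -/
theorem sum_charge_mul_excess_ge {x f : ℕ → ℝ} {b : ℝ} (h0 : x 0 = 0)
    (h : ∀ τ < T, x (τ + 1) = max 0 (x τ + step * f τ)) (hb : ∀ τ < T, f τ ^ 2 ≤ b) :
    -(step ^ 2 * b * T) ≤ 2 * step * ∑ τ ∈ Finset.range T, x τ * f τ := by
  -- Energy argument: in a round the squared charge grows by at most `2 * step * x * f + step ^ 2 *
  -- b`, since truncation at zero cannot enlarge it.
  suffices hmain : x T ^ 2 ≤ 2 * step * ∑ τ ∈ Finset.range T, x τ * f τ + step ^ 2 * b * T by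
    linarith [sq_nonneg (x T)]
  induction T with
  | zero => simp [h0]
  | succ T ih =>
    have ih := ih (fun τ hτ => h τ (hτ.trans (Nat.lt_succ_self T)))
      (fun τ hτ => hb τ (hτ.trans (Nat.lt_succ_self T)))
    rw [Finset.sum_range_succ, h T (Nat.lt_succ_self T)]
    have h1 : max 0 (x T + step * f T) ^ 2 ≤ (x T + step * f T) ^ 2 := by
      rcases le_total 0 (x T + step * f T) with h | h
      · rw [max_eq_right h]
      · rw [max_eq_left h]; nlinarith [sq_nonneg (x T + step * f T)]
    have h2 := mul_le_mul_of_nonneg_left (hb T (Nat.lt_succ_self T)) (sq_nonneg step)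
    push_cast
    nlinarith

end IsDynamics

end Dynamics

/-! ### Time averages and frequencies of choices -/

section Average

/-- The average over the first `T` rounds. -/
noncomputable def roundAvg (T : ℕ) (f : ℕ → ℝ) : ℝ := (T : ℝ)⁻¹ * ∑ τ ∈ Finset.range T, f τ

variable {T : ℕ}

theorem roundAvg_add (f g : ℕ → ℝ) : roundAvg T (fun τ => f τ + g τ) = roundAvg T f + roundAvg T g := by
  simp only [roundAvg, Finset.sum_add_distrib, mul_add]

theorem roundAvg_sub (f g : ℕ → ℝ) : roundAvg T (fun τ => f τ - g τ) = roundAvg T f - roundAvg T g := by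
  simp only [roundAvg, Finset.sum_sub_distrib, mul_sub]

theorem roundAvg_mul_const (f : ℕ → ℝ) (c : ℝ) : roundAvg T (fun τ => f τ * c) = roundAvg T f * c := by
  simp only [roundAvg, ← Finset.sum_mul, mul_assoc]

theorem roundAvg_const_mul (f : ℕ → ℝ) (c : ℝ) : roundAvg T (fun τ => c * f τ) = c * roundAvg T f := by
  simp only [roundAvg, ← Finset.mul_sum]; ring

theorem roundAvg_const (hT : 0 < T) (c : ℝ) : roundAvg T (fun _ => c) = c := by
  have : (T : ℝ) ≠ 0 := by positivity
  simp [roundAvg, this]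

theorem roundAvg_sum {γ : Type*} (s : Finset γ) (f : γ → ℕ → ℝ) :
    roundAvg T (fun τ => ∑ x ∈ s, f x τ) = ∑ x ∈ s, roundAvg T (f x) := by
  simp only [roundAvg]
  rw [Finset.sum_comm, Finset.mul_sum]

theorem roundAvg_mono {f g : ℕ → ℝ} (h : ∀ τ < T, f τ ≤ g τ) : roundAvg T f ≤ roundAvg T g :=
  mul_le_mul_of_nonneg_left (Finset.sum_le_sum fun τ hτ => h τ (Finset.mem_range.1 hτ))
    (by positivity)

theorem roundAvg_nonneg {f : ℕ → ℝ} (h : ∀ τ < T, 0 ≤ f τ) : 0 ≤ roundAvg T f :=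
  mul_nonneg (by positivity) (Finset.sum_nonneg fun τ hτ => h τ (Finset.mem_range.1 hτ))

/-- The frequency of the option `l` in a sequence of choices. -/
noncomputable def frequency (T : ℕ) (c : ℕ → ℕ) (l : ℕ) : ℝ :=
  roundAvg T fun τ => if l = c τ then 1 else 0

/-- Expectations under the lottery of frequencies are time averages; this connects `quadBound` with
the dynamics. -/
theorem sum_frequency_mul {L : ℕ} {c : ℕ → ℕ} (hc : ∀ τ < T, c τ < L) (f : ℕ → ℝ) :
    ∑ l ∈ Finset.range L, frequency T c l * f l = roundAvg T fun τ => f (c τ) := by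
  simp only [frequency, ← roundAvg_mul_const]
  rw [← roundAvg_sum]
  simp only [roundAvg]
  congr 1
  refine Finset.sum_congr rfl fun τ hτ => ?_
  simp [hc τ (Finset.mem_range.1 hτ)]

end Average

/-! ### Near-optimality of averaged charges and choices -/

section Dual

variable {α β : Type*} [Fintype α] [Fintype β] [DecidableEq α] [DecidableEq β]
  {N V step : ℝ} {κ : β → ℝ} {L T : ℕ} {p a : α × β → ℕ → ℝ}
  {u : ℕ → α → ℝ} {w : ℕ → β → ℝ} {ch : ℕ → α × β → ℕ}

namespace IsDynamics

theorem roundAvg_excess_le (hs : 0 < step) (hT : 0 < T) {x f : ℕ → ℝ} {B : ℝ} (h0 : x 0 = 0)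
    (h : ∀ τ < T, x (τ + 1) = max 0 (x τ + step * f τ)) (hB : x T ≤ B * (step * T)) :
    roundAvg T f ≤ B := by
  have h1 := sum_excess_le h0 h
  have hT' : (0 : ℝ) < T := by positivity
  rw [roundAvg, inv_mul_le_iff₀ hT']
  have : step * ∑ τ ∈ Finset.range T, f τ ≤ step * (T * B) := by linarith
  exact le_of_mul_le_mul_left this hs

theorem roundAvg_charge_mul_excess_ge (hs : 0 < step) (hT : 0 < T) {x f : ℕ → ℝ} {b : ℝ}
    (h0 : x 0 = 0) (h : ∀ τ < T, x (τ + 1) = max 0 (x τ + step * f τ))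
    (hb : ∀ τ < T, f τ ^ 2 ≤ b) : -(step * b / 2) ≤ roundAvg T fun τ => x τ * f τ := by
  have h1 := sum_charge_mul_excess_ge h0 h hb
  have hT' : (0 : ℝ) < T := by positivity
  rw [roundAvg, ← div_eq_inv_mul, le_div_iff₀ hT']
  have : 2 * step * (-(step * b / 2) * T) ≤ 2 * step * ∑ τ ∈ Finset.range T, x τ * f τ := by
    linarith
  exact le_of_mul_le_mul_left this (by positivity)

/-- The average charges and the average choices are a nearly optimal pair of a dual solution and
a lottery that uses about a third of the supply. -/
theorem exists_dual (ho : IsOptionTable N V κ L p a) (hd : IsDynamics κ L T p a step u w ch)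
    (hstep : step = V / (100 * N * N * N)) (hT : 140000 * N ^ 4 ≤ T) (hV : 0 < V)
    (hbest : ∃ e : α × β, 1 ≤ κ e.2 ∧ ∃ l < L, V ≤ p e l * a e l) :
    ∃ (u' : α → ℝ) (w' : β → ℝ) (ψ : α × β → ℝ), (∀ i, 0 ≤ u' i) ∧ (∀ j, 0 ≤ w' j) ∧
      (∀ e, 0 ≤ ψ e) ∧ (∀ i j, u' i + w' j ≤ 14 * N * V) ∧
      (∀ e : α × β, ∀ l < L, (p e l - (u' e.1 + w' e.2)) * a e l ≤ ψ e) ∧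
      4 / 27 * (∑ i, u' i + ∑ j, κ j * w' j + ∑ e, ψ e + V / 50) ≤
        quadBound κ L p a fun e => frequency T fun τ => ch τ e := by
  have hN := ho.one_le
  have hN0 : 0 < N := by linarith
  have hcα : (Fintype.card α : ℝ) ≤ N := by
    linarith [ho.card_le, (Nat.cast_nonneg (Fintype.card β) : (0 : ℝ) ≤ _)]
  have hcβ : (Fintype.card β : ℝ) ≤ N := by
    linarith [ho.card_le, (Nat.cast_nonneg (Fintype.card α) : (0 : ℝ) ≤ _)]
  have hT0 : 0 < T := by
    have : (0 : ℝ) < T := lt_of_lt_of_le (by positivity) hT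
    exact_mod_cast this
  have hs : 0 < step := by rw [hstep]; positivity
  have hsN : step * N ^ 3 = V / 100 := by rw [hstep]; field_simp
  have hsN' : step * N ≤ V := by
    have : step * N * 1 ≤ step * N * N ^ 2 :=
      mul_le_mul_of_nonneg_left (one_le_pow₀ hN) (by positivity)
    nlinarith
  have hκ0 : ∀ j, 0 ≤ κ j := fun j => by rcases ho.copies j with h | h <;> linarith
  set A : ℕ → α × β → ℝ := fun τ e => a e (ch τ e) with hA
  have hA0 : ∀ τ < T, ∀ e, 0 ≤ A τ e := fun τ hτ e => ho.a_nonneg e _ (hd.ch_lt τ hτ e)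
  have hA1 : ∀ τ < T, ∀ e, A τ e ≤ 1 := fun τ hτ e => ho.a_le_one e _ (hd.ch_lt τ hτ e)
  -- the averages
  set u' : α → ℝ := fun i => roundAvg T fun τ => u τ i with hu'
  set w' : β → ℝ := fun j => roundAvg T fun τ => w τ j with hw'
  set a' : α × β → ℝ := fun e => roundAvg T fun τ => A τ e with ha'
  set y : α × β → ℝ := fun e => roundAvg T fun τ => (u τ e.1 + w τ e.2) * A τ e with hy
  set ψ : α × β → ℝ := fun e => roundAvg T fun τ =>
    (p e (ch τ e) - (u τ e.1 + w τ e.2)) * A τ e with hψ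
  have hu0 : ∀ i, 0 ≤ u' i := fun i => roundAvg_nonneg fun τ hτ => hd.u_nonneg hτ.le i
  have hw0 : ∀ j, 0 ≤ w' j := fun j => roundAvg_nonneg fun τ hτ => hd.w_nonneg hτ.le j
  have ha0 : ∀ e, 0 ≤ a' e := fun e => roundAvg_nonneg fun τ hτ => hA0 τ hτ e
  have hcharge := fun τ (hτ : τ ≤ T) => hd.charges_le ho hs.le hsN' hτ
  have huw : ∀ i j, u' i + w' j ≤ 14 * N * V := by
    intro i j
    have h1 : u' i ≤ roundAvg T fun _ => 7 * N * V :=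
      roundAvg_mono fun τ hτ => (hcharge τ hτ.le).1 i
    have h2 : w' j ≤ roundAvg T fun _ => 7 * N * V :=
      roundAvg_mono fun τ hτ => (hcharge τ hτ.le).2 j
    rw [roundAvg_const hT0] at h1 h2
    linarith
  -- In every round the chosen option is at least as profitable as the fixed option `l`, whose
  -- profit is affine in the charges, so averaging preserves the inequality.
  have hψl : ∀ e : α × β, ∀ l < L, (p e l - (u' e.1 + w' e.2)) * a e l ≤ ψ e := by
    intro e l hl
    have h1 : (roundAvg T fun τ => (p e l - (u τ e.1 + w τ e.2)) * a e l) ≤ ψ e :=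
      roundAvg_mono fun τ hτ => hd.best τ hτ e l hl
    rwa [roundAvg_mul_const, roundAvg_sub, roundAvg_const hT0, roundAvg_add] at h1
  have hψ0 : ∀ e, 0 ≤ ψ e := fun e => roundAvg_nonneg fun τ hτ => by
    obtain ⟨l, hl, h⟩ := ho.top e (u τ e.1 + w τ e.2)
      (add_nonneg (hd.u_nonneg hτ.le _) (hd.w_nonneg hτ.le _))
      (by linarith [(hcharge τ hτ.le).1 e.1, (hcharge τ hτ.le).2 e.2])
    exact h.trans (hd.best τ hτ e l hl)
  refine ⟨u', w', ψ, hu0, hw0, hψ0, huw, hψl, ?_⟩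
  set X := ∑ i, u' i + ∑ j, κ j * w' j with hX
  have hX0 : 0 ≤ X := add_nonneg (Finset.sum_nonneg fun i _ => hu0 i)
    (Finset.sum_nonneg fun j _ => mul_nonneg (hκ0 j) (hw0 j))
  have hΨ0 : 0 ≤ ∑ e, ψ e := Finset.sum_nonneg fun e _ => hψ0 e
  -- the loads
  have hTs : 7 * N * V ≤ 1 / 200 * (step * T) := by
    have h1 : step * (140000 * N ^ 4) ≤ step * T := mul_le_mul_of_nonneg_left hT hs.le
    have h2 : step * (140000 * N ^ 4) = 140000 * N * (step * N ^ 3) := by ring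
    rw [h2, hsN] at h1
    linarith
  have hloadα : ∀ i, ∑ j, a' (i, j) ≤ 203 / 600 := by
    intro i
    have h1 := roundAvg_excess_le hs hT0 (x := fun τ => u τ i)
      (f := fun τ => ∑ j, A τ (i, j) - 1 / 3) (hd.u_zero i) (fun τ hτ => hd.u_succ τ hτ i)
      (((hcharge T le_rfl).1 i).trans hTs)
    rw [roundAvg_sub, roundAvg_const hT0, roundAvg_sum] at h1
    linarith
  have hloadβ : ∀ j, ∑ i, a' (i, j) ≤ 203 / 600 * κ j := by
    intro j
    rcases ho.copies j with h | h
    · have : ∀ i, a' (i, j) = 0 := by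
        intro i
        refine le_antisymm ?_ (ha0 _)
        have : a' (i, j) ≤ roundAvg T fun _ => 0 := roundAvg_mono fun τ hτ =>
          (ho.unusable (i, j) h _ (hd.ch_lt τ hτ _)).le
        rwa [roundAvg_const hT0] at this
      simp [this, h]
    · have h1 := roundAvg_excess_le hs hT0 (x := fun τ => w τ j)
        (f := fun τ => ∑ i, A τ (i, j) - κ j / 3) (hd.w_zero j) (fun τ hτ => hd.w_succ τ hτ j)
        (((hcharge T le_rfl).2 j).trans hTs)
      rw [roundAvg_sub, roundAvg_const hT0, roundAvg_sum] at h1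
      change ∑ i, a' (i, j) - _ ≤ _ at h1
      linarith
  -- the charges paid
  have hpaidα : ∀ i, 1 / 3 * u' i - step * N ^ 2 / 2 ≤
      roundAvg T fun τ => ∑ j, u τ i * A τ (i, j) := by
    intro i
    have h1 := roundAvg_charge_mul_excess_ge hs hT0 (x := fun τ => u τ i)
      (f := fun τ => ∑ j, A τ (i, j) - 1 / 3) (b := N ^ 2) (hd.u_zero i)
      (fun τ hτ => hd.u_succ τ hτ i) (fun τ hτ => by
        have h2 : 0 ≤ ∑ j, A τ (i, j) := Finset.sum_nonneg fun j _ => hA0 τ hτ _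
        have h3 : ∑ j, A τ (i, j) ≤ N := by
          refine le_trans ?_ hcβ
          calc ∑ j, A τ (i, j) ≤ ∑ _j : β, (1 : ℝ) := Finset.sum_le_sum fun j _ => hA1 τ hτ _
            _ = _ := by simp
        exact sq_le_sq' (by linarith) (by linarith))
    simp only [mul_sub] at h1
    rw [roundAvg_sub, roundAvg_mul_const] at h1
    simp only [Finset.mul_sum] at h1
    change _ ≤ _ - u' i * _ at h1
    linarith
  have hpaidβ : ∀ j, 1 / 3 * (κ j * w' j) - step * N ^ 2 / 2 ≤
      roundAvg T fun τ => ∑ i, w τ j * A τ (i, j) := by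
    intro j
    have h1 := roundAvg_charge_mul_excess_ge hs hT0 (x := fun τ => w τ j)
      (f := fun τ => ∑ i, A τ (i, j) - κ j / 3) (b := N ^ 2) (hd.w_zero j)
      (fun τ hτ => hd.w_succ τ hτ j) (fun τ hτ => by
        have h2 : 0 ≤ ∑ i, A τ (i, j) := Finset.sum_nonneg fun i _ => hA0 τ hτ _
        have h3 : ∑ i, A τ (i, j) ≤ N := by
          refine le_trans ?_ hcα
          calc ∑ i, A τ (i, j) ≤ ∑ _i : α, (1 : ℝ) := Finset.sum_le_sum fun i _ => hA1 τ hτ _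
            _ = _ := by simp
        have := ho.copies_le j
        have := hκ0 j
        exact sq_le_sq' (by linarith) (by linarith))
    simp only [mul_sub] at h1
    rw [roundAvg_sub, roundAvg_mul_const] at h1
    simp only [Finset.mul_sum] at h1
    change _ ≤ _ - w' j * _ at h1
    linarith
  have hy_eq : ∑ e, y e = ∑ i, (roundAvg T fun τ => ∑ j, u τ i * A τ (i, j)) +
      ∑ j, roundAvg T fun τ => ∑ i, w τ j * A τ (i, j) := by
    simp only [hy, add_mul, roundAvg_add, roundAvg_sum, Finset.sum_add_distrib]
    rw [Fintype.sum_prod_type, Fintype.sum_prod_type_right]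
  -- Approximate complementary slackness: there are at most `N` charges, each with error `step * N ^
  -- 2 / 2`, which makes `V / 200` in total.
  have hY : 1 / 3 * X - V / 200 ≤ ∑ e, y e := by
    have h1 := Finset.sum_le_sum fun i (_ : i ∈ Finset.univ) => hpaidα i
    have h2 := Finset.sum_le_sum fun j (_ : j ∈ Finset.univ) => hpaidβ j
    rw [Finset.sum_sub_distrib, ← Finset.mul_sum, Finset.sum_const, nsmul_eq_mul,
      Finset.card_univ] at h1 h2
    have h3 : ((Fintype.card α : ℝ) + Fintype.card β) * (step * N ^ 2 / 2) ≤
        N * (step * N ^ 2 / 2) := mul_le_mul_of_nonneg_right ho.card_le (by positivity)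
    have h4 : N * (step * N ^ 2 / 2) = V / 200 := by
      linear_combination (1 / 2) * hsN
    rw [hy_eq]
    linarith
  -- the dual value is at least `V`
  have hXV : V ≤ X + ∑ e, ψ e := by
    obtain ⟨e, he, l, hl, hle⟩ := hbest
    have h1 := hψl e l hl
    have h2 : ψ e ≤ ∑ e, ψ e := Finset.single_le_sum (fun e _ => hψ0 e) (Finset.mem_univ e)
    have h3 : u' e.1 ≤ ∑ i, u' i := Finset.single_le_sum (fun i _ => hu0 i) (Finset.mem_univ e.1)
    have h4 : κ e.2 * w' e.2 ≤ ∑ j, κ j * w' j := Finset.single_le_sum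
      (fun j _ => mul_nonneg (hκ0 j) (hw0 j)) (Finset.mem_univ e.2)
    have h5 : w' e.2 ≤ κ e.2 * w' e.2 := le_mul_of_one_le_left (hw0 _) he
    have h6 : (u' e.1 + w' e.2) * a e l ≤ u' e.1 + w' e.2 :=
      mul_le_of_le_one_right (add_nonneg (hu0 _) (hw0 _)) (ho.a_le_one e l hl)
    linarith
  -- the losses
  set K : α × β → α × β → ℝ := fun e e' => roundAvg T fun τ => roundAvg T fun τ' =>
    pairLoss (A τ e) (p e (ch τ e)) (A τ' e') (p e' (ch τ' e')) with hK
  -- The lotteries of two services are independent, so choices from different rounds meet in `K`.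
  -- The profit bound is therefore needed at the average charges instead of those of one round.
  have hpa : ∀ e : α × β, ∀ τ < T, (p e (ch τ e) - (u' e.1 + w' e.2)) * A τ e ≤ ψ e :=
    fun e τ hτ => hψl e _ (hd.ch_lt τ hτ e)
  have hKle : ∀ e e' z, z ≤ u' e.1 + w' e.2 → z ≤ u' e'.1 + w' e'.2 →
      K e e' ≤ (ψ e + (u' e.1 + w' e.2) * a' e) * a' e' +
        a' e * (ψ e' + (u' e'.1 + w' e'.2) * a' e') - z * (a' e * a' e') := by
    intro e e' z hz hz'
    set t := u' e.1 + w' e.2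
    set t' := u' e'.1 + w' e'.2
    have h1 : K e e' ≤ roundAvg T fun τ => roundAvg T fun τ' =>
        (ψ e + (t + t' - z) * A τ e) * A τ' e' + ψ e' * A τ e :=
      roundAvg_mono fun τ hτ => roundAvg_mono fun τ' hτ' =>
        (pairLoss_le (hA0 τ hτ e) (hA0 τ' hτ' e') (hψ0 e) (hψ0 e') (hpa e τ hτ) (hpa e' τ' hτ')
          hz hz').trans (le_of_eq (by ring))
    refine h1.trans (le_of_eq ?_)
    simp only [roundAvg_add, roundAvg_const_mul, roundAvg_const hT0, roundAvg_mul_const]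
    change (ψ e + (t + t' - z) * a' e) * a' e' + ψ e' * a' e = _
    ring
  have hloss := conflict_sum_le hκ0 hψ0 ha0 hu0 hw0 (by norm_num) hloadα hloadβ hKle
  have hcost : ∑ e : α × β, (u' e.1 + w' e.2) * a' e ≤ 203 / 600 * X := by
    have h1 : ∑ e : α × β, (u' e.1 + w' e.2) * a' e =
        ∑ i, u' i * ∑ j, a' (i, j) + ∑ j, w' j * ∑ i, a' (i, j) := by
      simp only [add_mul, Finset.sum_add_distrib, Finset.mul_sum]
      rw [Fintype.sum_prod_type, Fintype.sum_prod_type_right]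
    have h2 : ∑ i, u' i * ∑ j, a' (i, j) ≤ ∑ i, u' i * (203 / 600) :=
      Finset.sum_le_sum fun i _ => mul_le_mul_of_nonneg_left (hloadα i) (hu0 i)
    have h3 : ∑ j, w' j * ∑ i, a' (i, j) ≤ ∑ j, 203 / 600 * (κ j * w' j) :=
      Finset.sum_le_sum fun j _ =>
        (mul_le_mul_of_nonneg_left (hloadβ j) (hw0 j)).trans (le_of_eq (by ring))
    rw [← Finset.sum_mul] at h2
    rw [← Finset.mul_sum] at h3
    linarith
  have hG : quadBound κ L p a (fun e => frequency T fun τ => ch τ e) =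
      ∑ e, ψ e + ∑ e, y e - 1 / 2 * ∑ e, ∑ e', conflict κ e e' * K e e' := by
    unfold quadBound
    congr 1
    · rw [← Finset.sum_add_distrib]
      refine Finset.sum_congr rfl fun e _ => ?_
      rw [sum_frequency_mul (c := fun τ => ch τ e) (fun τ hτ => hd.ch_lt τ hτ e)
        (fun l => p e l * a e l), ← roundAvg_add]
      congr 1
      funext τ
      simp only [hA]
      ring
    · congr 1
      refine Finset.sum_congr rfl fun e _ => Finset.sum_congr rfl fun e' _ => ?_
      congr 1
      simp only [mul_assoc, ← Finset.mul_sum]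
      simp only [sum_frequency_mul (c := fun τ => ch τ e') (fun τ hτ => hd.ch_lt τ hτ e')
        (fun l' => pairLoss _ _ (a e' l') (p e' l'))]
      rw [sum_frequency_mul (c := fun τ => ch τ e) (fun τ hτ => hd.ch_lt τ hτ e)
        (fun l => roundAvg T fun τ' => pairLoss (a e l) (p e l) _ _)]
  -- The coefficient of `∑ ψ` is `1 - 2 * (203 / 600) > 0.32` and that of `X` is `1 / 3 - 3 / 2 *
  -- (203 / 600) ^ 2 > 0.161`, against `4 / 27 < 0.149`. By `hXV` the surplus exceeds `0.012 * V`,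
  -- which covers `V / 200` and `4 / 27 * (V / 50)`.
  rw [hG]
  linarith

end IsDynamics

end Dual

/-! ## Reasoning about programs -/

namespace RealRAM

namespace State

@[simp] theorem setNat_nat (s : State) (x k y : ℕ) :
    (s.setNat x k).nat y = if y = x then k else s.nat y := rfl

@[simp] theorem setNat_real (s : State) (x k : ℕ) : (s.setNat x k).real = s.real := rfl

@[simp] theorem setReal_nat (s : State) (a i j l : ℕ) (r : ℝ) :
    (s.setReal a i j l r).nat = s.nat := rfl

@[simp] theorem setReal_real (s : State) (a i j l : ℕ) (r : ℝ) (a' i' j' l' : ℕ) :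
    (s.setReal a i j l r).real a' i' j' l' =
      if a' = a ∧ i' = i ∧ j' = j ∧ l' = l then r else s.real a' i' j' l' := rfl

end State

namespace Program

variable {O : Oracles}

/-- The final state of a program. -/
noncomputable def sem (O : Oracles) (c : Program) (s : State) : State := (c.run O s).1

/-- The number of steps of a program. -/
noncomputable def steps (O : Oracles) (c : Program) (s : State) : ℕ := (c.run O s).2

@[simp] theorem sem_skip (s : State) : sem O .skip s = s := rfl

@[simp] theorem sem_setNat (x : ℕ) (e : NExp) (s : State) :
    sem O (.setNat x e) s = s.setNat x (e.eval s) := rfl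

@[simp] theorem sem_setReal (a : ℕ) (i j l : NExp) (e : RExp) (s : State) :
    sem O (.setReal a i j l e) s =
      s.setReal a (i.eval s) (j.eval s) (l.eval s) (e.eval O s) := rfl

@[simp] theorem sem_seq (c d : Program) (s : State) :
    sem O (.seq c d) s = sem O d (sem O c s) := rfl

theorem sem_ite_pos {t : Test} {s : State} (h : t.holds O s) (c d : Program) :
    sem O (.ite t c d) s = sem O c s := by
  simp [sem, run, h]

theorem sem_ite_neg {t : Test} {s : State} (h : ¬ t.holds O s) (c d : Program) :
    sem O (.ite t c d) s = sem O d s := by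
  simp [sem, run, h]

open Classical in
theorem sem_ite (t : Test) (c d : Program) (s : State) :
    sem O (.ite t c d) s = if t.holds O s then sem O c s else sem O d s := by
  split_ifs with h
  · exact sem_ite_pos h c d
  · exact sem_ite_neg h c d

/-- The state and the number of steps after the first `k` iterations of a loop. -/
noncomputable def iterate (O : Oracles) (x : ℕ) (c : Program) (r : State × ℕ) (k : ℕ) : State × ℕ :=
  Nat.rec r (fun k r => ((c.run O (r.1.setNat x k)).1, r.2 + (c.run O (r.1.setNat x k)).2 + 1)) k

theorem run_loop (x : ℕ) (e : NExp) (c : Program) (s : State) :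
    (loop x e c).run O s = iterate O x c (s, e.cost + 1) (e.eval s) := rfl

theorem iterate_succ (x : ℕ) (c : Program) (r : State × ℕ) (k : ℕ) :
    iterate O x c r (k + 1) = (sem O c ((iterate O x c r k).1.setNat x k),
      (iterate O x c r k).2 + steps O c ((iterate O x c r k).1.setNat x k) + 1) := rfl

/-- The program does not assign to the register `x`. -/
def keepsNat (x : ℕ) : Program → Bool
  | skip => true
  | setNat y _ => y != x
  | setReal _ _ _ _ _ => true
  | seq c d => c.keepsNat x && d.keepsNat x
  | ite _ c d => c.keepsNat x && d.keepsNat x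
  | loop y _ c => y != x && c.keepsNat x

/-- The program does not assign to the array `a`. -/
def keepsReal (a : ℕ) : Program → Bool
  | skip => true
  | setNat _ _ => true
  | setReal b _ _ _ _ => b != a
  | seq c d => c.keepsReal a && d.keepsReal a
  | ite _ c d => c.keepsReal a && d.keepsReal a
  | loop _ _ c => c.keepsReal a

/-- Frame conditions come from a syntactic check, so for concrete programs `decide` proves them. -/
theorem sem_nat {c : Program} {x : ℕ} (h : c.keepsNat x = true) (s : State) :
    (sem O c s).nat x = s.nat x := by
  induction c generalizing s with
  | skip => rfl
  | setNat y e =>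
    have : y ≠ x := by simpa [keepsNat] using h
    simp [this.symm]
  | setReal a i j l e => rfl
  | seq c d ihc ihd =>
    simp only [keepsNat, Bool.and_eq_true] at h
    rw [sem_seq, ihd h.2, ihc h.1]
  | ite t c d ihc ihd =>
    simp only [keepsNat, Bool.and_eq_true] at h
    rw [sem_ite]
    split_ifs
    · exact ihc h.1 s
    · exact ihd h.2 s
  | loop y e c ih =>
    simp only [keepsNat, Bool.and_eq_true, bne_iff_ne, ne_eq] at h
    rw [sem, run_loop]
    induction e.eval s with
    | zero => rfl
    | succ k ihk =>
      rw [iterate_succ, ih h.2, State.setNat_nat, if_neg (Ne.symm h.1), ihk]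

theorem sem_real {c : Program} {a : ℕ} (h : c.keepsReal a = true) (s : State) :
    (sem O c s).real a = s.real a := by
  induction c generalizing s with
  | skip => rfl
  | setNat y e => rfl
  | setReal b i j l e =>
    have : b ≠ a := by simpa [keepsReal] using h
    funext i' j' l'
    simp [this.symm]
  | seq c d ihc ihd =>
    simp only [keepsReal, Bool.and_eq_true] at h
    rw [sem_seq, ihd h.2, ihc h.1]
  | ite t c d ihc ihd =>
    simp only [keepsReal, Bool.and_eq_true] at h
    rw [sem_ite]
    split_ifs
    · exact ihc h.1 s
    · exact ihd h.2 s
  | loop y e c ih =>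
    simp only [keepsReal] at h
    rw [sem, run_loop]
    induction e.eval s with
    | zero => rfl
    | succ k ihk => rw [iterate_succ, ih h, State.setNat_real, ihk]

/-- The invariant rule for loops; what the body does not assign to is known to be unchanged. -/
theorem sem_loop_induct {x : ℕ} {e : NExp} {c : Program} {s : State} (Inv : ℕ → State → Prop)
    (h0 : Inv 0 s)
    (hstep : ∀ k < e.eval s, ∀ s', Inv k s' →
      (∀ y, y ≠ x → c.keepsNat y = true → s'.nat y = s.nat y) →
      (∀ a, c.keepsReal a = true → s'.real a = s.real a) →
      Inv (k + 1) (sem O c (s'.setNat x k))) :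
    Inv (e.eval s) (sem O (.loop x e c) s) := by
  rw [sem, run_loop]
  have hnat : ∀ k y, y ≠ x → c.keepsNat y = true →
      (iterate O x c (s, e.cost + 1) k).1.nat y = s.nat y := by
    intro k y hy hc
    induction k with
    | zero => rfl
    | succ k ih => rw [iterate_succ, sem_nat hc, State.setNat_nat, if_neg hy, ih]
  have hreal : ∀ k a, c.keepsReal a = true →
      (iterate O x c (s, e.cost + 1) k).1.real a = s.real a := by
    intro k a hc
    induction k with
    | zero => rfl
    | succ k ih => rw [iterate_succ, sem_real hc, State.setNat_real, ih]
  have : ∀ k ≤ e.eval s, Inv k (iterate O x c (s, e.cost + 1) k).1 := by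
    intro k hk
    induction k with
    | zero => exact h0
    | succ k ih =>
      rw [iterate_succ]
      exact hstep k hk _ (ih (Nat.le_of_succ_le hk)) (hnat k) (hreal k)
  exact this _ le_rfl

/-- Assignments to array `a` concern the cells of the service in registers 5 and 6 only. -/
def ownCells (a : ℕ) : Program → Bool
  | skip => true
  | setNat x _ => x != 5 && x != 6
  | setReal _ (.reg 5) (.reg 6) _ _ => true
  | setReal b _ _ _ _ => b != a
  | seq c d => c.ownCells a && d.ownCells a
  | ite _ c d => c.ownCells a && d.ownCells a
  | loop x _ c => x != 5 && x != 6 && c.ownCells a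

/-- Registers 5 and 6 are constant during the run, so a body executed for one service leaves the
rows of all others in array `a` alone. This makes the iterations of `forServices` independent. -/
theorem sem_ownCells {c : Program} {a : ℕ} (h : c.ownCells a = true) (s : State) :
    ((sem O c s).nat 5 = s.nat 5 ∧ (sem O c s).nat 6 = s.nat 6) ∧
      ∀ i j, (i ≠ s.nat 5 ∨ j ≠ s.nat 6) → (sem O c s).real a i j = s.real a i j := by
  induction c generalizing s with
  | skip => exact ⟨⟨rfl, rfl⟩, fun _ _ _ => rfl⟩
  | setNat y e =>
    simp only [ownCells, Bool.and_eq_true, bne_iff_ne, ne_eq] at h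
    simp [Ne.symm h.1, Ne.symm h.2]
  | setReal b i j l e =>
    refine ⟨⟨rfl, rfl⟩, fun i' j' hij => ?_⟩
    funext l'
    rw [sem_setReal, State.setReal_real, if_neg]
    rintro ⟨rfl, rfl, rfl, rfl⟩
    unfold ownCells at h
    split at h <;> simp_all [NExp.eval]
  | seq c d ihc ihd =>
    simp only [ownCells, Bool.and_eq_true] at h
    obtain ⟨⟨h5, h6⟩, h1⟩ := ihc h.1 s
    obtain ⟨⟨h5', h6'⟩, h2⟩ := ihd h.2 (sem O c s)
    rw [sem_seq]
    refine ⟨⟨h5'.trans h5, h6'.trans h6⟩, fun i j hij => ?_⟩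
    rw [h2 i j (by rwa [h5, h6]), h1 i j hij]
  | ite t c d ihc ihd =>
    simp only [ownCells, Bool.and_eq_true] at h
    rw [sem_ite]
    split_ifs
    · exact ihc h.1 s
    · exact ihd h.2 s
  | loop y e c ih =>
    simp only [ownCells, Bool.and_eq_true, bne_iff_ne, ne_eq] at h
    refine sem_loop_induct (O := O) (e := e) (fun _ s' => (s'.nat 5 = s.nat 5 ∧
      s'.nat 6 = s.nat 6) ∧ ∀ i j, (i ≠ s.nat 5 ∨ j ≠ s.nat 6) → s'.real a i j = s.real a i j)
      ⟨⟨rfl, rfl⟩, fun _ _ _ => rfl⟩ fun k _ s' ⟨⟨h5, h6⟩, h1⟩ _ _ => ?_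
    have e5 : (s'.setNat y k).nat 5 = s.nat 5 := by
      rw [State.setNat_nat, if_neg (Ne.symm h.1.1), h5]
    have e6 : (s'.setNat y k).nat 6 = s.nat 6 := by
      rw [State.setNat_nat, if_neg (Ne.symm h.1.2), h6]
    obtain ⟨⟨i5, i6⟩, i1⟩ := ih h.2 (s'.setNat y k)
    rw [e5] at i5
    rw [e6] at i6
    refine ⟨⟨i5, i6⟩, fun i j hij => ?_⟩
    rw [i1 i j (by rwa [e5, e6]), State.setNat_real, h1 i j hij]

/-! ### Running time -/

/-- All loops are bounded by registers below `R`, and these are never assigned to. -/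
def simpleLoops (R : ℕ) : Program → Bool
  | skip => true
  | setNat y _ => decide (R ≤ y)
  | setReal _ _ _ _ _ => true
  | seq c d => c.simpleLoops R && d.simpleLoops R
  | ite _ c d => c.simpleLoops R && d.simpleLoops R
  | loop y (.reg r) c => decide (R ≤ y) && decide (r < R) && c.simpleLoops R
  | loop _ _ _ => false

open Polynomial in
/-- A bound on the running time in terms of a bound on the numbers of iterations. -/
noncomputable def costPoly : Program → Polynomial ℕ
  | skip => 1
  | setNat _ e => C (e.cost + 1)
  | setReal _ i j l e => C (i.cost + j.cost + l.cost + e.cost + 1)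
  | seq c d => c.costPoly + d.costPoly
  | ite t c d => C t.cost + c.costPoly + d.costPoly
  | loop _ e c => C (e.cost + 1) + X * (c.costPoly + 1)

theorem keepsNat_of_simpleLoops {R r : ℕ} (hr : r < R) {c : Program}
    (h : c.simpleLoops R = true) : c.keepsNat r = true := by
  induction c with
  | skip => rfl
  | setNat y e =>
    simp only [simpleLoops, decide_eq_true_eq] at h
    simp only [keepsNat, bne_iff_ne, ne_eq]
    omega
  | setReal a i j l e => rfl
  | seq c d ihc ihd =>
    simp only [simpleLoops, Bool.and_eq_true] at h
    simp [keepsNat, ihc h.1, ihd h.2]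
  | ite t c d ihc ihd =>
    simp only [simpleLoops, Bool.and_eq_true] at h
    simp [keepsNat, ihc h.1, ihd h.2]
  | loop y e c ih =>
    cases e with
    | reg r' =>
      simp only [simpleLoops, Bool.and_eq_true, decide_eq_true_eq] at h
      simp only [keepsNat, ih h.2, Bool.and_true, bne_iff_ne, ne_eq]
      omega
    | _ => simp [simpleLoops] at h

/-- The bounding registers never change, so every loop, at any depth, makes at most `K` iterations.
`costPoly` charges both branches of a test. -/
theorem steps_le {R K : ℕ} {c : Program} (h : c.simpleLoops R = true) (s : State)
    (hs : ∀ r < R, s.nat r ≤ K) : steps O c s ≤ c.costPoly.eval K := by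
  induction c generalizing s with
  | skip => simp [steps, run, costPoly]
  | setNat y e => simp [steps, run, costPoly]
  | setReal a i j l e => simp [steps, run, costPoly]
  | seq c d ihc ihd =>
    simp only [simpleLoops, Bool.and_eq_true] at h
    simp only [costPoly, Polynomial.eval_add]
    refine add_le_add (ihc h.1 s hs) (ihd h.2 (sem O c s) fun r hr => ?_)
    rw [sem_nat (keepsNat_of_simpleLoops hr h.1)]
    exact hs r hr
  | ite t c d ihc ihd =>
    simp only [simpleLoops, Bool.and_eq_true] at h
    have h1 := ihc h.1 s hs
    have h2 := ihd h.2 s hs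
    simp only [steps] at h1 h2
    simp only [costPoly, Polynomial.eval_add, Polynomial.eval_C, steps, run]
    split_ifs <;> simp only <;> omega
  | loop y e c ih =>
    cases e with
    | reg r' =>
      simp only [simpleLoops, Bool.and_eq_true, decide_eq_true_eq] at h
      have hkeep : ∀ r < R, c.keepsNat r = true := fun r hr => keepsNat_of_simpleLoops hr h.2
      have hmain : ∀ k, (∀ r < R, (iterate O y c (s, (NExp.reg r').cost + 1) k).1.nat r = s.nat r) ∧
          (iterate O y c (s, (NExp.reg r').cost + 1) k).2 ≤
            (NExp.reg r').cost + 1 + k * (c.costPoly.eval K + 1) := by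
        intro k
        induction k with
        | zero => exact ⟨fun _ _ => rfl, by simp [iterate]⟩
        | succ k ihk =>
          rw [iterate_succ]
          have hn : ∀ r < R, ((iterate O y c (s, (NExp.reg r').cost + 1) k).1.setNat y k).nat r =
              s.nat r := fun r hr => by
            rw [State.setNat_nat, if_neg (by omega), ihk.1 r hr]
          refine ⟨fun r hr => by rw [sem_nat (hkeep r hr), hn r hr], ?_⟩
          have := ih h.2 ((iterate O y c (s, (NExp.reg r').cost + 1) k).1.setNat y k)
            fun r hr => by rw [hn r hr]; exact hs r hr
          have h2 := ihk.2
          simp only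
          rw [add_mul, one_mul]
          omega
      rw [steps, run_loop]
      refine (hmain _).2.trans ?_
      simp only [costPoly, Polynomial.eval_add, Polynomial.eval_C, Polynomial.eval_mul,
        Polynomial.eval_X, Polynomial.eval_one]
      exact Nat.add_le_add_left (Nat.mul_le_mul_right _ (hs r' h.1.2)) _
    | _ => simp [simpleLoops] at h

/-! ### Loops over all services -/

/-- Run `c` for every service `(i, j)`, with `i` in register 5 and `j` in register 6. -/
def forServices (c : Program) : Program := .loop 5 (.reg 0) (.loop 6 (.reg 1) c)

/-- The invariant is indexed by the next service in lexicographic order, and `hrow` identifies the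
end of a row with the start of the next. -/
theorem sem_forServices_induct {c : Program} {s : State}
    (Inv : ℕ → ℕ → (ℕ → ℕ → ℕ → ℕ → ℝ) → Prop)
    (hc1 : c.keepsNat 1 = true) (hc5 : c.keepsNat 5 = true)
    (h0 : Inv 0 0 s.real) (hrow : ∀ i < s.nat 0, ∀ r, Inv i (s.nat 1) r → Inv (i + 1) 0 r)
    (hstep : ∀ i < s.nat 0, ∀ j < s.nat 1, ∀ s', Inv i j s'.real → s'.nat 5 = i → s'.nat 6 = j →
      (∀ y, y ≠ 5 → y ≠ 6 → c.keepsNat y = true → s'.nat y = s.nat y) →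
      (∀ a, c.keepsReal a = true → s'.real a = s.real a) →
      Inv i (j + 1) (sem O c s').real) :
    Inv (s.nat 0) 0 (sem O (forServices c) s).real := by
  refine sem_loop_induct (O := O) (e := .reg 0) (fun i s' => Inv i 0 s'.real) h0
    fun i hi s₁ hinv hn hr => ?_
  have hn' : ∀ y, y ≠ 5 → y ≠ 6 → c.keepsNat y = true → s₁.nat y = s.nat y := fun y h5 h6 hy =>
    hn y h5 (by simp [keepsNat, hy, h6.symm])
  have h1 : (NExp.reg 1).eval (s₁.setNat 5 i) = s.nat 1 := by
    change (s₁.setNat 5 i).nat 1 = _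
    rw [State.setNat_nat, if_neg (by norm_num), hn' 1 (by norm_num) (by norm_num) hc1]
  refine hrow i hi _ ?_
  have := sem_loop_induct (O := O) (x := 6) (e := .reg 1) (c := c) (s := s₁.setNat 5 i)
    (fun j s' => Inv i j s'.real) hinv fun j hj s₂ hinv₂ hn₂ hr₂ => ?_
  · rwa [h1] at this
  · rw [h1] at hj
    refine hstep i hi j hj _ hinv₂ ?_ rfl ?_ ?_
    · rw [State.setNat_nat, if_neg (by norm_num), hn₂ 5 (by norm_num) hc5]
      rfl
    · intro y h5 h6 hy
      rw [State.setNat_nat, if_neg h6, hn₂ y h6 hy, State.setNat_nat, if_neg h5, hn' y h5 h6 hy]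
    · intro a ha
      rw [State.setNat_real, hr₂ a ha, State.setNat_real, hr a ha]

/-- The rule for bodies that treat the services independently of each other. -/
theorem sem_forServices {c : Program} {s : State} (Pre Post : ℕ → ℕ → (ℕ → ℕ → ℕ → ℕ → ℝ) → Prop)
    (hc1 : c.keepsNat 1 = true) (hc5 : c.keepsNat 5 = true)
    (h0 : ∀ i j, Pre i j s.real)
    (hstep : ∀ i < s.nat 0, ∀ j < s.nat 1, ∀ s', Pre i j s'.real → s'.nat 5 = i → s'.nat 6 = j →
      (∀ y, y ≠ 5 → y ≠ 6 → c.keepsNat y = true → s'.nat y = s.nat y) →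
      (∀ a, c.keepsReal a = true → s'.real a = s.real a) →
      Post i j (sem O c s').real)
    (hother : ∀ i < s.nat 0, ∀ j < s.nat 1, ∀ s', s'.nat 5 = i → s'.nat 6 = j →
      (∀ y, y ≠ 5 → y ≠ 6 → c.keepsNat y = true → s'.nat y = s.nat y) →
      ∀ i' j', (i' ≠ i ∨ j' ≠ j) → (Pre i' j' s'.real → Pre i' j' (sem O c s').real) ∧
        (Post i' j' s'.real → Post i' j' (sem O c s').real)) :
    ∀ i < s.nat 0, ∀ j < s.nat 1, Post i j (sem O (forServices c) s).real := by
  -- Services before `(i, j)` already satisfy `Post`, all others still satisfy `Pre`.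
  have := sem_forServices_induct (O := O) (c := c) (s := s)
    (fun i j r => (∀ i' j', i' < i ∨ i' = i ∧ j' < j → j' < s.nat 1 → Post i' j' r) ∧
      ∀ i' j', i < i' ∨ i' = i ∧ j ≤ j' → Pre i' j' r) hc1 hc5 ?_ ?_ ?_
  · exact fun i hi j hj => this.1 i j (Or.inl hi) hj
  · exact ⟨fun i' j' h => by omega, fun i' j' _ => h0 i' j'⟩
  · rintro i - r ⟨hpost, hpre⟩
    exact ⟨fun i' j' h hj' => hpost i' j' (by omega) hj', fun i' j' h => hpre i' j' (by omega)⟩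
  · rintro i hi j hj s' ⟨hpost, hpre⟩ h5 h6 hn hr
    refine ⟨fun i' j' h hj' => ?_, fun i' j' h => ?_⟩
    · by_cases heq : i' = i ∧ j' = j
      · obtain ⟨rfl, rfl⟩ := heq
        exact hstep i' hi j' hj s' (hpre i' j' (by omega)) h5 h6 hn hr
      · exact (hother i hi j hj s' h5 h6 hn i' j' (by omega)).2 (hpost i' j' (by omega) hj')
    · exact (hother i hi j hj s' h5 h6 hn i' j' (by omega)).1 (hpre i' j' (by omega))

/-! ### Finding the best option -/

/-- Store in register 8 the number of the option (in register 7) for which `c` computes the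
largest score (in array 10). -/
def argmax (c : Program) : Program :=
  .seq (.setNat 8 (.const 0)) (.loop 7 (.reg 3) (.seq c
    (.ite (.natLt (.const 0) (.reg 7))
      (.ite (.realLt (.cell 10 (.const 1) (.const 0) (.const 0))
          (.cell 10 (.const 0) (.const 0) (.const 0)))
        (.seq (.setReal 10 (.const 1) (.const 0) (.const 0)
          (.cell 10 (.const 0) (.const 0) (.const 0))) (.setNat 8 (.reg 7))) .skip)
      (.seq (.setReal 10 (.const 1) (.const 0) (.const 0)
        (.cell 10 (.const 0) (.const 0) (.const 0))) (.setNat 8 (.reg 7))))))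

/-- The cell for the best score may hold a stale value from an earlier search. The first option is
therefore recorded without comparison, and the loop invariant is empty before it. -/
theorem sem_argmax {c : Program} {s : State} (f : ℕ → ℝ) (hM : 0 < s.nat 3)
    (h7 : c.keepsNat 7 = true) (h8 : c.keepsNat 8 = true)
    (hc : ∀ s', (∀ y, y ≠ 7 → y ≠ 8 → c.keepsNat y = true → s'.nat y = s.nat y) →
      (∀ a, a ≠ 10 → c.keepsReal a = true → s'.real a = s.real a) →
      (sem O c s').real 10 0 0 0 = f (s'.nat 7) ∧
      (sem O c s').real 10 1 0 0 = s'.real 10 1 0 0) :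
    (sem O (argmax c) s).nat 8 < s.nat 3 ∧
      ∀ l < s.nat 3, f l ≤ f ((sem O (argmax c) s).nat 8) := by
  have := sem_loop_induct (O := O) (x := 7) (e := .reg 3) (s := s.setNat 8 0)
    (c := .seq c (.ite (.natLt (.const 0) (.reg 7))
      (.ite (.realLt (.cell 10 (.const 1) (.const 0) (.const 0))
          (.cell 10 (.const 0) (.const 0) (.const 0)))
        (.seq (.setReal 10 (.const 1) (.const 0) (.const 0)
          (.cell 10 (.const 0) (.const 0) (.const 0))) (.setNat 8 (.reg 7))) .skip)
      (.seq (.setReal 10 (.const 1) (.const 0) (.const 0)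
        (.cell 10 (.const 0) (.const 0) (.const 0))) (.setNat 8 (.reg 7)))))
    (fun k s' => 0 < k → s'.nat 8 < k ∧ s'.real 10 1 0 0 = f (s'.nat 8) ∧
      ∀ l < k, f l ≤ f (s'.nat 8)) (by simp) ?_
  · have h3 : (NExp.reg 3).eval (s.setNat 8 0) = s.nat 3 := rfl
    rw [h3] at this
    have := this hM
    exact ⟨this.1, this.2.2⟩
  · intro k _ s' ih hn hr _
    obtain ⟨e1, e2⟩ := hc (s'.setNat 7 k) (fun y y7 y8 hy => by
        rw [State.setNat_nat, if_neg y7, hn y y7 (by simp [keepsNat, hy, y8.symm]),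
          State.setNat_nat, if_neg y8])
      (fun a ha hca => by
        rw [State.setNat_real, hr a (by simp [keepsReal, hca, ha.symm]), State.setNat_real])
    have e3 : (sem O c (s'.setNat 7 k)).nat 7 = k := by rw [sem_nat h7]; simp
    have e4 : (sem O c (s'.setNat 7 k)).nat 8 = s'.nat 8 := by rw [sem_nat h8]; simp
    have e5 : (s'.setNat 7 k).nat 7 = k := by simp
    rw [e5] at e1
    rw [State.setNat_real] at e2
    set t := sem O c (s'.setNat 7 k) with ht
    rw [sem_seq, ← ht]
    have hlt : ∀ l, l < k + 1 → l < k ∨ l = k := fun l h => by omega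
    rcases Nat.eq_zero_or_pos k with rfl | hk
    · rw [sem_ite_neg (by simp [Test.holds, NExp.eval, e3])]
      simp [RExp.eval, NExp.eval, e1, e3]
    · rw [sem_ite_pos (by simp [Test.holds, NExp.eval, e3, hk])]
      obtain ⟨i1, i2, i3⟩ := ih hk
      by_cases hf : f (s'.nat 8) < f k
      · rw [sem_ite_pos (by simp [Test.holds, RExp.eval, NExp.eval, e1, e2, i2, hf])]
        simp only [sem_seq, sem_setReal, sem_setNat, RExp.eval, NExp.eval, State.setNat_nat,
          State.setReal_nat, State.setNat_real, State.setReal_real, if_true, e1, e3, and_self]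
        refine ⟨Nat.lt_succ_self _, trivial, fun l hl => ?_⟩
        rcases hlt l hl with h | rfl
        · exact (i3 l h).trans hf.le
        · exact le_rfl
      · rw [sem_ite_neg (by simpa [Test.holds, RExp.eval, NExp.eval, e1, e2, i2] using hf)]
        rw [sem_skip, e4, e2]
        refine ⟨by omega, i2, fun l hl => ?_⟩
        rcases hlt l hl with h | rfl
        · exact i3 l h
        · exact not_lt.1 hf

end Program

end RealRAM

/-! ## The pricing program -/

namespace RealRAM

namespace Program

variable {O : Oracles}

/-- Register 2 becomes `m + n + 1`. -/
def setSize : Program := .setNat 2 (.plus (.plus (.reg 0) (.reg 1)) (.const 1))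

/-- Multiply register 3 by register 2. -/
def timesSize : Program :=
  .seq (.setNat 4 (.const 0)) (.seq (.loop 5 (.reg 2) (.setNat 4 (.plus (.reg 4) (.reg 3))))
    (.setNat 3 (.reg 4)))

/-- Register 3 becomes the number of options and of rounds. -/
def setGrid : Program :=
  .seq (.setNat 3 (.const 300000)) (.seq timesSize (.seq timesSize (.seq timesSize
    (.seq timesSize timesSize))))

/-- Array 3 receives the numbers of usable copies. -/
def capCopies : Program :=
  .loop 6 (.reg 1) (.ite
    (.realLt (.ofNat (.reg 0)) (.cell 0 (.reg 6) (.const 0) (.const 0)))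
    (.setReal 3 (.reg 6) (.const 0) (.const 0) (.ofNat (.reg 0)))
    (.setReal 3 (.reg 6) (.const 0) (.const 0) (.cell 0 (.reg 6) (.const 0) (.const 0))))

/-- The service at hand can be given at all. -/
def usableTest : Test := .realLt (.const 0) (.cell 3 (.reg 6) (.const 0) (.const 0))

/-- Array 2: the largest monopoly revenue. -/
def valueCell : RExp := .cell 2 (.const 0) (.const 0) (.const 0)

/-- The monopoly revenue of the service at hand. -/
def monopolyRevenue : RExp :=
  .times (.bestPrice (.reg 5) (.reg 6) (.const 0))
    (.accept (.reg 5) (.reg 6) (.bestPrice (.reg 5) (.reg 6) (.const 0)))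

/-- Compute the largest monopoly revenue. -/
def maxRevenue : Program :=
  forServices (.ite usableTest (.ite (.realLt valueCell monopolyRevenue)
    (.setReal 2 (.const 0) (.const 0) (.const 0) monopolyRevenue) .skip) .skip)

/-- The distance of the lower bounds on the prices of consecutive options. -/
def gridWidth : RExp :=
  .div valueCell (.times (.const 100) (.times (.ofNat (.reg 2)) (.ofNat (.reg 2))))

/-- Arrays 4 and 5 receive the prices and the acceptance probabilities of the options. -/
def fillTables : Program :=
  forServices (.ite usableTest (.loop 7 (.reg 3) (.seq
    (.setReal 4 (.reg 5) (.reg 6) (.reg 7)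
      (.bestPrice (.reg 5) (.reg 6) (.times (.ofNat (.reg 7)) gridWidth)))
    (.setReal 5 (.reg 5) (.reg 6) (.reg 7)
      (.accept (.reg 5) (.reg 6) (.cell 4 (.reg 5) (.reg 6) (.reg 7)))))) .skip)

/-- The profit from an option at the current charges, which are in arrays 6 and 7. -/
def profitScore : Program :=
  .setReal 10 (.const 0) (.const 0) (.const 0) (.times
    (.minus (.cell 4 (.reg 5) (.reg 6) (.reg 7)) (.plus (.cell 6 (.reg 5) (.const 0) (.const 0))
      (.cell 7 (.reg 6) (.const 0) (.const 0))))
    (.cell 5 (.reg 5) (.reg 6) (.reg 7)))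

/-- Choose an option for every service, record it in the lotteries in array 8, and put its
acceptance probability into array 9. -/
def chooseOptions : Program :=
  forServices (.seq (argmax profitScore) (.seq
    (.setReal 8 (.reg 5) (.reg 6) (.reg 8)
      (.plus (.cell 8 (.reg 5) (.reg 6) (.reg 8)) (.div (.const 1) (.ofNat (.reg 3)))))
    (.setReal 9 (.reg 5) (.reg 6) (.const 0) (.cell 5 (.reg 5) (.reg 6) (.reg 8)))))

/-- The step size of the subgradient method. -/
def stepSize : RExp :=
  .div valueCell (.times (.times (.times (.const 100) (.ofNat (.reg 2))) (.ofNat (.reg 2)))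
    (.ofNat (.reg 2)))

/-- The charge for the agent at hand. -/
def agentCharge : RExp := .cell 6 (.reg 5) (.const 0) (.const 0)

/-- The charge for the item at hand. -/
def itemCharge : RExp := .cell 7 (.reg 6) (.const 0) (.const 0)

/-- Update the charges of the agents. -/
def updateAgents : Program :=
  .loop 5 (.reg 0) (.seq
    (.setReal 6 (.reg 5) (.const 0) (.const 0) (.minus agentCharge (.times stepSize (.const (1 / 3)))))
    (.seq (.loop 6 (.reg 1) (.setReal 6 (.reg 5) (.const 0) (.const 0)
        (.plus agentCharge (.times stepSize (.cell 9 (.reg 5) (.reg 6) (.const 0))))))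
      (.ite (.realLt agentCharge (.const 0))
        (.setReal 6 (.reg 5) (.const 0) (.const 0) (.const 0)) .skip)))

/-- Update the charges of the items. -/
def updateItems : Program :=
  .loop 6 (.reg 1) (.seq
    (.setReal 7 (.reg 6) (.const 0) (.const 0) (.minus itemCharge
      (.times stepSize (.div (.cell 3 (.reg 6) (.const 0) (.const 0)) (.const 3)))))
    (.seq (.loop 5 (.reg 0) (.setReal 7 (.reg 6) (.const 0) (.const 0)
        (.plus itemCharge (.times stepSize (.cell 9 (.reg 5) (.reg 6) (.const 0))))))
      (.ite (.realLt itemCharge (.const 0))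
        (.setReal 7 (.reg 6) (.const 0) (.const 0) (.const 0)) .skip)))

/-- The subgradient method. -/
def runDynamics : Program :=
  .loop 11 (.reg 3) (.seq chooseOptions (.seq updateAgents updateItems))

/-! ### Effects of the single stages -/

theorem sem_timesSize (s : State) :
    (sem O timesSize s).nat 3 = s.nat 2 * s.nat 3 := by
  have := sem_loop_induct (O := O) (x := 5) (e := .reg 2)
    (c := .setNat 4 (.plus (.reg 4) (.reg 3))) (s := s.setNat 4 0)
    (fun k s' => s'.nat 4 = k * s.nat 3) (by simp) fun k _ s' h hn _ => by
      have := hn 3 (by norm_num) (by decide)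
      simp [NExp.eval, h, this, add_mul]
  simpa [timesSize, NExp.eval] using this

/-- One number serves as grid length and as number of rounds: `grid_top_le` asks for `300000 * N ^
5`, which exceeds the `140000 * N ^ 4` rounds of `exists_dual`. -/
theorem sem_setGrid (s : State) : (sem O setGrid s).nat 3 = 300000 * s.nat 2 ^ 5 := by
  have h2 : ∀ s, (sem O timesSize s).nat 2 = s.nat 2 := fun s => sem_nat (by decide) s
  simp only [setGrid, sem_seq, sem_timesSize, h2, sem_setNat, State.setNat_nat, NExp.eval]
  norm_num
  ring

theorem sem_capCopies (s : State) : ∀ j < s.nat 1,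
    (sem O capCopies s).real 3 j 0 0 = min (s.real 0 j 0 0) (s.nat 0) := by
  refine sem_loop_induct (O := O) (x := 6) (e := .reg 1) (s := s)
    (fun k s' => ∀ j < k, s'.real 3 j 0 0 = min (s.real 0 j 0 0) (s.nat 0)) (by simp)
    fun k _ s' h hn hr j hj => ?_
  have e0 := hn 0 (by norm_num) (by decide)
  have er := hr 0 (by decide)
  by_cases hlt : (s.nat 0 : ℝ) < s.real 0 k 0 0
  · rw [sem_ite_pos (by simpa [Test.holds, RExp.eval, NExp.eval, er, e0] using hlt)]
    rcases Nat.lt_succ_iff_lt_or_eq.1 hj with hj | rfl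
    · simp [RExp.eval, NExp.eval, h j hj, hj.ne]
    · simp [RExp.eval, NExp.eval, e0, hlt.le]
  · rw [sem_ite_neg (by simpa [Test.holds, RExp.eval, NExp.eval, er, e0] using hlt)]
    rcases Nat.lt_succ_iff_lt_or_eq.1 hj with hj | rfl
    · simp [RExp.eval, NExp.eval, h j hj, hj.ne]
    · simpa [RExp.eval, NExp.eval, er] using hlt

theorem holds_usableTest {s : State} :
    usableTest.holds O s ↔ 0 < s.real 3 (s.nat 6) 0 0 := by
  simp [usableTest, Test.holds, RExp.eval, NExp.eval]

/-- An upper bound alone would not do: attainment is what later makes the dual value at least `V`,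
so that errors proportional to `V` can be absorbed. -/
theorem sem_maxRevenue (s : State) (h0 : s.real 2 0 0 0 = 0) :
    (0 ≤ (sem O maxRevenue s).real 2 0 0 0 ∧
    ∀ i < s.nat 0, ∀ j < s.nat 1, 0 < s.real 3 j 0 0 →
      O.bestPrice i j 0 * O.accept i j (O.bestPrice i j 0) ≤ (sem O maxRevenue s).real 2 0 0 0) ∧
    ((sem O maxRevenue s).real 2 0 0 0 = 0 ∨ ∃ i < s.nat 0, ∃ j < s.nat 1, 0 < s.real 3 j 0 0 ∧
      (sem O maxRevenue s).real 2 0 0 0 =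
        O.bestPrice i j 0 * O.accept i j (O.bestPrice i j 0)) := by
  have := sem_forServices_induct (O := O) (s := s) (c := .ite usableTest
    (.ite (.realLt valueCell monopolyRevenue)
      (.setReal 2 (.const 0) (.const 0) (.const 0) monopolyRevenue) .skip) .skip)
    (fun i j r => (0 ≤ r 2 0 0 0 ∧ ∀ i' j', i' < i ∨ i' = i ∧ j' < j → j' < s.nat 1 →
      0 < s.real 3 j' 0 0 →
      O.bestPrice i' j' 0 * O.accept i' j' (O.bestPrice i' j' 0) ≤ r 2 0 0 0) ∧
      (r 2 0 0 0 = 0 ∨ ∃ i < s.nat 0, ∃ j < s.nat 1, 0 < s.real 3 j 0 0 ∧ r 2 0 0 0 =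
        O.bestPrice i j 0 * O.accept i j (O.bestPrice i j 0)))
    (by decide) (by decide) ?_ ?_ ?_
  · exact ⟨⟨this.1.1, fun i hi j hj => this.1.2 i j (Or.inl hi) hj⟩, this.2⟩
  · exact ⟨⟨h0.ge, fun i' j' h => by omega⟩, Or.inl h0⟩
  · exact fun i _ r h => ⟨⟨h.1.1, fun i' j' h' hj' => h.1.2 i' j' (by omega) hj'⟩, h.2⟩
  · rintro i hi j hj s' ⟨⟨hV, hle⟩, hatt⟩ h5 h6 - hr
    have h3 := hr 3 (by decide)
    have key : ∀ V, 0 ≤ V → s'.real 2 0 0 0 ≤ V → (0 < s.real 3 j 0 0 →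
        O.bestPrice i j 0 * O.accept i j (O.bestPrice i j 0) ≤ V) →
        ∀ i' j', i' < i ∨ i' = i ∧ j' < j + 1 → j' < s.nat 1 → 0 < s.real 3 j' 0 0 →
        O.bestPrice i' j' 0 * O.accept i' j' (O.bestPrice i' j' 0) ≤ V := by
      intro V _ h1 h2 i' j' h hj' hk
      by_cases heq : i' = i ∧ j' = j
      · obtain ⟨rfl, rfl⟩ := heq
        exact h2 hk
      · exact (hle i' j' (by omega) hj' hk).trans h1
    by_cases hu : 0 < s.real 3 j 0 0
    · rw [sem_ite_pos (holds_usableTest.2 (by rwa [h3, h6]))]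
      by_cases hlt : s'.real 2 0 0 0 < O.bestPrice i j 0 * O.accept i j (O.bestPrice i j 0)
      · rw [sem_ite_pos (by simpa [Test.holds, valueCell, monopolyRevenue, RExp.eval, NExp.eval,
          h5, h6] using hlt)]
        simp only [sem_setReal, monopolyRevenue, RExp.eval, NExp.eval, State.setReal_real, h5, h6,
          and_self, if_true, Rat.cast_zero]
        exact ⟨⟨hV.trans hlt.le, key _ (hV.trans hlt.le) hlt.le fun _ => le_rfl⟩,
          Or.inr ⟨i, hi, j, hj, hu, rfl⟩⟩
      · rw [sem_ite_neg (by simpa [Test.holds, valueCell, monopolyRevenue, RExp.eval, NExp.eval,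
          h5, h6] using hlt), sem_skip]
        exact ⟨⟨hV, key _ hV le_rfl fun _ => not_lt.1 hlt⟩, hatt⟩
    · rw [sem_ite_neg (fun h => hu (by rwa [holds_usableTest, h3, h6] at h)), sem_skip]
      exact ⟨⟨hV, key _ hV le_rfl fun h => absurd h hu⟩, hatt⟩

theorem eval_gridWidth (s : State) :
    gridWidth.eval O s = s.real 2 0 0 0 / (100 * (s.nat 2 * s.nat 2)) := by
  simp [gridWidth, valueCell, RExp.eval, NExp.eval]

theorem sem_fillTables (s : State) (h4 : ∀ i j l, s.real 4 i j l = 0)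
    (h5 : ∀ i j l, s.real 5 i j l = 0) : ∀ i < s.nat 0, ∀ j < s.nat 1,
    (0 < s.real 3 j 0 0 → ∀ l < s.nat 3,
      (sem O fillTables s).real 4 i j l =
        O.bestPrice i j (l * (s.real 2 0 0 0 / (100 * (s.nat 2 * s.nat 2)))) ∧
      (sem O fillTables s).real 5 i j l = O.accept i j ((sem O fillTables s).real 4 i j l)) ∧
    (¬ 0 < s.real 3 j 0 0 → ∀ l < s.nat 3, (sem O fillTables s).real 4 i j l = 0 ∧
      (sem O fillTables s).real 5 i j l = 0) := by
  refine sem_forServices (O := O) (s := s)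
    (fun i j r => ∀ l, r 4 i j l = 0 ∧ r 5 i j l = 0)
    (fun i j r => (0 < s.real 3 j 0 0 → ∀ l < s.nat 3,
      r 4 i j l = O.bestPrice i j (l * (s.real 2 0 0 0 / (100 * (s.nat 2 * s.nat 2)))) ∧
      r 5 i j l = O.accept i j (r 4 i j l)) ∧
    (¬ 0 < s.real 3 j 0 0 → ∀ l < s.nat 3, r 4 i j l = 0 ∧ r 5 i j l = 0))
    (by decide) (by decide) (fun i j l => ⟨h4 i j l, h5 i j l⟩) ?_ ?_
  · intro i hi j hj s' hpre e5 e6 hn hr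
    have h3 := hr 3 (by decide)
    have h2 := hr 2 (by decide)
    have n2 := hn 2 (by norm_num) (by norm_num) (by decide)
    have n3 := hn 3 (by norm_num) (by norm_num) (by decide)
    by_cases hu : 0 < s.real 3 j 0 0
    · rw [sem_ite_pos (holds_usableTest.2 (by rwa [h3, e6]))]
      refine ⟨fun _ => ?_, fun h => absurd hu h⟩
      rw [← n3]
      refine sem_loop_induct (O := O) (x := 7) (e := .reg 3) (s := s') (fun k s'' => ∀ l < k,
        s''.real 4 i j l =
          O.bestPrice i j (l * (s.real 2 0 0 0 / (100 * (s.nat 2 * s.nat 2)))) ∧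
        s''.real 5 i j l = O.accept i j (s''.real 4 i j l)) (by simp)
        fun k _ s'' hinv hn' hr' l hl => ?_
      have n5' := (hn' 5 (by norm_num) (by decide)).trans e5
      have n6' := (hn' 6 (by norm_num) (by decide)).trans e6
      have n2' := (hn' 2 (by norm_num) (by decide)).trans n2
      have h2' := (hr' 2 (by decide)).trans h2
      simp only [sem_seq, sem_setReal, RExp.eval, eval_gridWidth, NExp.eval, State.setReal_real,
        State.setReal_nat, State.setNat_nat, State.setNat_real, n5', n6', n2', h2']
      rcases Nat.lt_succ_iff_lt_or_eq.1 hl with hl | rfl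
      · simp [hl.ne, hinv l hl]
      · simp
    · rw [sem_ite_neg (fun h => hu (by rwa [holds_usableTest, h3, e6] at h)), sem_skip]
      exact ⟨fun h => absurd h hu, fun _ l _ => hpre l⟩
  · rintro i - j - s' e5 e6 - i' j' hij
    subst e5 e6
    have o4 := (sem_ownCells (O := O) (a := 4) (c := .ite usableTest (.loop 7 (.reg 3) (.seq
      (.setReal 4 (.reg 5) (.reg 6) (.reg 7)
        (.bestPrice (.reg 5) (.reg 6) (.times (.ofNat (.reg 7)) gridWidth)))
      (.setReal 5 (.reg 5) (.reg 6) (.reg 7)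
        (.accept (.reg 5) (.reg 6) (.cell 4 (.reg 5) (.reg 6) (.reg 7)))))) .skip)
      (by decide) s').2 i' j' hij
    have o5 := (sem_ownCells (O := O) (a := 5) (c := .ite usableTest (.loop 7 (.reg 3) (.seq
      (.setReal 4 (.reg 5) (.reg 6) (.reg 7)
        (.bestPrice (.reg 5) (.reg 6) (.times (.ofNat (.reg 7)) gridWidth)))
      (.setReal 5 (.reg 5) (.reg 6) (.reg 7)
        (.accept (.reg 5) (.reg 6) (.cell 4 (.reg 5) (.reg 6) (.reg 7)))))) .skip)
      (by decide) s').2 i' j' hij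
    rw [o4, o5]
    exact ⟨id, id⟩


theorem sem_chooseOptions (s : State) (hM : 0 < s.nat 3) : ∀ i < s.nat 0, ∀ j < s.nat 1,
    ∃ b < s.nat 3, (∀ l < s.nat 3,
      (s.real 4 i j l - (s.real 6 i 0 0 + s.real 7 j 0 0)) * s.real 5 i j l ≤
      (s.real 4 i j b - (s.real 6 i 0 0 + s.real 7 j 0 0)) * s.real 5 i j b) ∧
    (∀ l, (sem O chooseOptions s).real 8 i j l =
      s.real 8 i j l + if l = b then 1 / (s.nat 3 : ℝ) else 0) ∧
    (sem O chooseOptions s).real 9 i j 0 = s.real 5 i j b := by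
  refine sem_forServices (O := O) (s := s) (fun i j r => ∀ l, r 8 i j l = s.real 8 i j l)
    (fun i j r => ∃ b < s.nat 3, (∀ l < s.nat 3,
      (s.real 4 i j l - (s.real 6 i 0 0 + s.real 7 j 0 0)) * s.real 5 i j l ≤
      (s.real 4 i j b - (s.real 6 i 0 0 + s.real 7 j 0 0)) * s.real 5 i j b) ∧
    (∀ l, r 8 i j l = s.real 8 i j l + if l = b then 1 / (s.nat 3 : ℝ) else 0) ∧
    r 9 i j 0 = s.real 5 i j b) (by decide) (by decide) (fun _ _ _ => rfl) ?_ ?_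
  · intro i hi j hj s' hpre e5 e6 hn hr
    have n3 := hn 3 (by norm_num) (by norm_num) (by decide)
    have r4 := hr 4 (by decide)
    have r5 := hr 5 (by decide)
    have r6 := hr 6 (by decide)
    have r7 := hr 7 (by decide)
    obtain ⟨h1, h2⟩ := sem_argmax (O := O) (c := profitScore) (s := s')
      (fun l => (s.real 4 i j l - (s.real 6 i 0 0 + s.real 7 j 0 0)) * s.real 5 i j l)
      (by rwa [n3]) (by decide) (by decide) (fun t ht ht' => by
        have t5 := (ht 5 (by norm_num) (by norm_num) (by decide)).trans e5
        have t6 := (ht 6 (by norm_num) (by norm_num) (by decide)).trans e6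
        have r4' := (ht' 4 (by norm_num) (by decide)).trans r4
        have r5' := (ht' 5 (by norm_num) (by decide)).trans r5
        have r6' := (ht' 6 (by norm_num) (by decide)).trans r6
        have r7' := (ht' 7 (by norm_num) (by decide)).trans r7
        simp [profitScore, RExp.eval, NExp.eval, t5, t6, r4', r5', r6', r7'])
    rw [n3] at h1 h2
    set t := sem O (argmax profitScore) s' with ht
    have t3 : t.nat 3 = s.nat 3 := (sem_nat (by decide) s').trans n3
    have t5 : t.nat 5 = i := (sem_nat (by decide) s').trans e5
    have t6 : t.nat 6 = j := (sem_nat (by decide) s').trans e6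
    have tr5 : t.real 5 = s.real 5 := (sem_real (by decide) s').trans r5
    have tr8 : t.real 8 = s'.real 8 := sem_real (by decide) s'
    refine ⟨t.nat 8, h1, h2, fun l => ?_, ?_⟩
    · rw [sem_seq, ← ht]
      simp only [sem_seq, sem_setReal, RExp.eval, NExp.eval, State.setReal_real,
        State.setReal_nat, t3, t5, t6, tr8]
      by_cases hl : l = t.nat 8
      · simp [hl, hpre]
      · simp [hl, hpre]
    · rw [sem_seq, ← ht]
      simp [RExp.eval, NExp.eval, t5, t6, tr5]
  · rintro i - j - s' e5 e6 - i' j' hij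
    subst e5 e6
    have o8 := (sem_ownCells (O := O) (a := 8) (c := .seq (argmax profitScore) (.seq
      (.setReal 8 (.reg 5) (.reg 6) (.reg 8)
        (.plus (.cell 8 (.reg 5) (.reg 6) (.reg 8)) (.div (.const 1) (.ofNat (.reg 3)))))
      (.setReal 9 (.reg 5) (.reg 6) (.const 0) (.cell 5 (.reg 5) (.reg 6) (.reg 8)))))
      (by decide) s').2 i' j' hij
    have o9 := (sem_ownCells (O := O) (a := 9) (c := .seq (argmax profitScore) (.seq
      (.setReal 8 (.reg 5) (.reg 6) (.reg 8)
        (.plus (.cell 8 (.reg 5) (.reg 6) (.reg 8)) (.div (.const 1) (.ofNat (.reg 3)))))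
      (.setReal 9 (.reg 5) (.reg 6) (.const 0) (.cell 5 (.reg 5) (.reg 6) (.reg 8)))))
      (by decide) s').2 i' j' hij
    rw [o8, o9]
    exact ⟨id, id⟩

/-- The value of the step size. -/
noncomputable def stepVal (s : State) : ℝ :=
  s.real 2 0 0 0 / (100 * s.nat 2 * s.nat 2 * s.nat 2)

theorem eval_stepSize (s : State) : stepSize.eval O s = stepVal s := by
  simp [stepSize, stepVal, valueCell, RExp.eval, NExp.eval]

theorem sem_updateAgents (s : State) : ∀ i < s.nat 0,
    (sem O updateAgents s).real 6 i 0 0 = max 0 (s.real 6 i 0 0 + stepVal s *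
      (∑ j ∈ Finset.range (s.nat 1), s.real 9 i j 0 - 1 / 3)) := by
  have := sem_loop_induct (O := O) (x := 5) (e := .reg 0) (s := s) (c := .seq
    (.setReal 6 (.reg 5) (.const 0) (.const 0) (.minus agentCharge (.times stepSize (.const (1 / 3)))))
    (.seq (.loop 6 (.reg 1) (.setReal 6 (.reg 5) (.const 0) (.const 0)
        (.plus agentCharge (.times stepSize (.cell 9 (.reg 5) (.reg 6) (.const 0))))))
      (.ite (.realLt agentCharge (.const 0))
        (.setReal 6 (.reg 5) (.const 0) (.const 0) (.const 0)) .skip)))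
    (fun k s' => ∀ i, s'.real 6 i 0 0 = if i < k then max 0 (s.real 6 i 0 0 + stepVal s *
      (∑ j ∈ Finset.range (s.nat 1), s.real 9 i j 0 - 1 / 3)) else s.real 6 i 0 0)
    (by simp) ?_
  · exact fun i hi => (this i).trans (if_pos hi)
  · intro k _ s' h hn hr
    have n1 := hn 1 (by norm_num) (by decide)
    have n2 := hn 2 (by norm_num) (by decide)
    have r2 := hr 2 (by decide)
    have r9 := hr 9 (by decide)
    have hst : ∀ t : State, t.nat 2 = s.nat 2 → t.real 2 = s.real 2 → stepVal t = stepVal s :=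
      fun t h1 h2 => by rw [stepVal, stepVal, h1, h2]
    set t := sem O (.setReal 6 (.reg 5) (.const 0) (.const 0)
      (.minus agentCharge (.times stepSize (.const (1 / 3))))) (s'.setNat 5 k) with ht
    have t1 : t.nat 1 = s.nat 1 := by rw [ht, sem_nat (by decide)]; simpa using n1
    have t2 : t.nat 2 = s.nat 2 := by rw [ht, sem_nat (by decide)]; simpa using n2
    have t5 : t.nat 5 = k := by rw [ht, sem_nat (by decide)]; simp
    have tr2 : t.real 2 = s.real 2 := by rw [ht, sem_real (by decide)]; simpa using r2
    have tr9 : t.real 9 = s.real 9 := by rw [ht, sem_real (by decide)]; simpa using r9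
    have tr6 : ∀ i, t.real 6 i 0 0 = if i = k then s.real 6 k 0 0 - stepVal s * (1 / 3)
        else s'.real 6 i 0 0 := by
      intro i
      rw [ht]
      have hk := h k
      simp only [lt_irrefl, if_false] at hk
      have hsv := hst (s'.setNat 5 k) (by simpa using n2) (by simpa using r2)
      simp [agentCharge, RExp.eval, eval_stepSize, NExp.eval, hk, hsv]
    -- The new charge is accumulated in its own cell, after subtraction of the target load, and
    -- truncated only once the sum is complete.
    have hloop := sem_loop_induct (O := O) (x := 6) (e := .reg 1) (s := t)
      (c := .setReal 6 (.reg 5) (.const 0) (.const 0)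
        (.plus agentCharge (.times stepSize (.cell 9 (.reg 5) (.reg 6) (.const 0)))))
      (fun q t' => ∀ i, t'.real 6 i 0 0 = if i = k then s.real 6 k 0 0 + stepVal s *
        (∑ j ∈ Finset.range q, s.real 9 k j 0 - 1 / 3) else s'.real 6 i 0 0) ?_ ?_
    · have e1 : NExp.eval t (.reg 1) = s.nat 1 := t1
      rw [e1] at hloop
      set t' := sem O (.loop 6 (.reg 1) (.setReal 6 (.reg 5) (.const 0) (.const 0)
        (.plus agentCharge (.times stepSize (.cell 9 (.reg 5) (.reg 6) (.const 0)))))) t with ht'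
      have t5' : t'.nat 5 = k := (sem_nat (by decide) t).trans t5
      intro i
      rw [sem_seq, ← ht, sem_seq, ← ht']
      have hk := hloop k
      rw [if_pos rfl] at hk
      rcases lt_or_ge (t'.real 6 k 0 0) 0 with hneg | hpos
      · rw [sem_ite_pos (by simpa [Test.holds, agentCharge, RExp.eval, NExp.eval, t5'] using hneg)]
        simp only [sem_setReal, RExp.eval, NExp.eval, State.setReal_real, t5', true_and, and_true,
          hloop i, h i, Rat.cast_zero]
        rw [hk] at hneg
        by_cases hik : i = k
        · subst hik; simp only [if_true, Nat.lt_succ_self]; exact (max_eq_left hneg.le).symm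
        · have hlt : i < k + 1 ↔ i < k := by omega
          simp only [hik, if_false, hlt]
      · rw [sem_ite_neg (by simpa [Test.holds, agentCharge, RExp.eval, NExp.eval, t5'] using hpos)]
        simp only [sem_skip, hloop i, h i]
        rw [hk] at hpos
        by_cases hik : i = k
        · subst hik; simp only [if_true, Nat.lt_succ_self]; exact (max_eq_right hpos).symm
        · have hlt : i < k + 1 ↔ i < k := by omega
          simp only [hik, if_false, hlt]
    · intro i
      rw [tr6 i]
      split_ifs
      · simp; ring
      · rfl
    · intro q _ t' ht' hn' hr' i
      have n2' := (hn' 2 (by norm_num) (by decide)).trans t2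
      have n5' := (hn' 5 (by norm_num) (by decide)).trans t5
      have r2' := (hr' 2 (by decide)).trans tr2
      have r9' := (hr' 9 (by decide)).trans tr9
      have hsv := hst (t'.setNat 6 q) (by simpa using n2') (by simpa using r2')
      have hk := ht' k
      rw [if_pos rfl] at hk
      simp only [sem_setReal, agentCharge, RExp.eval, eval_stepSize, NExp.eval, State.setReal_real,
        State.setNat_nat, State.setNat_real, n5', hsv, r9', true_and, and_true]
      by_cases hik : i = k
      · subst hik
        simp only [if_true, hk, Finset.sum_range_succ]
        norm_num [n5', hk]
        ring
      · simp [hik, ht' i]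

theorem sem_updateItems (s : State) : ∀ j < s.nat 1,
    (sem O updateItems s).real 7 j 0 0 = max 0 (s.real 7 j 0 0 + stepVal s *
      (∑ i ∈ Finset.range (s.nat 0), s.real 9 i j 0 - s.real 3 j 0 0 / 3)) := by
  have := sem_loop_induct (O := O) (x := 6) (e := .reg 1) (s := s) (c := .seq
    (.setReal 7 (.reg 6) (.const 0) (.const 0) (.minus itemCharge
      (.times stepSize (.div (.cell 3 (.reg 6) (.const 0) (.const 0)) (.const 3)))))
    (.seq (.loop 5 (.reg 0) (.setReal 7 (.reg 6) (.const 0) (.const 0)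
        (.plus itemCharge (.times stepSize (.cell 9 (.reg 5) (.reg 6) (.const 0))))))
      (.ite (.realLt itemCharge (.const 0))
        (.setReal 7 (.reg 6) (.const 0) (.const 0) (.const 0)) .skip)))
    (fun k s' => ∀ j, s'.real 7 j 0 0 = if j < k then max 0 (s.real 7 j 0 0 + stepVal s *
      (∑ i ∈ Finset.range (s.nat 0), s.real 9 i j 0 - s.real 3 j 0 0 / 3)) else s.real 7 j 0 0)
    (by simp) ?_
  · exact fun j hj => (this j).trans (if_pos hj)
  · intro k _ s' h hn hr
    have n0 := hn 0 (by norm_num) (by decide)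
    have n2 := hn 2 (by norm_num) (by decide)
    have r2 := hr 2 (by decide)
    have r3 := hr 3 (by decide)
    have r9 := hr 9 (by decide)
    have hst : ∀ t : State, t.nat 2 = s.nat 2 → t.real 2 = s.real 2 → stepVal t = stepVal s :=
      fun t h1 h2 => by rw [stepVal, stepVal, h1, h2]
    set t := sem O (.setReal 7 (.reg 6) (.const 0) (.const 0) (.minus itemCharge
      (.times stepSize (.div (.cell 3 (.reg 6) (.const 0) (.const 0)) (.const 3)))))
      (s'.setNat 6 k) with ht
    have t0 : t.nat 0 = s.nat 0 := by rw [ht, sem_nat (by decide)]; simpa using n0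
    have t2 : t.nat 2 = s.nat 2 := by rw [ht, sem_nat (by decide)]; simpa using n2
    have t6 : t.nat 6 = k := by rw [ht, sem_nat (by decide)]; simp
    have tr2 : t.real 2 = s.real 2 := by rw [ht, sem_real (by decide)]; simpa using r2
    have tr9 : t.real 9 = s.real 9 := by rw [ht, sem_real (by decide)]; simpa using r9
    have tr7 : ∀ j, t.real 7 j 0 0 = if j = k then
        s.real 7 k 0 0 - stepVal s * (s.real 3 k 0 0 / 3) else s'.real 7 j 0 0 := by
      intro j
      rw [ht]
      have hk := h k
      simp only [lt_irrefl, if_false] at hk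
      have hsv := hst (s'.setNat 6 k) (by simpa using n2) (by simpa using r2)
      simp [itemCharge, RExp.eval, eval_stepSize, NExp.eval, hk, hsv, r3]
    have hloop := sem_loop_induct (O := O) (x := 5) (e := .reg 0) (s := t)
      (c := .setReal 7 (.reg 6) (.const 0) (.const 0)
        (.plus itemCharge (.times stepSize (.cell 9 (.reg 5) (.reg 6) (.const 0)))))
      (fun q t' => ∀ j, t'.real 7 j 0 0 = if j = k then s.real 7 k 0 0 + stepVal s *
        (∑ i ∈ Finset.range q, s.real 9 i k 0 - s.real 3 k 0 0 / 3) else s'.real 7 j 0 0) ?_ ?_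
    · have e1 : NExp.eval t (.reg 0) = s.nat 0 := t0
      rw [e1] at hloop
      set t' := sem O (.loop 5 (.reg 0) (.setReal 7 (.reg 6) (.const 0) (.const 0)
        (.plus itemCharge (.times stepSize (.cell 9 (.reg 5) (.reg 6) (.const 0)))))) t with ht'
      have t6' : t'.nat 6 = k := (sem_nat (by decide) t).trans t6
      intro j
      rw [sem_seq, ← ht, sem_seq, ← ht']
      have hk := hloop k
      rw [if_pos rfl] at hk
      rcases lt_or_ge (t'.real 7 k 0 0) 0 with hneg | hpos
      · rw [sem_ite_pos (by simpa [Test.holds, itemCharge, RExp.eval, NExp.eval, t6'] using hneg)]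
        simp only [sem_setReal, RExp.eval, NExp.eval, State.setReal_real, t6', true_and, and_true,
          hloop j, h j, Rat.cast_zero]
        rw [hk] at hneg
        by_cases hjk : j = k
        · subst hjk; simp only [if_true, Nat.lt_succ_self]; exact (max_eq_left hneg.le).symm
        · have hlt : j < k + 1 ↔ j < k := by omega
          simp only [hjk, if_false, hlt]
      · rw [sem_ite_neg (by simpa [Test.holds, itemCharge, RExp.eval, NExp.eval, t6'] using hpos)]
        simp only [sem_skip, hloop j, h j]
        rw [hk] at hpos
        by_cases hjk : j = k
        · subst hjk; simp only [if_true, Nat.lt_succ_self]; exact (max_eq_right hpos).symm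
        · have hlt : j < k + 1 ↔ j < k := by omega
          simp only [hjk, if_false, hlt]
    · intro j
      rw [tr7 j]
      split_ifs
      · simp; ring
      · rfl
    · intro q _ t' ht' hn' hr' j
      have n2' := (hn' 2 (by norm_num) (by decide)).trans t2
      have n6' := (hn' 6 (by norm_num) (by decide)).trans t6
      have r2' := (hr' 2 (by decide)).trans tr2
      have r9' := (hr' 9 (by decide)).trans tr9
      have hsv := hst (t'.setNat 5 q) (by simpa using n2') (by simpa using r2')
      have hk := ht' k
      rw [if_pos rfl] at hk
      simp only [sem_setReal, itemCharge, RExp.eval, eval_stepSize, NExp.eval, State.setReal_real,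
        State.setNat_nat, State.setNat_real, n6', hsv, r9', true_and, and_true]
      by_cases hjk : j = k
      · subst hjk
        simp only [if_true, hk, Finset.sum_range_succ]
        norm_num [n6', hk]
        ring
      · simp [hjk, ht' j]

end Program

end RealRAM

/-! ### Appending a round; the option score as two separate sums -/

section Extend

variable {α β : Type*} [Fintype α] [Fintype β] {step : ℝ} {κ : β → ℝ} {L T : ℕ}
  {p a : α × β → ℕ → ℝ} {u : ℕ → α → ℝ} {w : ℕ → β → ℝ} {ch : ℕ → α × β → ℕ}

/-- Histories are functions of the round, so a round is appended by changing one value of each; the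
recurrences of earlier rounds never look there. -/
theorem IsDynamics.extend (hd : IsDynamics κ L T p a step u w ch) {b : α × β → ℕ}
    (hb : ∀ e, b e < L) (hbest : ∀ e : α × β, ∀ l < L,
      (p e l - (u T e.1 + w T e.2)) * a e l ≤ (p e (b e) - (u T e.1 + w T e.2)) * a e (b e))
    {u' : α → ℝ} {w' : β → ℝ}
    (hu : ∀ i, u' i = max 0 (u T i + step * (∑ j, a (i, j) (b (i, j)) - 1 / 3)))
    (hw : ∀ j, w' j = max 0 (w T j + step * (∑ i, a (i, j) (b (i, j)) - κ j / 3))) :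
    IsDynamics κ L (T + 1) p a step (Function.update u (T + 1) u') (Function.update w (T + 1) w')
      (Function.update ch T b) := by
  have hlt : ∀ τ < T + 1, τ < T ∨ τ = T := fun τ h => by omega
  refine ⟨by simpa using hd.u_zero, by simpa using hd.w_zero, ?_, ?_, ?_, ?_⟩
  · intro τ hτ i
    rcases hlt τ hτ with h | rfl
    · rw [Function.update_of_ne (by omega), Function.update_of_ne (by omega),
        Function.update_of_ne (by omega)]
      exact hd.u_succ τ h i
    · rw [Function.update_self, Function.update_of_ne (by omega), Function.update_self]
      exact hu i
  · intro τ hτ j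
    rcases hlt τ hτ with h | rfl
    · rw [Function.update_of_ne (by omega), Function.update_of_ne (by omega),
        Function.update_of_ne (by omega)]
      exact hd.w_succ τ h j
    · rw [Function.update_self, Function.update_of_ne (by omega), Function.update_self]
      exact hw j
  · intro τ hτ e
    rcases hlt τ hτ with h | rfl
    · rw [Function.update_of_ne (by omega)]; exact hd.ch_lt τ h e
    · rw [Function.update_self]; exact hb e
  · intro τ hτ e l hl
    rcases hlt τ hτ with h | rfl
    · rw [Function.update_of_ne (by omega), Function.update_of_ne (by omega),
        Function.update_of_ne (by omega)]
      exact hd.best τ h e l hl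
    · rw [Function.update_self, Function.update_of_ne (by omega), Function.update_of_ne (by omega)]
      exact hbest e l hl

variable [DecidableEq α] [DecidableEq β]

/-- The two sums include the service itself, which has no conflict with itself. The extra terms
vanish because its lottery is zero, so the program needs no test to skip them. -/
theorem optionScore_eq (κ : β → ℝ) (L : ℕ) (p a ν : α × β → ℕ → ℝ) (e : α × β)
    (he : ∀ l, ν e l = 0) (l : ℕ) :
    optionScore κ L p a ν e l = p e l * a e l -
      ∑ j, ∑ l' ∈ Finset.range L,
        ν (e.1, j) l' * pairLoss (a e l) (p e l) (a (e.1, j) l') (p (e.1, j) l') -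
      ∑ i, ∑ l' ∈ Finset.range L,
        ν (i, e.2) l' * pairLoss (a e l) (p e l) (a (i, e.2) l') (p (i, e.2) l') / κ e.2 := by
  set F : α × β → ℝ := fun e' => ∑ l' ∈ Finset.range L,
    ν e' l' * pairLoss (a e l) (p e l) (a e' l') (p e' l') with hF
  have hFe : F e = 0 := by simp [hF, he]
  have h1 : ∑ e', sameAgent e e' * F e' = ∑ j, F (e.1, j) := by
    rw [Fintype.sum_prod_type, Finset.sum_eq_single e.1]
    · refine Finset.sum_congr rfl fun j _ => ?_
      by_cases h : e.2 = j
      · subst h; rw [Prod.mk.eta, hFe]; simp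
      · simp [sameAgent, h]
    · intro i _ hi
      exact Finset.sum_eq_zero fun j _ => by simp [sameAgent, hi.symm]
    · simp
  have h2 : ∑ e', sameItem κ e e' * F e' = ∑ i, F (i, e.2) / κ e.2 := by
    rw [Fintype.sum_prod_type_right, Finset.sum_eq_single e.2]
    · refine Finset.sum_congr rfl fun i _ => ?_
      by_cases h : e.1 = i
      · subst h; rw [Prod.mk.eta, hFe]; simp
      · simp [sameItem, h, div_eq_inv_mul]
    · intro j _ hj
      exact Finset.sum_eq_zero fun i _ => by simp [sameItem, hj.symm]
    · simp
  have h3 : optionScore κ L p a ν e l = p e l * a e l - ∑ e', conflict κ e e' * F e' := rfl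
  rw [h3]
  simp only [conflict, add_mul, Finset.sum_add_distrib, h1, h2]
  simp only [hF, Finset.sum_div]
  ring

end Extend

/-! ### The subgradient loop and the choice of a best option -/

namespace RealRAM

namespace Program

variable {O : Oracles}

/-- The loop invariant carries a whole history of charges and choices of which the arrays show the
present. Each choice adds `1 / M` to array 8, where `M` is the number of rounds, so it ends up with
the frequencies. -/
theorem sem_runDynamics {m n : ℕ} (s : State) (hm : s.nat 0 = m) (hn : s.nat 1 = n)
    (hM : 0 < s.nat 3) (h6 : ∀ i, s.real 6 i 0 0 = 0) (h7 : ∀ j, s.real 7 j 0 0 = 0)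
    (h8 : ∀ i j l, s.real 8 i j l = 0) :
    ∃ u w ch, IsDynamics (α := Fin m) (β := Fin n) (fun j => s.real 3 j 0 0) (s.nat 3) (s.nat 3)
      (fun e l => s.real 4 e.1 e.2 l) (fun e l => s.real 5 e.1 e.2 l) (stepVal s) u w ch ∧
      ∀ (i : Fin m) (j : Fin n) l, (sem O runDynamics s).real 8 i j l =
        frequency (s.nat 3) (fun τ => ch τ (i, j)) l := by
  have := sem_loop_induct (O := O) (x := 11) (e := .reg 3) (s := s)
    (c := .seq chooseOptions (.seq updateAgents updateItems))
    (fun k s' => ∃ u w ch, IsDynamics (α := Fin m) (β := Fin n) (fun j => s.real 3 j 0 0)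
      (s.nat 3) k (fun e l => s.real 4 e.1 e.2 l) (fun e l => s.real 5 e.1 e.2 l) (stepVal s)
      u w ch ∧ (∀ i : Fin m, s'.real 6 i 0 0 = u k i) ∧ (∀ j : Fin n, s'.real 7 j 0 0 = w k j) ∧
      ∀ (i : Fin m) (j : Fin n) l, s'.real 8 i j l =
        ∑ τ ∈ Finset.range k, if l = ch τ (i, j) then 1 / (s.nat 3 : ℝ) else 0) ?_ ?_
  · obtain ⟨u, w, ch, hd, -, -, h⟩ := this
    refine ⟨u, w, ch, hd, fun i j l => (h i j l).trans ?_⟩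
    simp only [frequency, roundAvg, Finset.mul_sum]
    refine Finset.sum_congr rfl fun τ _ => ?_
    split_ifs <;> simp
  · refine ⟨fun _ _ => 0, fun _ _ => 0, fun _ _ => 0, ⟨fun _ => rfl, fun _ => rfl, ?_, ?_, ?_, ?_⟩,
      fun i => h6 i, fun j => h7 j, fun i j l => by simpa using h8 i j l⟩ <;>
    exact fun τ hτ => absurd hτ (Nat.not_lt_zero τ)
  · rintro k - s' ⟨u, w, ch, hd, hu, hw, hν⟩ hn' hr
    set t := s'.setNat 11 k with ht
    have t0 : t.nat 0 = m := (hn' 0 (by norm_num) (by decide)).trans hm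
    have t1 : t.nat 1 = n := (hn' 1 (by norm_num) (by decide)).trans hn
    have t2 : t.nat 2 = s.nat 2 := hn' 2 (by norm_num) (by decide)
    have t3 : t.nat 3 = s.nat 3 := hn' 3 (by norm_num) (by decide)
    have tr2 : t.real 2 = s.real 2 := hr 2 (by decide)
    have tr3 : t.real 3 = s.real 3 := hr 3 (by decide)
    have tr4 : t.real 4 = s.real 4 := hr 4 (by decide)
    have tr5 : t.real 5 = s.real 5 := hr 5 (by decide)
    have hch : ∀ e : Fin m × Fin n, ∃ b < s.nat 3, (∀ l < s.nat 3,
        (s.real 4 e.1 e.2 l - (u k e.1 + w k e.2)) * s.real 5 e.1 e.2 l ≤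
        (s.real 4 e.1 e.2 b - (u k e.1 + w k e.2)) * s.real 5 e.1 e.2 b) ∧
        (∀ l, (sem O chooseOptions t).real 8 e.1 e.2 l =
          t.real 8 e.1 e.2 l + if l = b then 1 / (s.nat 3 : ℝ) else 0) ∧
        (sem O chooseOptions t).real 9 e.1 e.2 0 = s.real 5 e.1 e.2 b := by
      intro e
      have h := sem_chooseOptions (O := O) t (by rwa [t3]) e.1 (by rw [t0]; exact e.1.2) e.2
        (by rw [t1]; exact e.2.2)
      have e6 : t.real 6 e.1 0 0 = u k e.1 := hu e.1
      have e7 : t.real 7 e.2 0 0 = w k e.2 := hw e.2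
      rwa [t3, tr4, tr5, e6, e7] at h
    choose b hb hbest hb8 hb9 using hch
    set t' := sem O chooseOptions t with ht'
    have t0' : t'.nat 0 = m := (sem_nat (by decide) t).trans t0
    have t1' : t'.nat 1 = n := (sem_nat (by decide) t).trans t1
    have t2' : t'.nat 2 = s.nat 2 := (sem_nat (by decide) t).trans t2
    have tr2' : t'.real 2 = s.real 2 := (sem_real (by decide) t).trans tr2
    have tr3' : t'.real 3 = s.real 3 := (sem_real (by decide) t).trans tr3
    have tr6' : t'.real 6 = t.real 6 := sem_real (by decide) t
    have tr7' : t'.real 7 = t.real 7 := sem_real (by decide) t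
    set t'' := sem O updateAgents t' with ht''
    have t0'' : t''.nat 0 = m := (sem_nat (by decide) t').trans t0'
    have t1'' : t''.nat 1 = n := (sem_nat (by decide) t').trans t1'
    have t2'' : t''.nat 2 = s.nat 2 := (sem_nat (by decide) t').trans t2'
    have tr2'' : t''.real 2 = s.real 2 := (sem_real (by decide) t').trans tr2'
    have tr3'' : t''.real 3 = s.real 3 := (sem_real (by decide) t').trans tr3'
    have tr7'' : t''.real 7 = t.real 7 := (sem_real (by decide) t').trans tr7'
    have tr8'' : t''.real 8 = t'.real 8 := sem_real (by decide) t'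
    have tr9'' : t''.real 9 = t'.real 9 := sem_real (by decide) t'
    have hst' : stepVal t' = stepVal s := by rw [stepVal, stepVal, t2', tr2']
    have hst'' : stepVal t'' = stepVal s := by rw [stepVal, stepVal, t2'', tr2'']
    have hfin : sem O (.seq chooseOptions (.seq updateAgents updateItems)) t =
      sem O updateItems t'' := rfl
    rw [hfin]
    refine ⟨_, _, _, hd.extend hb hbest (u' := fun i => (sem O updateItems t'').real 6 i 0 0)
      (w' := fun j => (sem O updateItems t'').real 7 j 0 0) (fun i => ?_) (fun j => ?_),
      fun i => by rw [Function.update_self], fun j => by rw [Function.update_self],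
      fun i j l => ?_⟩
    · rw [sem_real (c := updateItems) (by decide), ht'', sem_updateAgents t' i
        (by rw [t0']; exact i.2), hst', t1', tr6', Finset.sum_range]
      simp only [ht, State.setNat_real, hu]
      congr 4
      exact Finset.sum_congr rfl fun j _ => hb9 (i, j)
    · rw [sem_updateItems t'' j (by rw [t1'']; exact j.2), hst'', t0'', tr3'', tr7'',
        Finset.sum_range, tr9'']
      simp only [ht, State.setNat_real, hw]
      congr 4
      exact Finset.sum_congr rfl fun i _ => hb9 (i, j)
    · rw [sem_real (c := updateItems) (by decide), tr8'', hb8 (i, j), Finset.sum_range_succ,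
        Function.update_self]
      congr 1
      refine (hν i j l).trans (Finset.sum_congr rfl fun τ hτ => ?_)
      rw [Function.update_of_ne (Finset.mem_range.1 hτ).ne]

/-! ### Derandomization -/

/-- The score under construction. -/
def scoreCell : RExp := .cell 10 (.const 0) (.const 0) (.const 0)

/-- Assign to the score. -/
def setScore (e : RExp) : Program := .setReal 10 (.const 0) (.const 0) (.const 0) e

/-- The price of the option at hand. -/
def optionPrice : RExp := .cell 4 (.reg 5) (.reg 6) (.reg 7)

/-- The acceptance probability of the option at hand. -/
def optionProb : RExp := .cell 5 (.reg 5) (.reg 6) (.reg 7)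

/-- The expected loss from option `l` of service `(i, j)`, where `q` is the larger price. -/
def lossExp (i j : NExp) (q : RExp) : RExp :=
  .times (.cell 8 i j (.reg 10)) (.times (.times optionProb (.cell 5 i j (.reg 10))) q)

/-- Subtract the loss from a service of the same agent. -/
def subtractAgentLoss : Program :=
  .ite (.realLt optionPrice (.cell 4 (.reg 5) (.reg 9) (.reg 10)))
    (setScore (.minus scoreCell
      (lossExp (.reg 5) (.reg 9) (.cell 4 (.reg 5) (.reg 9) (.reg 10)))))
    (setScore (.minus scoreCell (lossExp (.reg 5) (.reg 9) optionPrice)))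

/-- Subtract the loss from a service for the same item. -/
def subtractItemLoss : Program :=
  .ite (.realLt optionPrice (.cell 4 (.reg 9) (.reg 6) (.reg 10)))
    (setScore (.minus scoreCell
      (.div (lossExp (.reg 9) (.reg 6) (.cell 4 (.reg 9) (.reg 6) (.reg 10)))
        (.cell 3 (.reg 6) (.const 0) (.const 0)))))
    (setScore (.minus scoreCell (.div (lossExp (.reg 9) (.reg 6) optionPrice)
      (.cell 3 (.reg 6) (.const 0) (.const 0)))))

/-- The gain from the option at hand. -/
def gainScore : Program :=
  .seq (setScore (.times optionPrice optionProb))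
    (.seq (.loop 9 (.reg 1) (.loop 10 (.reg 3) subtractAgentLoss))
      (.loop 9 (.reg 0) (.loop 10 (.reg 3) subtractItemLoss)))

/-- Clear the lottery of the service at hand. -/
def clearLottery : Program := .loop 7 (.reg 3) (.setReal 8 (.reg 5) (.reg 6) (.reg 7) (.const 0))

/-- Replace the lottery of the service at hand by its best option. -/
def pickPrice : Program :=
  .seq clearLottery (.seq (argmax gainScore) (.seq
    (.setReal 8 (.reg 5) (.reg 6) (.reg 8) (.const 1))
    (.setReal 1 (.reg 5) (.reg 6) (.const 0) (.cell 4 (.reg 5) (.reg 6) (.reg 8)))))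

/-- Common to both passes of `gainScore`. The second conclusion protects the best score found so
far, as `sem_argmax` demands. -/
theorem sem_subtractSums {c : Program} {e : NExp} {s : State} (g : ℕ → ℕ → ℝ)
    (h3 : c.keepsNat 3 = true) (h9 : c.keepsNat 9 = true)
    (hc : ∀ s', (∀ y, y ≠ 9 → y ≠ 10 → c.keepsNat y = true → s'.nat y = s.nat y) →
      (∀ a, a ≠ 10 → c.keepsReal a = true → s'.real a = s.real a) →
      (sem O c s').real 10 0 0 0 = s'.real 10 0 0 0 - g (s'.nat 9) (s'.nat 10) ∧
      (sem O c s').real 10 1 0 0 = s'.real 10 1 0 0) :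
    (sem O (.loop 9 e (.loop 10 (.reg 3) c)) s).real 10 0 0 0 = s.real 10 0 0 0 -
      ∑ x ∈ Finset.range (e.eval s), ∑ l ∈ Finset.range (s.nat 3), g x l ∧
    (sem O (.loop 9 e (.loop 10 (.reg 3) c)) s).real 10 1 0 0 = s.real 10 1 0 0 := by
  refine sem_loop_induct (O := O) (x := 9) (e := e) (s := s) (fun k s' => s'.real 10 0 0 0 =
      s.real 10 0 0 0 - ∑ x ∈ Finset.range k, ∑ l ∈ Finset.range (s.nat 3), g x l ∧
    s'.real 10 1 0 0 = s.real 10 1 0 0) (by simp) fun k _ s' h hn hr => ?_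
  have hn' : ∀ y, y ≠ 9 → y ≠ 10 → c.keepsNat y = true → s'.nat y = s.nat y :=
    fun y y9 y10 hy => hn y y9 (by simp [keepsNat, hy, y10.symm])
  have e3 : NExp.eval (s'.setNat 9 k) (.reg 3) = s.nat 3 := by
    simp [NExp.eval, hn' 3 (by norm_num) (by norm_num) h3]
  have := sem_loop_induct (O := O) (x := 10) (e := .reg 3) (s := s'.setNat 9 k) (c := c)
    (fun q s'' => s''.real 10 0 0 0 =
      s'.real 10 0 0 0 - ∑ l ∈ Finset.range q, g k l ∧
    s''.real 10 1 0 0 = s.real 10 1 0 0) (by simp [h.2]) fun q _ s'' h'' hn'' hr'' => ?_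
  · rw [e3] at this
    refine ⟨?_, this.2⟩
    rw [this.1, h.1, Finset.sum_range_succ]
    ring
  · obtain ⟨c1, c2⟩ := hc (s''.setNat 10 q)
      (fun y y9 y10 hy => by
        rw [State.setNat_nat, if_neg y10, hn'' y y10 hy, State.setNat_nat, if_neg y9,
          hn' y y9 y10 hy])
      (fun a ha hca => by rw [State.setNat_real, hr'' a hca, State.setNat_real, hr a hca])
    have e9 : (s''.setNat 10 q).nat 9 = k := by
      rw [State.setNat_nat, if_neg (by norm_num), hn'' 9 (by norm_num) h9]; simp
    rw [e9] at c1
    simp only [State.setNat_nat, State.setNat_real, if_true] at c1 c2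
    exact ⟨by rw [c1, h''.1, Finset.sum_range_succ]; ring, c2.trans h''.2⟩

theorem sem_subtractAgentLoss (s : State) :
    (sem O subtractAgentLoss s).real 10 0 0 0 = s.real 10 0 0 0 -
      s.real 8 (s.nat 5) (s.nat 9) (s.nat 10) *
        pairLoss (s.real 5 (s.nat 5) (s.nat 6) (s.nat 7)) (s.real 4 (s.nat 5) (s.nat 6) (s.nat 7))
          (s.real 5 (s.nat 5) (s.nat 9) (s.nat 10)) (s.real 4 (s.nat 5) (s.nat 9) (s.nat 10)) ∧
    (sem O subtractAgentLoss s).real 10 1 0 0 = s.real 10 1 0 0 := by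
  by_cases h : s.real 4 (s.nat 5) (s.nat 6) (s.nat 7) < s.real 4 (s.nat 5) (s.nat 9) (s.nat 10)
  · rw [subtractAgentLoss, sem_ite_pos (by simpa [Test.holds, optionPrice, RExp.eval, NExp.eval])]
    simp [setScore, scoreCell, lossExp, optionProb, RExp.eval, NExp.eval, pairLoss,
      max_eq_right h.le]
  · rw [subtractAgentLoss, sem_ite_neg (by simpa [Test.holds, optionPrice, RExp.eval, NExp.eval]
      using h)]
    simp [setScore, scoreCell, lossExp, optionProb, optionPrice, RExp.eval, NExp.eval, pairLoss,
      max_eq_left (not_lt.1 h)]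

theorem sem_subtractItemLoss (s : State) :
    (sem O subtractItemLoss s).real 10 0 0 0 = s.real 10 0 0 0 -
      s.real 8 (s.nat 9) (s.nat 6) (s.nat 10) *
        pairLoss (s.real 5 (s.nat 5) (s.nat 6) (s.nat 7)) (s.real 4 (s.nat 5) (s.nat 6) (s.nat 7))
          (s.real 5 (s.nat 9) (s.nat 6) (s.nat 10)) (s.real 4 (s.nat 9) (s.nat 6) (s.nat 10)) /
        s.real 3 (s.nat 6) 0 0 ∧
    (sem O subtractItemLoss s).real 10 1 0 0 = s.real 10 1 0 0 := by
  by_cases h : s.real 4 (s.nat 5) (s.nat 6) (s.nat 7) < s.real 4 (s.nat 9) (s.nat 6) (s.nat 10)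
  · rw [subtractItemLoss, sem_ite_pos (by simpa [Test.holds, optionPrice, RExp.eval, NExp.eval])]
    simp [setScore, scoreCell, lossExp, optionProb, RExp.eval, NExp.eval, pairLoss,
      max_eq_right h.le]
  · rw [subtractItemLoss, sem_ite_neg (by simpa [Test.holds, optionPrice, RExp.eval, NExp.eval]
      using h)]
    simp [setScore, scoreCell, lossExp, optionProb, optionPrice, RExp.eval, NExp.eval, pairLoss,
      max_eq_left (not_lt.1 h)]

/-- The value that `gainScore` computes. -/
noncomputable def gainVal (m n M : ℕ) (κ : ℕ → ℝ) (ν p a : ℕ → ℕ → ℕ → ℝ) (i j l : ℕ) : ℝ :=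
  p i j l * a i j l -
    ∑ j' ∈ Finset.range n, ∑ l' ∈ Finset.range M,
      ν i j' l' * pairLoss (a i j l) (p i j l) (a i j' l') (p i j' l') -
    ∑ i' ∈ Finset.range m, ∑ l' ∈ Finset.range M,
      ν i' j l' * pairLoss (a i j l) (p i j l) (a i' j l') (p i' j l') / κ j

theorem sem_gainScore (s : State) :
    (sem O gainScore s).real 10 0 0 0 = gainVal (s.nat 0) (s.nat 1) (s.nat 3)
      (fun j => s.real 3 j 0 0) (s.real 8) (s.real 4) (s.real 5) (s.nat 5) (s.nat 6) (s.nat 7) ∧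
    (sem O gainScore s).real 10 1 0 0 = s.real 10 1 0 0 := by
  set t := sem O (setScore (.times optionPrice optionProb)) s with ht
  have tn : t.nat = s.nat := rfl
  have tr : ∀ a, a ≠ 10 → t.real a = s.real a := fun a ha => by
    rw [ht, sem_real]
    simp [setScore, keepsReal, ha.symm]
  have t0 : t.real 10 0 0 0 = s.real 4 (s.nat 5) (s.nat 6) (s.nat 7) *
      s.real 5 (s.nat 5) (s.nat 6) (s.nat 7) := by
    simp [ht, setScore, optionPrice, optionProb, RExp.eval, NExp.eval]
  have t1 : t.real 10 1 0 0 = s.real 10 1 0 0 := by simp [ht, setScore, NExp.eval]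
  obtain ⟨a1, a2⟩ := sem_subtractSums (O := O) (c := subtractAgentLoss) (e := .reg 1) (s := t)
    (fun x l' => s.real 8 (s.nat 5) x l' *
        pairLoss (s.real 5 (s.nat 5) (s.nat 6) (s.nat 7)) (s.real 4 (s.nat 5) (s.nat 6) (s.nat 7))
          (s.real 5 (s.nat 5) x l') (s.real 4 (s.nat 5) x l'))
    (by decide) (by decide) fun s' hn hr => by
      have n5 := hn 5 (by norm_num) (by norm_num) (by decide)
      have n6 := hn 6 (by norm_num) (by norm_num) (by decide)
      have n7 := hn 7 (by norm_num) (by norm_num) (by decide)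
      have r4 := (hr 4 (by norm_num) (by decide)).trans (tr 4 (by norm_num))
      have r5 := (hr 5 (by norm_num) (by decide)).trans (tr 5 (by norm_num))
      have r8 := (hr 8 (by norm_num) (by decide)).trans (tr 8 (by norm_num))
      have := sem_subtractAgentLoss (O := O) s'
      rwa [n5, n6, n7, r4, r5, r8, tn] at this
  set t' := sem O (.loop 9 (.reg 1) (.loop 10 (.reg 3) subtractAgentLoss)) t with ht'
  have tn' : ∀ y, y ≠ 9 → y ≠ 10 → t'.nat y = s.nat y := fun y h9 h10 => by
    rw [ht', sem_nat, tn]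
    simp [subtractAgentLoss, setScore, keepsNat, h9.symm, h10.symm]
  have tr' : ∀ a, a ≠ 10 → t'.real a = s.real a := fun a ha => by
    rw [ht', sem_real, tr a ha]
    simp [subtractAgentLoss, setScore, keepsReal, ha.symm]
  obtain ⟨b1, b2⟩ := sem_subtractSums (O := O) (c := subtractItemLoss) (e := .reg 0) (s := t')
    (fun x l' => s.real 8 x (s.nat 6) l' *
        pairLoss (s.real 5 (s.nat 5) (s.nat 6) (s.nat 7)) (s.real 4 (s.nat 5) (s.nat 6) (s.nat 7))
          (s.real 5 x (s.nat 6) l') (s.real 4 x (s.nat 6) l') / s.real 3 (s.nat 6) 0 0)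
    (by decide) (by decide) fun s' hn hr => by
      have n5 := (hn 5 (by norm_num) (by norm_num) (by decide)).trans
        (tn' 5 (by norm_num) (by norm_num))
      have n6 := (hn 6 (by norm_num) (by norm_num) (by decide)).trans
        (tn' 6 (by norm_num) (by norm_num))
      have n7 := (hn 7 (by norm_num) (by norm_num) (by decide)).trans
        (tn' 7 (by norm_num) (by norm_num))
      have r3 := (hr 3 (by norm_num) (by decide)).trans (tr' 3 (by norm_num))
      have r4 := (hr 4 (by norm_num) (by decide)).trans (tr' 4 (by norm_num))
      have r5 := (hr 5 (by norm_num) (by decide)).trans (tr' 5 (by norm_num))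
      have r8 := (hr 8 (by norm_num) (by decide)).trans (tr' 8 (by norm_num))
      have := sem_subtractItemLoss (O := O) s'
      rwa [n5, n6, n7, r3, r4, r5, r8] at this
  have hfin : sem O gainScore s =
    sem O (.loop 9 (.reg 0) (.loop 10 (.reg 3) subtractItemLoss)) t' := rfl
  rw [hfin, b1, b2, a1, a2, t0, t1, tn' 3 (by norm_num) (by norm_num)]
  have e0 : NExp.eval t' (.reg 0) = s.nat 0 := tn' 0 (by norm_num) (by norm_num)
  have e1 : NExp.eval t (.reg 1) = s.nat 1 := rfl
  rw [e0, e1, tn]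
  exact ⟨rfl, rfl⟩

theorem sem_clearLottery (s : State) (i j l : ℕ) : (sem O clearLottery s).real 8 i j l =
    if i = s.nat 5 ∧ j = s.nat 6 ∧ l < s.nat 3 then 0 else s.real 8 i j l := by
  refine sem_loop_induct (O := O) (x := 7) (e := .reg 3) (s := s) (fun k s' =>
    s'.real 8 i j l = if i = s.nat 5 ∧ j = s.nat 6 ∧ l < k then 0 else s.real 8 i j l)
    (by simp) fun k _ s' h hn _ => ?_
  have n5 := hn 5 (by norm_num) (by decide)
  have n6 := hn 6 (by norm_num) (by decide)
  simp only [sem_setReal, NExp.eval, RExp.eval, State.setReal_real, State.setNat_nat,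
    State.setNat_real, h]
  norm_num [n5, n6]
  by_cases h5 : i = s.nat 5 <;> by_cases h6 : j = s.nat 6 <;> by_cases hk : l = k <;>
    simp [h5, h6, hk, Nat.le_iff_lt_or_eq]

theorem sem_pickPrice (s : State) (hM : 0 < s.nat 3)
    (h8 : ∀ l, s.nat 3 ≤ l → s.real 8 (s.nat 5) (s.nat 6) l = 0) :
    ∃ b < s.nat 3, (∀ l < s.nat 3,
      gainVal (s.nat 0) (s.nat 1) (s.nat 3) (fun j => s.real 3 j 0 0)
        (fun i j l => if i = s.nat 5 ∧ j = s.nat 6 then 0 else s.real 8 i j l)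
        (s.real 4) (s.real 5) (s.nat 5) (s.nat 6) l ≤
      gainVal (s.nat 0) (s.nat 1) (s.nat 3) (fun j => s.real 3 j 0 0)
        (fun i j l => if i = s.nat 5 ∧ j = s.nat 6 then 0 else s.real 8 i j l)
        (s.real 4) (s.real 5) (s.nat 5) (s.nat 6) b) ∧
    (∀ l, (sem O pickPrice s).real 8 (s.nat 5) (s.nat 6) l = if l = b then 1 else 0) ∧
    (sem O pickPrice s).real 1 (s.nat 5) (s.nat 6) 0 = s.real 4 (s.nat 5) (s.nat 6) b := by
  set t := sem O clearLottery s with ht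
  have tn : ∀ y, y ≠ 7 → t.nat y = s.nat y := fun y hy => by
    rw [ht, sem_nat]; simp [clearLottery, keepsNat, hy.symm]
  have tr : ∀ a, a ≠ 8 → t.real a = s.real a := fun a ha => by
    rw [ht, sem_real]; simp [clearLottery, keepsReal, ha.symm]
  -- `clearLottery` stops at the number of options; beyond it the row is zero by `h8`.
  have t8 : t.real 8 = fun i j l => if i = s.nat 5 ∧ j = s.nat 6 then 0 else s.real 8 i j l := by
    funext i j l
    rw [ht, sem_clearLottery]
    by_cases h : i = s.nat 5 ∧ j = s.nat 6
    · obtain ⟨rfl, rfl⟩ := h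
      simp only [true_and, and_self, if_true]
      split_ifs with hl
      · rfl
      · exact h8 l (not_lt.1 hl)
    · rw [if_neg fun h' => h ⟨h'.1, h'.2.1⟩, if_neg h]
  obtain ⟨h1, h2⟩ := sem_argmax (O := O) (c := gainScore) (s := t)
    (fun l => gainVal (s.nat 0) (s.nat 1) (s.nat 3) (fun j => s.real 3 j 0 0)
        (fun i j l => if i = s.nat 5 ∧ j = s.nat 6 then 0 else s.real 8 i j l)
        (s.real 4) (s.real 5) (s.nat 5) (s.nat 6) l)
    (by rw [tn 3 (by norm_num)]; exact hM) (by decide) (by decide) fun s' hn hr => by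
      have n0 := (hn 0 (by norm_num) (by norm_num) (by decide)).trans (tn 0 (by norm_num))
      have n1 := (hn 1 (by norm_num) (by norm_num) (by decide)).trans (tn 1 (by norm_num))
      have n3 := (hn 3 (by norm_num) (by norm_num) (by decide)).trans (tn 3 (by norm_num))
      have n5 := (hn 5 (by norm_num) (by norm_num) (by decide)).trans (tn 5 (by norm_num))
      have n6 := (hn 6 (by norm_num) (by norm_num) (by decide)).trans (tn 6 (by norm_num))
      have r3 := (hr 3 (by norm_num) (by decide)).trans (tr 3 (by norm_num))
      have r4 := (hr 4 (by norm_num) (by decide)).trans (tr 4 (by norm_num))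
      have r5 := (hr 5 (by norm_num) (by decide)).trans (tr 5 (by norm_num))
      have r8 := (hr 8 (by norm_num) (by decide)).trans t8
      have := sem_gainScore (O := O) s'
      rwa [n0, n1, n3, n5, n6, r3, r4, r5, r8] at this
  rw [tn 3 (by norm_num)] at h1 h2
  set t' := sem O (argmax gainScore) t with ht'
  have t5' : t'.nat 5 = s.nat 5 := (sem_nat (by decide) t).trans (tn 5 (by norm_num))
  have t6' : t'.nat 6 = s.nat 6 := (sem_nat (by decide) t).trans (tn 6 (by norm_num))
  have tr4' : t'.real 4 = s.real 4 := (sem_real (by decide) t).trans (tr 4 (by norm_num))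
  have tr8' : t'.real 8 = t.real 8 := sem_real (by decide) t
  have hfin : sem O pickPrice s = sem O (.seq
    (.setReal 8 (.reg 5) (.reg 6) (.reg 8) (.const 1))
    (.setReal 1 (.reg 5) (.reg 6) (.const 0) (.cell 4 (.reg 5) (.reg 6) (.reg 8)))) t' := rfl
  refine ⟨t'.nat 8, h1, h2, fun l => ?_, ?_⟩
  · rw [hfin]
    simp [NExp.eval, RExp.eval, t5', t6', tr8', t8]
  · rw [hfin]
    simp [NExp.eval, RExp.eval, t5', t6', tr4']

end Program

end RealRAM

/-! ### Frequencies form probability vectors -/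

section Frequency

variable {T L : ℕ} {c : ℕ → ℕ}

theorem frequency_nonneg (T : ℕ) (c : ℕ → ℕ) (l : ℕ) : 0 ≤ frequency T c l :=
  roundAvg_nonneg fun τ _ => by split_ifs <;> norm_num

theorem sum_frequency (hT : 0 < T) (hc : ∀ τ < T, c τ < L) :
    ∑ l ∈ Finset.range L, frequency T c l = 1 := by
  simpa [roundAvg_const hT] using sum_frequency_mul hc fun _ => 1

theorem frequency_eq_zero (hc : ∀ τ < T, c τ < L) {l : ℕ} (hl : L ≤ l) : frequency T c l = 0 := by
  rw [frequency, roundAvg, Finset.sum_eq_zero, mul_zero]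
  intro τ hτ
  rw [if_neg]
  have := hc τ (Finset.mem_range.1 hτ)
  omega

end Frequency

/-! ### Correctness of the derandomization -/

namespace RealRAM

namespace Program

variable {O : Oracles}

theorem gainVal_eq_optionScore {m n : ℕ} (M : ℕ) (κ : ℕ → ℝ) (ν p a : ℕ → ℕ → ℕ → ℝ)
    (e : Fin m × Fin n) (l : ℕ) :
    gainVal m n M κ (fun i j l => if i = e.1 ∧ j = e.2 then 0 else ν i j l) p a e.1 e.2 l =
      optionScore (fun j : Fin n => κ j) M (fun (e : Fin m × Fin n) l => p e.1 e.2 l)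
        (fun e l => a e.1 e.2 l) (Function.update (fun e l => ν e.1 e.2 l) e 0) e l := by
  have h : Function.update (fun e l => ν e.1 e.2 l) e 0 = fun (e' : Fin m × Fin n) l =>
      if (e'.1 : ℕ) = e.1 ∧ (e'.2 : ℕ) = e.2 then 0 else ν e'.1 e'.2 l := by
    funext e' l
    by_cases he : e' = e
    · subst he; simp
    · rw [Function.update_of_ne he, if_neg]
      exact fun h => he (Prod.ext (Fin.ext h.1) (Fin.ext h.2))
  rw [optionScore_eq _ _ _ _ _ _ (by simp), h, gainVal, Finset.sum_range, Finset.sum_range]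

/-- Replace all lotteries by single prices, which go to array 1. -/
def pickPrices : Program := forServices pickPrice

/-- The method of conditional expectations: a replacement does not lower the bound and leaves
probability vectors behind, so `quadBound_le_update` applies again to the next service. -/
theorem sem_pickPrices {m n : ℕ} (s : State) (hm : s.nat 0 = m) (hn : s.nat 1 = n)
    (hM : 0 < s.nat 3) (h0 : ∀ (e : Fin m × Fin n) l, 0 ≤ s.real 8 e.1 e.2 l)
    (h1 : ∀ e : Fin m × Fin n, ∑ l ∈ Finset.range (s.nat 3), s.real 8 e.1 e.2 l = 1)
    (hz : ∀ (e : Fin m × Fin n) l, s.nat 3 ≤ l → s.real 8 e.1 e.2 l = 0) :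
    ∃ b : Fin m × Fin n → ℕ, (∀ e, b e < s.nat 3) ∧
      (∀ e, (sem O pickPrices s).real 1 e.1 e.2 0 = s.real 4 e.1 e.2 (b e)) ∧
      quadBound (fun j : Fin n => s.real 3 j 0 0) (s.nat 3) (fun (e : Fin m × Fin n) l => s.real 4 e.1 e.2 l)
          (fun e l => s.real 5 e.1 e.2 l) (fun e l => s.real 8 e.1 e.2 l) ≤
        quadBound (fun j : Fin n => s.real 3 j 0 0) (s.nat 3) (fun (e : Fin m × Fin n) l => s.real 4 e.1 e.2 l)
          (fun e l => s.real 5 e.1 e.2 l) (fun e l => if l = b e then 1 else 0) := by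
  subst hm hn
  set Q : (Fin (s.nat 0) × Fin (s.nat 1) → ℕ → ℝ) → ℝ := quadBound
    (fun j : Fin (s.nat 1) => s.real 3 j 0 0) (s.nat 3)
    (fun (e : Fin (s.nat 0) × Fin (s.nat 1)) l => s.real 4 e.1 e.2 l)
    (fun e l => s.real 5 e.1 e.2 l) with hQ
  have := sem_forServices_induct (O := O) (c := pickPrice) (s := s)
    (fun i j r => Q (fun e l => s.real 8 e.1 e.2 l) ≤ Q (fun e l => r 8 e.1 e.2 l) ∧
      (∀ e : Fin (s.nat 0) × Fin (s.nat 1), (∀ l, 0 ≤ r 8 e.1 e.2 l) ∧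
        ∑ l ∈ Finset.range (s.nat 3), r 8 e.1 e.2 l = 1 ∧
        ∀ l, s.nat 3 ≤ l → r 8 e.1 e.2 l = 0) ∧
      ∀ e : Fin (s.nat 0) × Fin (s.nat 1), (e.1 : ℕ) < i ∨ (e.1 : ℕ) = i ∧ (e.2 : ℕ) < j →
        ∃ b < s.nat 3, (∀ l, r 8 e.1 e.2 l = if l = b then 1 else 0) ∧
          r 1 e.1 e.2 0 = s.real 4 e.1 e.2 b)
    (by decide) (by decide) ?_ ?_ ?_
  · obtain ⟨h, -, hb⟩ := this
    choose b hb1 hb2 hb3 using fun e => hb e (Or.inl e.1.2)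
    refine ⟨b, hb1, hb3, h.trans_eq (congrArg Q ?_)⟩
    funext e l
    exact hb2 e l
  · exact ⟨le_rfl, fun e => ⟨h0 e, h1 e, hz e⟩, fun e he => by omega⟩
  · rintro i hi r ⟨g1, g2, g3⟩
    refine ⟨g1, g2, fun e he => g3 e ?_⟩
    have := e.2.2
    omega
  · rintro i hi j hj s' ⟨g1, g2, g3⟩ h5 h6 hn' hr
    have n0 := hn' 0 (by norm_num) (by norm_num) (by decide)
    have n1 := hn' 1 (by norm_num) (by norm_num) (by decide)
    have n3 := hn' 3 (by norm_num) (by norm_num) (by decide)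
    have r3 := hr 3 (by decide)
    have r4 := hr 4 (by decide)
    have r5 := hr 5 (by decide)
    set e : Fin (s.nat 0) × Fin (s.nat 1) := (⟨i, hi⟩, ⟨j, hj⟩) with he
    obtain ⟨b, hb, hbest, e8, e1⟩ := sem_pickPrice (O := O) s' (by rwa [n3]) (by
      rw [n3, h5, h6]; exact (g2 e).2.2)
    have o8 := (sem_ownCells (O := O) (a := 8) (c := pickPrice) (by decide) s').2
    have o1 := (sem_ownCells (O := O) (a := 1) (c := pickPrice) (by decide) s').2
    rw [h5, h6] at hbest e8 e1 o8 o1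
    rw [n0, n1, n3, r3, r4, r5] at hbest
    rw [n3] at hb
    rw [r4] at e1
    set ν : Fin (s.nat 0) × Fin (s.nat 1) → ℕ → ℝ := fun e l => s'.real 8 e.1 e.2 l with hν
    have hsc : ∀ l < s.nat 3, _ := fun l hl => by
      have := hbest l hl
      rw [gainVal_eq_optionScore (s.nat 3) (fun j => s.real 3 j 0 0) (s'.real 8) (s.real 4)
        (s.real 5) e l, gainVal_eq_optionScore (s.nat 3) (fun j => s.real 3 j 0 0) (s'.real 8)
        (s.real 4) (s.real 5) e b] at this
      exact this
    have hle := quadBound_le_update _ _ _ _ ν e hb (g2 e).1 (g2 e).2.1 hsc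
    have hother : ∀ e' : Fin (s.nat 0) × Fin (s.nat 1), e' ≠ e → (e'.1 : ℕ) ≠ i ∨ (e'.2 : ℕ) ≠ j := by
      intro e' hne
      by_contra! h
      exact hne (Prod.ext (Fin.ext h.1) (Fin.ext h.2))
    have hupd : (fun (e' : Fin (s.nat 0) × Fin (s.nat 1)) l => (sem O pickPrice s').real 8 e'.1 e'.2 l) =
        Function.update ν e fun l => if l = b then 1 else 0 := by
      funext e' l
      by_cases h : e' = e
      · rw [h, Function.update_self]; exact e8 l
      · rw [Function.update_of_ne h, o8 _ _ (hother e' h)]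
    refine ⟨g1.trans ?_, fun e' => ?_, fun e' h' => ?_⟩
    · rw [hupd]; exact hle
    · by_cases h : e' = e
      · rw [h]
        refine ⟨fun l => ?_, ?_, fun l hl => ?_⟩
        · exact (e8 l).symm ▸ by split_ifs <;> norm_num
        · rw [Finset.sum_congr rfl fun l _ => e8 l]; simp [hb]
        · exact (e8 l).trans (if_neg (by omega))
      · rw [o8 _ _ (hother e' h)]; exact g2 e'
    · by_cases h : e' = e
      · rw [h]; exact ⟨b, hb, e8, e1⟩
      · rw [o8 _ _ (hother e' h), o1 _ _ (hother e' h)]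
        refine g3 e' ?_
        have := hother e' h
        omega

end Program

end RealRAM

/-! ## Approximately optimal prices on a grid -/

namespace Market

variable {m n : ℕ}

theorem acceptProb_nonneg (I : Market m n) (s : Service m n) (p : ℝ) : 0 ≤ I.acceptProb s p :=
  measureReal_nonneg

theorem acceptProb_le_one (I : Market m n) (s : Service m n) (p : ℝ) : I.acceptProb s p ≤ 1 :=
  measureReal_le_one

theorem acceptProb_antitone (I : Market m n) (s : Service m n) : Antitone (I.acceptProb s) :=
  fun _ _ h => measureReal_mono fun _ hv => h.trans hv

/-- `b x` is a price of at least `x` whose revenue is almost as large as that of any other such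
price; the error is relative to the revenue of `b 0`. -/
structure IsNearlyBest (I : Market m n) (θ : ℝ) (s : Service m n) (b : ℝ → ℝ) : Prop where
  le : ∀ x, 0 ≤ x → x ≤ b x
  revenue_le : ∀ x q, 0 ≤ x → x ≤ q →
    q * I.acceptProb s q ≤ b x * I.acceptProb s (b x) + θ * (b 0 * I.acceptProb s (b 0))

variable {I : Market m n} {θ N V : ℝ} {s : Service m n} {b : ℝ → ℝ}

namespace IsNearlyBest

theorem revenue_le_of_le (hb : I.IsNearlyBest θ s b) (hθ : 0 ≤ θ)
    (hV : b 0 * I.acceptProb s (b 0) ≤ V) {q : ℝ} (hq : 0 ≤ q) :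
    q * I.acceptProb s q ≤ (1 + θ) * V := by
  have h1 := hb.revenue_le 0 q le_rfl hq
  have h2 := mul_le_mul_of_nonneg_left hV hθ
  linarith

/-- The grid must reach far beyond the largest charge `14 * N * V`, so that prices past its end sell
too rarely for charges to matter. The `- 1` for the last index is absorbed by lowering `300000` to
`290000`. -/
theorem grid_top_le (hN : 1 ≤ N) (hV : 0 < V) {M : ℕ} (hM : 300000 * N ^ 5 ≤ M) :
    2900 * N ^ 3 * V ≤ ((M - 1 : ℕ) : ℝ) * (V / (100 * (N * N))) := by
  have h5 : 1 ≤ N ^ 5 := one_le_pow₀ hN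
  have hM1 : 1 ≤ M := by
    have : (0 : ℝ) < M := by linarith
    exact_mod_cast this
  rw [Nat.cast_sub hM1, Nat.cast_one]
  have h1 : 290000 * N ^ 5 ≤ (M : ℝ) - 1 := by linarith
  calc 2900 * N ^ 3 * V = 290000 * N ^ 5 * (V / (100 * (N * N))) := by
        field_simp; ring
    _ ≤ _ := mul_le_mul_of_nonneg_right h1 (by positivity)

/-- Round `q` down to a grid point. If the nearly best price above that point is at least `q`, it
earns almost as much and incurs no larger expected charge. Otherwise it lies less than a grid width
below `q` and sells at least as often. If `q` is beyond the grid, the last option is nearly as good.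
-/
theorem profit_le (hb : I.IsNearlyBest θ s b) (hN : 1 ≤ N) (hθ : θ = 1 / (200 * N ^ 2))
    (hV : 0 < V) (hr : b 0 * I.acceptProb s (b 0) ≤ V) {M : ℕ} (hM : 300000 * N ^ 5 ≤ M)
    {t ψ : ℝ} (ht0 : 0 ≤ t) (ht : t ≤ 14 * N * V) (hψ0 : 0 ≤ ψ)
    (hψ : ∀ l < M, (b (l * (V / (100 * (N * N)))) - t) *
      I.acceptProb s (b (l * (V / (100 * (N * N))))) ≤ ψ) {q : ℝ} (hq : 0 ≤ q) :
    (q - t) * I.acceptProb s q ≤ ψ + V / (50 * N ^ 2) := by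
  set δ := V / (100 * (N * N)) with hδ
  have hN0 : 0 < N := by linarith
  have hδ0 : 0 < δ := by positivity
  have hδV : V / (50 * N ^ 2) = 2 * δ := by rw [hδ]; field_simp; ring
  have hθV : θ * V = δ / 2 := by rw [hδ, hθ]; field_simp; ring
  have hθ0 : 0 ≤ θ := by rw [hθ]; positivity
  have hr' : θ * (b 0 * I.acceptProb s (b 0)) ≤ δ / 2 :=
    hθV ▸ mul_le_mul_of_nonneg_left hr hθ0
  rw [hδV]
  have hM1 : 1 ≤ M := by
    have h5 : 1 ≤ N ^ 5 := one_le_pow₀ hN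
    have : (0 : ℝ) < M := by linarith
    exact_mod_cast this
  rcases lt_or_ge q t with hqt | hqt
  · have := mul_nonneg (sub_nonneg.2 hqt.le) (I.acceptProb_nonneg s q)
    linarith
  rcases le_or_gt q ((M - 1 : ℕ) * δ) with hqM | hqM
  · set l := ⌊q / δ⌋₊ with hl
    have hl1 : (l : ℝ) * δ ≤ q := (le_div_iff₀ hδ0).1 (Nat.floor_le (by positivity))
    have hl2 : q < ((l : ℝ) + 1) * δ := (div_lt_iff₀ hδ0).1 (Nat.lt_floor_add_one _)
    have hlM : l < M := by
      have : (l : ℝ) ≤ (M - 1 : ℕ) := le_of_mul_le_mul_right (hl1.trans hqM) hδ0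
      have : l ≤ M - 1 := by exact_mod_cast this
      omega
    have hx0 : 0 ≤ (l : ℝ) * δ := by positivity
    have hxb := hb.le _ hx0
    have hψl := hψ l hlM
    set x := (l : ℝ) * δ with hx
    have a0 := I.acceptProb_nonneg s (b x)
    have a1 := I.acceptProb_le_one s (b x)
    rcases le_or_gt q (b x) with hqb | hqb
    · have h1 := hb.revenue_le x q hx0 hl1
      have h2 := mul_le_mul_of_nonneg_left (I.acceptProb_antitone s hqb) ht0
      linarith
    · have h1 := mul_le_mul_of_nonneg_left (I.acceptProb_antitone s hqb.le) (sub_nonneg.2 hqt)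
      have h2 : (q - b x) * I.acceptProb s (b x) ≤ δ * 1 :=
        mul_le_mul (by linarith) a1 a0 hδ0.le
      linarith
  · have htop := grid_top_le hN hV hM
    rw [← hδ] at htop
    have hψl := hψ (M - 1) (by omega)
    have hx0 : 0 ≤ ((M - 1 : ℕ) : ℝ) * δ := by positivity
    have hxb := hb.le _ hx0
    set x := ((M - 1 : ℕ) : ℝ) * δ with hx
    have a0 := I.acceptProb_nonneg s (b x)
    have h1 := hb.revenue_le x q hx0 hqM.le
    have h2 := hb.revenue_le_of_le hθ0 hr (hx0.trans hxb)
    have h3 : 0 ≤ t * I.acceptProb s q := mul_nonneg ht0 (I.acceptProb_nonneg s q)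
    -- A price of at least `2900 * N ^ 3 * V` with revenue at most `2 * V` is accepted so rarely
    -- that the expected charge stays below the grid width `δ`.
    have h4 : 2900 * N ^ 3 * V * I.acceptProb s (b x) ≤ (1 + θ) * V :=
      (mul_le_mul_of_nonneg_right (htop.trans hxb) a0).trans h2
    have h5 : θ ≤ 1 := by
      rw [hθ, div_le_one (by positivity)]
      nlinarith
    have h6 : t * I.acceptProb s (b x) ≤ δ := by
      have e1 : t * I.acceptProb s (b x) ≤ 14 * N * V * I.acceptProb s (b x) :=
        mul_le_mul_of_nonneg_right ht a0
      have e2 : 2900 * N ^ 3 * V * I.acceptProb s (b x) ≤ 2 * V := by nlinarith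
      have e3 : 14 * N * V * I.acceptProb s (b x) =
          14 / (2900 * (N * N)) * (2900 * N ^ 3 * V * I.acceptProb s (b x)) := by
        field_simp
      have e4 : 14 / (2900 * (N * N)) * (2900 * N ^ 3 * V * I.acceptProb s (b x)) ≤
          14 / (2900 * (N * N)) * (2 * V) := mul_le_mul_of_nonneg_left e2 (by positivity)
      have e5 : 14 / (2900 * (N * N)) * (2 * V) = 28 / 29 * δ := by
        rw [hδ]; field_simp; ring
      linarith
    linarith

end IsNearlyBest


/-- The options that the grid prices `b s` provide, for services that can be given at all. -/
structure IsGrid (I : Market m n) (N V : ℝ) (M : ℕ) (b : Service m n → ℝ → ℝ)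
    (p a : Service m n → ℕ → ℝ) : Prop where
  size : N = m + n + 1
  length : 300000 * N ^ 5 ≤ M
  nearlyBest : ∀ s, 0 < I.usableCopies s.2 → I.IsNearlyBest (1 / (200 * N ^ 2)) s (b s)
  V_nonneg : 0 ≤ V
  le_V : ∀ s, 0 < I.usableCopies s.2 → b s 0 * I.acceptProb s (b s 0) ≤ V
  attained : V = 0 ∨ ∃ s, 0 < I.usableCopies s.2 ∧ V = b s 0 * I.acceptProb s (b s 0)
  price : ∀ s, 0 < I.usableCopies s.2 → ∀ l < M, p s l = b s (l * (V / (100 * (N * N))))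
  prob : ∀ s, 0 < I.usableCopies s.2 → ∀ l < M, a s l = I.acceptProb s (p s l)
  unusable : ∀ s, ¬ 0 < I.usableCopies s.2 → ∀ l < M, p s l = 0 ∧ a s l = 0

namespace IsGrid

variable {I : Market m n} {N V : ℝ} {M : ℕ} {b : Service m n → ℝ → ℝ}
  {p a : Service m n → ℕ → ℝ}

theorem one_le (h : I.IsGrid N V M b p a) : 1 ≤ N := by
  have := h.size
  have h1 : (0 : ℝ) ≤ m := Nat.cast_nonneg m
  have h2 : (0 : ℝ) ≤ n := Nat.cast_nonneg n
  linarith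

theorem length_pos (h : I.IsGrid N V M b p a) : 0 < M := by
  have h5 : 1 ≤ N ^ 5 := one_le_pow₀ h.one_le
  have : (0 : ℝ) < M := by linarith [h.length]
  exact_mod_cast this

theorem point_nonneg (h : I.IsGrid N V M b p a) (l : ℕ) : 0 ≤ l * (V / (100 * (N * N))) := by
  have := h.one_le
  have := h.V_nonneg
  positivity

theorem p_nonneg (h : I.IsGrid N V M b p a) (s : Service m n) {l : ℕ} (hl : l < M) :
    0 ≤ p s l := by
  by_cases hs : 0 < I.usableCopies s.2
  · rw [h.price s hs l hl]
    exact (h.point_nonneg l).trans ((h.nearlyBest s hs).le _ (h.point_nonneg l))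
  · exact (h.unusable s hs l hl).1.ge

theorem theta_nonneg (N : ℝ) : 0 ≤ 1 / (200 * N ^ 2) := by positivity

theorem theta_le (h : I.IsGrid N V M b p a) : 1 / (200 * N ^ 2) ≤ 1 := by
  have := h.one_le
  rw [div_le_one (by positivity)]
  nlinarith

theorem revenue_le (h : I.IsGrid N V M b p a) (s : Service m n) {l : ℕ} (hl : l < M) :
    p s l * a s l ≤ 2 * V := by
  have hV := h.V_nonneg
  by_cases hs : 0 < I.usableCopies s.2
  · rw [h.prob s hs l hl]
    refine ((h.nearlyBest s hs).revenue_le_of_le (theta_nonneg N) (h.le_V s hs)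
      (h.p_nonneg s hl)).trans ?_
    nlinarith [h.theta_le]
  · rw [(h.unusable s hs l hl).1, zero_mul]
    linarith

theorem prob_eq (h : I.IsGrid N V M b p a) (s : Service m n) {l : ℕ} (hl : l < M) :
    a s l = I.usableProb s (p s l) := by
  unfold usableProb
  split_ifs with hs
  · exact h.prob s hs l hl
  · exact (h.unusable s hs l hl).2

theorem isOptionTable (h : I.IsGrid N V M b p a) (hV : 0 < V) :
    IsOptionTable N V (fun j => (I.usableCopies j : ℝ)) M p a := by
  have hN := h.one_le
  refine ⟨?_, hN, h.V_nonneg, fun j => ?_, fun j => ?_, fun e he l hl => ?_, fun e l hl => ?_,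
    fun e l hl => ?_, fun e l hl => h.p_nonneg e hl, fun e l hl => h.revenue_le e hl,
    fun e t ht0 ht => ?_⟩
  · rw [h.size, Fintype.card_fin, Fintype.card_fin]
    linarith
  · rcases Nat.eq_zero_or_pos (I.usableCopies j) with hj | hj
    · exact Or.inl (by rw [hj, Nat.cast_zero])
    · exact Or.inr (by exact_mod_cast hj)
  · have h1 : I.usableCopies j ≤ m := min_le_right _ _
    have h2 : (I.usableCopies j : ℝ) ≤ m := by exact_mod_cast h1
    have h3 : (0 : ℝ) ≤ n := Nat.cast_nonneg n
    linarith [h.size]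
  · refine (h.unusable e ?_ l hl).2
    have : I.usableCopies e.2 = 0 := by exact_mod_cast he
    omega
  · rw [h.prob_eq e hl, usableProb]
    split_ifs
    · exact I.acceptProb_nonneg _ _
    · exact le_rfl
  · rw [h.prob_eq e hl, usableProb]
    split_ifs
    · exact I.acceptProb_le_one _ _
    · exact zero_le_one
  -- The last option is priced above every charge in question, or belongs to an unusable service and
  -- earns exactly zero.
  · have hM := h.length_pos
    refine ⟨M - 1, by omega, ?_⟩
    by_cases hs : 0 < I.usableCopies e.2
    · rw [h.prob e hs _ (by omega)]
      refine mul_nonneg (sub_nonneg.2 ?_) (I.acceptProb_nonneg _ _)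
      rw [h.price e hs _ (by omega)]
      refine le_trans ?_ ((h.nearlyBest e hs).le _ (h.point_nonneg _))
      refine le_trans ?_ (IsNearlyBest.grid_top_le hN hV h.length)
      refine ht.trans (mul_le_mul_of_nonneg_right ?_ hV.le)
      have : N ^ 1 ≤ N ^ 3 := pow_le_pow_right₀ hN (by norm_num)
      linarith
    · rw [(h.unusable e hs _ (by omega)).2, mul_zero]

/-- Arbitrary prices beat the grid by at most `V / (50 * N ^ 2)` per service. There are at most `N ^
2` services, which is what the term `V / 50` in `hq` is reserved for, and `6.75` is the inverse of
`4 / 27`. -/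
theorem isTruthfulApproxOPM_of_dual (h : I.IsGrid N V M b p a) (hV : 0 < V)
    {u : Fin m → ℝ} {w : Fin n → ℝ} {ψ : Service m n → ℝ} (hu : ∀ i, 0 ≤ u i)
    (hw : ∀ j, 0 ≤ w j) (hψ0 : ∀ e, 0 ≤ ψ e) (huw : ∀ i j, u i + w j ≤ 14 * N * V)
    (hψ : ∀ e : Service m n, ∀ l < M, (p e l - (u e.1 + w e.2)) * a e l ≤ ψ e)
    {c : Service m n → ℕ} (hc : ∀ e, c e < M)
    (hq : 4 / 27 * (∑ i, u i + ∑ j, I.usableCopies j * w j + ∑ e, ψ e + V / 50) ≤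
      quadBound (fun j => (I.usableCopies j : ℝ)) M p a fun e l => if l = c e then 1 else 0)
    {q : Service m n → ℝ≥0} (hqc : ∀ e, (q e : ℝ) = p e (c e)) :
    I.IsTruthfulApproxOPM 6.75 q := by
  have hN := h.one_le
  refine I.isTruthfulApproxOPM_of_le 6.75 q u w (fun e => ψ e + V / (50 * N ^ 2)) hu hw
    (fun e => add_nonneg (hψ0 e) (by positivity)) (fun e he x hx => ?_) ?_
  · refine (h.nearlyBest e he).profit_le hN rfl hV (h.le_V e he) h.length
      (add_nonneg (hu _) (hw _)) (huw _ _) (hψ0 e) (fun l hl => ?_) hx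
    have := hψ e l hl
    rwa [h.prob e he l hl, h.price e he l hl] at this
  · rw [quadBound_pure _ _ _ hc] at hq
    simp only [hqc, ← h.prob_eq _ (hc _)]
    have e1 : ∑ e : Service m n, (ψ e + V / (50 * N ^ 2)) ≤ ∑ e, ψ e + V / 50 := by
      rw [Finset.sum_add_distrib, Finset.sum_const, Finset.card_univ, nsmul_eq_mul,
        Fintype.card_prod, Fintype.card_fin, Fintype.card_fin, Nat.cast_mul]
      have h1 : (0 : ℝ) ≤ m := Nat.cast_nonneg m
      have h2 : (0 : ℝ) ≤ n := Nat.cast_nonneg n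
      have h3 : (m : ℝ) * n ≤ N ^ 2 := by rw [h.size]; nlinarith
      have h4 : (m : ℝ) * n * (V / (50 * N ^ 2)) ≤ N ^ 2 * (V / (50 * N ^ 2)) :=
        mul_le_mul_of_nonneg_right h3 (by positivity)
      have h5 : N ^ 2 * (V / (50 * N ^ 2)) = V / 50 := by field_simp
      linarith
    have e2 : ((6.75 : ℝ≥0) : ℝ) = 27 / 4 := by push_cast; norm_num
    rw [e2]
    linarith

/-- If no usable service can earn anything, zero charges are a dual solution of value zero, and any
options will do. The case is separate because the analysis of the dynamics divides by a positive
step size. -/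
theorem isTruthfulApproxOPM_of_eq_zero (h : I.IsGrid N 0 M b p a) {c : Service m n → ℕ}
    (hc : ∀ e, c e < M) {q : Service m n → ℝ≥0} (hqc : ∀ e, (q e : ℝ) = p e (c e)) :
    I.IsTruthfulApproxOPM 6.75 q := by
  refine I.isTruthfulApproxOPM_of_le 6.75 q 0 0 0 (fun _ => le_rfl) (fun _ => le_rfl)
    (fun _ => le_rfl) (fun e he x hx => ?_) ?_
  · have := (h.nearlyBest e he).revenue_le_of_le (theta_nonneg N) (h.le_V e he) hx
    simpa using this
  · have hz : ∀ e, (q e : ℝ) * I.usableProb e (q e) = 0 := fun e => by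
      rw [hqc, ← h.prob_eq e (hc e)]
      refine le_antisymm (by simpa using h.revenue_le e (hc e)) ?_
      refine mul_nonneg (h.p_nonneg e (hc e)) ?_
      rw [h.prob_eq e (hc e), usableProb]
      split_ifs
      · exact I.acceptProb_nonneg _ _
      · exact le_rfl
    have hz2 : ∀ e e', I.usableProb e (q e) * I.usableProb e' (q e') * max (q e : ℝ) (q e') = 0 := by
      intro e e'
      have h1 := hz e
      have h2 := hz e'
      rcases max_choice (q e : ℝ) (q e') with hm | hm <;> rw [hm]
      · rw [mul_right_comm, mul_comm _ (q e : ℝ), h1, zero_mul]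
      · rw [mul_assoc, mul_comm _ (q e' : ℝ), h2, mul_zero]
    simp [hz, hz2]

theorem isTruthfulApproxOPM (h : I.IsGrid N V M b p a) {u : ℕ → Fin m → ℝ} {w : ℕ → Fin n → ℝ}
    {ch : ℕ → Service m n → ℕ} (hd : IsDynamics (fun j => (I.usableCopies j : ℝ)) M M p a
      (V / (100 * N * N * N)) u w ch) {c : Service m n → ℕ} (hc : ∀ e, c e < M)
    (hq : quadBound (fun j => (I.usableCopies j : ℝ)) M p a
        (fun e => frequency M fun τ => ch τ e) ≤
      quadBound (fun j => (I.usableCopies j : ℝ)) M p a fun e l => if l = c e then 1 else 0)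
    {q : Service m n → ℝ≥0} (hqc : ∀ e, (q e : ℝ) = p e (c e)) :
    I.IsTruthfulApproxOPM 6.75 q := by
  have hN := h.one_le
  rcases h.V_nonneg.eq_or_lt with hV | hV
  · subst hV
    exact h.isTruthfulApproxOPM_of_eq_zero hc hqc
  · obtain ⟨u', w', ψ, hu, hw, hψ0, huw, hψ, hle⟩ := IsDynamics.exists_dual (h.isOptionTable hV) hd
      rfl (by
        have h4 : N ^ 4 ≤ N ^ 5 := pow_le_pow_right₀ hN (by norm_num)
        have h5 : 0 ≤ N ^ 4 := by positivity
        linarith [h.length]) hV (by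
        rcases h.attained with h0 | ⟨s, hs, hs'⟩
        · exact absurd h0 hV.ne'
        -- Option `0` is the nearly best price above zero, and `V` is its revenue for a maximizing
        -- service.
        · refine ⟨s, by exact_mod_cast hs, 0, h.length_pos, ?_⟩
          rw [h.prob s hs 0 h.length_pos, h.price s hs 0 h.length_pos, Nat.cast_zero, zero_mul]
          exact hs'.le)
    exact h.isTruthfulApproxOPM_of_dual hV hu hw hψ0 huw hψ hc (hle.trans hq) hqc

end IsGrid

end Market

/-! ### The complete program -/

namespace RealRAM

namespace Program

variable {O : Oracles}

/-- The work after the number of options has been computed. -/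
def priceGrid : Program :=
  .seq capCopies (.seq maxRevenue (.seq fillTables (.seq runDynamics pickPrices)))

/-- Compute prices of an approximately optimal order-oblivious posted pricing. -/
def computePrices : Program := .seq setSize (.seq setGrid priceGrid)

/-- The state in which `priceGrid` is started. -/
noncomputable def gridState {m n : ℕ} (O : Oracles) (I : Market m n) : State :=
  sem O setGrid (sem O setSize (input I))

variable {m n : ℕ} (I : Market m n)

theorem gridState_nat : (gridState O I).nat 0 = m ∧ (gridState O I).nat 1 = n ∧
    (gridState O I).nat 2 = m + n + 1 ∧ (gridState O I).nat 3 = 300000 * (m + n + 1) ^ 5 := by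
  have h2 : (sem O setSize (input I)).nat 2 = m + n + 1 := by
    simp [setSize, NExp.eval, input]
  refine ⟨?_, ?_, ?_, ?_⟩
  · rw [gridState, sem_nat (by decide), sem_nat (by decide)]; simp [input]
  · rw [gridState, sem_nat (by decide), sem_nat (by decide)]; simp [input]
  · rw [gridState, sem_nat (by decide), h2]
  · rw [gridState, sem_setGrid, h2]

theorem gridState_real : (gridState O I).real = (input I).real := by
  funext a
  rw [gridState, sem_real (by simp [setGrid, timesSize, keepsReal]),
    sem_real (by simp [setSize, keepsReal])]

theorem gridState_real_zero (j : Fin n) : (gridState O I).real 0 j 0 0 = I.copies j := by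
  simp [gridState_real, input]

theorem gridState_real_of_ne {a : ℕ} (ha : a ≠ 0) (i j l : ℕ) :
    (gridState O I).real a i j l = 0 := by
  simp [gridState_real, input, ha]

-- Stated for nearly best prices, so that it covers exact oracles as well as oracles obtained from
-- suprema that are not attained.
set_option maxHeartbeats 2000000 in
theorem exists_outputs_computePrices
    (hacc : ∀ (i : Fin m) (j : Fin n) p, O.accept i j p = I.acceptProb (i, j) p)
    (hbest : ∀ (i : Fin m) (j : Fin n),
      I.IsNearlyBest (1 / (200 * (m + n + 1) ^ 2)) (i, j) (O.bestPrice i j)) :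
    ∃ q : Service m n → ℝ≥0, Outputs (sem O computePrices (input I)) q ∧
      I.IsTruthfulApproxOPM 6.75 q := by
  obtain ⟨g0, g1, g2, g3⟩ := gridState_nat (O := O) I
  have gz := fun a (ha : a ≠ 0) => gridState_real_of_ne (O := O) I ha
  have gc := gridState_real_zero (O := O) I
  set s₀ := gridState O I with hs₀
  have hMpos : 0 < s₀.nat 3 := by rw [g3]; positivity
  -- the numbers of usable copies
  set s₁ := sem O capCopies s₀ with hs₁
  have n₁ : ∀ y < 4, s₁.nat y = s₀.nat y := fun y hy =>
    sem_nat (by interval_cases y <;> decide) _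
  have κ₁ : ∀ j : Fin n, s₁.real 3 j 0 0 = I.usableCopies j := fun j => by
    rw [hs₁, sem_capCopies _ _ (by rw [g1]; exact j.2), gc, g0, Market.usableCopies, Nat.cast_min]
  have r₁ : ∀ a, a ≠ 3 → s₁.real a = s₀.real a := fun a ha =>
    sem_real (by simp [capCopies, keepsReal, ha.symm]) _
  -- the largest monopoly revenue
  set s₂ := sem O maxRevenue s₁ with hs₂
  have n₂ : ∀ y < 4, s₂.nat y = s₀.nat y := fun y hy =>
    (sem_nat (by interval_cases y <;> decide) _).trans (n₁ y hy)
  have r₂ : ∀ a, a ≠ 2 → s₂.real a = s₁.real a := fun a ha =>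
    sem_real (by simp [maxRevenue, forServices, keepsReal, ha.symm]) _
  obtain ⟨⟨hV0, hVle⟩, hVatt⟩ := sem_maxRevenue (O := O) s₁ (by
    rw [r₁ 2 (by norm_num)]; exact gz 2 (by norm_num) _ _ _)
  rw [← hs₂, n₁ 0 (by norm_num), n₁ 1 (by norm_num), g0, g1] at hVatt
  rw [← hs₂, n₁ 0 (by norm_num), n₁ 1 (by norm_num), g0, g1] at hVle
  rw [← hs₂] at hV0
  set V := s₂.real 2 0 0 0 with hV
  -- the tables
  set s₃ := sem O fillTables s₂ with hs₃
  have n₃ : ∀ y < 4, s₃.nat y = s₀.nat y := fun y hy =>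
    (sem_nat (by interval_cases y <;> decide) _).trans (n₂ y hy)
  have r₃ : ∀ a, a ≠ 4 → a ≠ 5 → s₃.real a = s₂.real a := fun a h4 h5 =>
    sem_real (by simp [fillTables, forServices, keepsReal, h4.symm, h5.symm]) _
  have z₂ : ∀ a, a ≠ 0 → a ≠ 2 → a ≠ 3 → ∀ i j l, s₂.real a i j l = 0 := fun a h0 h2 h3 i j l => by
    rw [r₂ a h2, r₁ a h3]; exact gz a h0 i j l
  have hfill := sem_fillTables (O := O) s₂ (z₂ 4 (by norm_num) (by norm_num) (by norm_num))
    (z₂ 5 (by norm_num) (by norm_num) (by norm_num))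
  rw [n₂ 0 (by norm_num), n₂ 1 (by norm_num), n₂ 2 (by norm_num), n₂ 3 (by norm_num), g0, g1, g2,
    ← hs₃, ← hV, r₂ 3 (by norm_num)] at hfill
  set M := s₀.nat 3 with hM
  set N : ℝ := m + n + 1 with hN
  have hN' : ((m + n + 1 : ℕ) : ℝ) = N := by push_cast; rfl
  rw [hN'] at hfill
  have hpos : ∀ j : Fin n, 0 < s₁.real 3 j 0 0 ↔ 0 < I.usableCopies j := fun j => by
    rw [κ₁, Nat.cast_pos]
  have hgrid : I.IsGrid N V M (fun e => O.bestPrice e.1 e.2) (fun e l => s₃.real 4 e.1 e.2 l)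
      (fun e l => s₃.real 5 e.1 e.2 l) := by
    refine ⟨rfl, ?_, fun e _ => hbest e.1 e.2, hV0, fun e he => ?_, ?_, fun e he l hl => ?_,
      fun e he l hl => ?_, fun e he l hl => ?_⟩
    · rw [g3]; push_cast; rfl
    · have := hVle e.1 e.1.2 e.2 e.2.2 ((hpos e.2).2 he)
      rwa [hacc] at this
    · refine hVatt.imp id ?_
      rintro ⟨i, hi, j, hj, hp, he⟩
      refine ⟨(⟨i, hi⟩, ⟨j, hj⟩), (hpos ⟨j, hj⟩).1 hp, he.trans ?_⟩
      exact congrArg _ (hacc ⟨i, hi⟩ ⟨j, hj⟩ _)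
    · exact (((hfill e.1 e.1.2 e.2 e.2.2).1 ((hpos e.2).2 he)) l hl).1
    · rw [(((hfill e.1 e.1.2 e.2 e.2.2).1 ((hpos e.2).2 he)) l hl).2, hacc]
    · exact (hfill e.1 e.1.2 e.2 e.2.2).2 (fun h => he ((hpos e.2).1 h)) l hl
  -- the subgradient method
  set s₄ := sem O runDynamics s₃ with hs₄
  have n₄ : ∀ y < 4, s₄.nat y = s₀.nat y := fun y hy =>
    (sem_nat (by interval_cases y <;> decide) _).trans (n₃ y hy)
  have r₄ : ∀ a, a = 3 ∨ a = 4 ∨ a = 5 → s₄.real a = s₃.real a := by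
    rintro a (rfl | rfl | rfl) <;> exact sem_real (by decide) _
  have z₃ : ∀ a, 6 ≤ a → ∀ i j l, s₃.real a i j l = 0 := fun a ha i j l => by
    rw [r₃ a (by omega) (by omega)]
    exact z₂ a (by omega) (by omega) (by omega) i j l
  have n₃M : s₃.nat 3 = M := n₃ 3 (by norm_num)
  have κ₃ : (fun j : Fin n => s₃.real 3 j 0 0) = fun j => (I.usableCopies j : ℝ) := by
    funext j
    rw [r₃ 3 (by norm_num) (by norm_num), r₂ 3 (by norm_num), κ₁]
  have hstep : stepVal s₃ = V / (100 * N * N * N) := by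
    rw [stepVal, r₃ 2 (by norm_num) (by norm_num), n₃ 2 (by norm_num), g2, hN', ← hV]
  obtain ⟨u, w, ch, hd, hν⟩ := sem_runDynamics (O := O) s₃ ((n₃ 0 (by norm_num)).trans g0)
    ((n₃ 1 (by norm_num)).trans g1) (by rw [n₃M]; exact hMpos) (fun i => z₃ 6 le_rfl i 0 0)
    (fun j => z₃ 7 (by norm_num) j 0 0) (z₃ 8 (by norm_num))
  rw [κ₃, hstep, n₃M] at hd
  rw [n₃M, ← hs₄] at hν
  -- derandomization
  have n₄M : s₄.nat 3 = M := n₄ 3 (by norm_num)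
  obtain ⟨c, hc, hout, hq⟩ := sem_pickPrices (O := O) (m := m) (n := n) s₄
    ((n₄ 0 (by norm_num)).trans g0) ((n₄ 1 (by norm_num)).trans g1) (by rw [n₄M]; exact hMpos)
    (fun e l => by rw [hν]; exact frequency_nonneg _ _ _)
    (fun e => by
      rw [n₄M, Finset.sum_congr rfl fun l _ => hν e.1 e.2 l]
      exact sum_frequency hMpos fun τ hτ => hd.ch_lt τ hτ e)
    (fun e l hl => by
      rw [hν]
      exact frequency_eq_zero (fun τ hτ => hd.ch_lt τ hτ e) (by rwa [n₄M] at hl))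
  rw [n₄M] at hc
  rw [r₄ 3 (by norm_num), r₄ 4 (by norm_num), r₄ 5 (by norm_num), n₄M, κ₃] at hq
  rw [r₄ 4 (by norm_num)] at hout
  have hfin : sem O computePrices (input I) = sem O pickPrices s₄ := rfl
  refine ⟨fun e => ⟨s₃.real 4 e.1 e.2 (c e), hgrid.p_nonneg e (hc e)⟩, fun i j => ?_,
    hgrid.isTruthfulApproxOPM hd hc ?_ fun _ => rfl⟩
  · rw [hfin]; exact hout (i, j)
  · refine Eq.trans_le ?_ hq
    congr 1
    funext e l
    exact (hν e.1 e.2 l).symm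

/-! ### Running time -/

open Polynomial in
/-- A bound on the running time of `computePrices` in terms of the number of agents and items. -/
noncomputable def computePricesCost : Polynomial ℕ :=
  setSize.costPoly + setGrid.costPoly.comp (X + 1) +
    priceGrid.costPoly.comp (C 300000 * (X + 1) ^ 5)

/-- `steps_le` forbids assignments to loop bounds, but registers 2 and 3 are computed on the way.
The program is therefore split into three stages with `R = 2, 3, 4`, and the bounds on the registers
are composed with the cost polynomials. -/
theorem steps_computePrices_le :
    (computePrices.run O (input I)).2 ≤ computePricesCost.eval (m + n) := by
  have h1 : steps O setSize (input I) ≤ setSize.costPoly.eval (m + n) := by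
    refine steps_le (R := 2) (by decide) _ fun r hr => ?_
    interval_cases r <;> simp [input]
  have h2 : steps O setGrid (sem O setSize (input I)) ≤ setGrid.costPoly.eval (m + n + 1) := by
    refine steps_le (R := 3) (by decide) _ fun r hr => ?_
    interval_cases r
    · rw [sem_nat (by decide)]; simp [input]; omega
    · rw [sem_nat (by decide)]; simp [input]; omega
    · simp [setSize, NExp.eval, input]
  have h3 : steps O priceGrid (gridState O I) ≤
      priceGrid.costPoly.eval (300000 * (m + n + 1) ^ 5) := by
    obtain ⟨g0, g1, g2, g3⟩ := gridState_nat (O := O) I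
    have hle : m + n + 1 ≤ 300000 * (m + n + 1) ^ 5 :=
      (Nat.le_self_pow (by norm_num) _).trans (Nat.le_mul_of_pos_left _ (by norm_num))
    refine steps_le (R := 4) (by decide) _ fun r hr => ?_
    interval_cases r
    · rw [g0]; omega
    · rw [g1]; omega
    · rw [g2]; exact hle
    · rw [g3]
  have h4 : (computePrices.run O (input I)).2 = steps O setSize (input I) +
      (steps O setGrid (sem O setSize (input I)) + steps O priceGrid (gridState O I)) := rfl
  rw [h4, computePricesCost]
  simp only [Polynomial.eval_add, Polynomial.eval_comp, Polynomial.eval_mul, Polynomial.eval_pow,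
    Polynomial.eval_X, Polynomial.eval_one, Polynomial.eval_C]
  omega

end Program

end RealRAM

/-! ### Existence of prices from finite suprema -/

namespace Market

variable {m n : ℕ}

/-- Finite suprema give prices with an absolute error. To make it relative to the revenue of `b 0`,
fix a price of positive revenue `r₀`: with error at most `r₀ / 2`, `b 0` earns at least `r₀ / 2`, so
the error `θ * (r₀ / 2)` is small enough. If all revenues vanish, any choice works. -/
theorem exists_isNearlyBest {I : Market m n} {s : Service m n} {B θ : ℝ}
    (hB : ∀ p : ℝ, 0 ≤ p → p * I.acceptProb s p ≤ B) (hθ : 0 < θ) :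
    ∃ b, I.IsNearlyBest θ s b := by
  set S : ℝ → Set ℝ := fun x => (fun p => p * I.acceptProb s p) '' Set.Ici x with hS
  have hbdd : ∀ x, 0 ≤ x → BddAbove (S x) := fun x hx =>
    ⟨B, by rintro _ ⟨p, hp, rfl⟩; exact hB p (hx.trans hp)⟩
  have hne : ∀ x, (S x).Nonempty := fun x => ⟨_, x, Set.mem_Ici.2 le_rfl, rfl⟩
  have happrox : ∀ ε > 0, ∀ x, 0 ≤ x → ∃ y, x ≤ y ∧ ∀ q, x ≤ q →
      q * I.acceptProb s q ≤ y * I.acceptProb s y + ε := by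
    intro ε hε x hx
    obtain ⟨_, ⟨y, hy, rfl⟩, hlt⟩ := exists_lt_of_lt_csSup (hne x) (sub_lt_self (sSup (S x)) hε)
    refine ⟨y, hy, fun q hq => ?_⟩
    have := le_csSup (hbdd x hx) ⟨q, hq, rfl⟩
    simp only at this hlt
    linarith
  have hnn : ∀ p, 0 ≤ p → 0 ≤ p * I.acceptProb s p := fun p hp =>
    mul_nonneg hp (I.acceptProb_nonneg s p)
  by_cases hz : ∀ q, 0 ≤ q → q * I.acceptProb s q = 0
  · exact ⟨id, fun x _ => le_rfl, fun x q hx hq => by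
      simp [hz x hx, hz q (hx.trans hq)]⟩
  · push Not at hz
    obtain ⟨p₀, hp₀, hne₀⟩ := hz
    have hr₀ : 0 < p₀ * I.acceptProb s p₀ := lt_of_le_of_ne (hnn p₀ hp₀) (Ne.symm hne₀)
    set r₀ := p₀ * I.acceptProb s p₀ with hr
    have hε : 0 < min (r₀ / 2) (θ * (r₀ / 2)) := lt_min (by positivity) (by positivity)
    have : ∀ x, ∃ y, 0 ≤ x → x ≤ y ∧ ∀ q, x ≤ q →
        q * I.acceptProb s q ≤ y * I.acceptProb s y + min (r₀ / 2) (θ * (r₀ / 2)) := by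
      intro x
      by_cases hx : 0 ≤ x
      · obtain ⟨y, hy⟩ := happrox _ hε x hx
        exact ⟨y, fun _ => hy⟩
      · exact ⟨0, fun h => absurd h hx⟩
    choose b hb using this
    refine ⟨b, fun x hx => (hb x hx).1, fun x q hx hq => ?_⟩
    have h1 := (hb x hx).2 q hq
    have h2 := (hb 0 le_rfl).2 p₀ hp₀
    have h3 := min_le_left (r₀ / 2) (θ * (r₀ / 2))
    have h4 := min_le_right (r₀ / 2) (θ * (r₀ / 2))
    have h5 : θ * (r₀ / 2) ≤ θ * (b 0 * I.acceptProb s (b 0)) :=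
      mul_le_mul_of_nonneg_left (by linarith) hθ.le
    linarith

/-- The program serves as a proof of existence: its correctness holds for any oracles with the
required properties, in particular for noncomputable ones. -/
theorem exists_isTruthfulApproxOPM {I : Market m n} (h : I.FiniteMonopolyRevenue) :
    ∃ p : Service m n → ℝ≥0, I.IsTruthfulApproxOPM 6.75 p := by
  have : ∀ s, ∃ b, I.IsNearlyBest (1 / (200 * (m + n + 1) ^ 2)) s b := fun s => by
    obtain ⟨B, hB⟩ := h s
    exact exists_isNearlyBest hB (by positivity)
  choose b hb using this
  set O : RealRAM.Oracles :=
    { accept := fun i j p => if h : i < m ∧ j < n then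
        I.acceptProb (⟨i, h.1⟩, ⟨j, h.2⟩) p else 0
      -- A dummy is enough, as `computePrices` never asks for quantiles.
      quantile := fun _ _ _ => 0
      bestPrice := fun i j x => if h : i < m ∧ j < n then b (⟨i, h.1⟩, ⟨j, h.2⟩) x else 0 } with hO
  obtain ⟨q, -, hq⟩ := RealRAM.Program.exists_outputs_computePrices (O := O) I
    (fun i j p => by simp [hO]) fun i j => by
      have : O.bestPrice i j = b (i, j) := by funext x; simp [hO]
      rw [this]
      exact hb (i, j)
  exact ⟨q, hq⟩

end Market

theorem RealRAM.Oracles.Describe.isNearlyBest {m n : ℕ} {I : Market m n} {O : RealRAM.Oracles}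
    (h : O.Describe I) {θ : ℝ} (hθ : 0 ≤ θ) (i : Fin m) (j : Fin n) :
    I.IsNearlyBest θ (i, j) (O.bestPrice i j) := by
  obtain ⟨-, -, hbest⟩ := h i j
  refine ⟨fun x hx => (hbest x hx).1, fun x q hx hq => ?_⟩
  have h1 := (hbest x hx).2 q hq
  have h2 : 0 ≤ O.bestPrice i j 0 * I.acceptProb (i, j) (O.bestPrice i j 0) :=
    mul_nonneg (hbest 0 le_rfl).1 (I.acceptProb_nonneg _ _)
  linarith [mul_nonneg hθ h2]

theorem mainTheorem11 :
    (∀ (m n : ℕ) (I : Market m n), I.FiniteMonopolyRevenue →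
      ∃ p : Service m n → ℝ≥0, I.IsTruthfulApproxOPM 6.75 p) ∧
    ∃ (A : RealRAM.Program) (P : Polynomial ℕ),
      ∀ (m n : ℕ) (I : Market m n) (O : RealRAM.Oracles), O.Describe I →
        (A.run O (RealRAM.input I)).2 ≤ P.eval (m + n) ∧
        ∃ p : Service m n → ℝ≥0,
          RealRAM.Outputs (A.run O (RealRAM.input I)).1 p ∧ I.IsTruthfulApproxOPM 6.75 p :=
  ⟨fun _ _ _ h => Market.exists_isTruthfulApproxOPM h, RealRAM.Program.computePrices,
    RealRAM.Program.computePricesCost, fun _ _ I _ h =>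
      ⟨RealRAM.Program.steps_computePrices_le I,
        RealRAM.Program.exists_outputs_computePrices I (fun i j => (h i j).1)
          fun i j => h.isNearlyBest (by positivity) i j⟩⟩
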